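/- Let $(\mathcal X,d_0)$ be a compact metric space with $d_0\le 1$, equipped with its Borel $\sigma$-algebra, and let $\mathfrak N$ be the space of finite point measures $\xi=\sum_{i=1}^{n}\delta_{x_i}$ on $\mathcal X$, with $|\xi|=n$, equipped with the smallest $\sigma$-algebra making all point counts $\xi\mapsto\xi(A)$ ($A$ Borel) measurable. For $p\in[1,\infty]$ and $\xi=\sum_{i=1}^{|\xi|}\delta_{x_i}$, $\eta=\sum_{i=1}^{|\eta|}\delta_{y_i}$ put $d_1^{(p)}(\xi,\eta)=1$ if $|\xi|\ne|\eta|$, $d_1^{(p)}(\xi,\eta)=0$ if $|\xi|=|\eta|=0$, and, if $|\xi|=|\eta|=n\ge1$, $$d_1^{(p)}(\xi,\eta)=\min_{\pi}\Big(\tfrac1n\sum_{i=1}^n d_0(x_i,y_{\pi(i)})^p\Big)^{1/p}\ (p<\infty),\qquad d_1^{(\infty)}(\xi,\eta)=\min_{\pi}\max_{1\le i\le n}d_0(x_i,y_{\pi(i)}),$$ the minimum being over the permutations $\pi$ of $\{1,\dots,n\}$. Let $\mathcal F_2^{(p)}$ be the set of all $f:\mathfrak N\to[0,1]$ with $|f(\xi)-f(\eta)|\le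 d_1^{(p)}(\xi,\eta)$ for all $\xi,\eta\in\mathfrak N$. For $n=|\xi|\le m=|\eta|$ let $d_1'(\xi,\eta)=(m-n)+\min_{\pi}\sum_{i=1}^n d_0(x_i,y_{\pi(i)})$, the minimum being over the permutations $\pi$ of $\{1,\dots,m\}$, and let $d_1'(\xi,\eta)=d_1'(\eta,\xi)$ if $n>m$. Let $\boldsymbol\lambda$ be a finite measure on $\mathcal X$ with total mass $\lambda=\boldsymbol\lambda(\mathcal X)>0$, let $\mathrm{Po}(\boldsymbol\lambda)$ be the distribution of the Poisson process with expectation measure $\boldsymbol\lambda$, and for $\xi\in\mathfrak N$ let $(\mathbf Z_\xi(t))_{t\ge0}$ be the spatial immigration-death process with immigration measure $\boldsymbol\lambda$ and unit per capita death rate started in $\xi$, that is, the pure jump Markov process on $\mathfrak N$ which jumps from $\zeta$ to $\zeta+\delta_x$ at rate $\boldsymbol\lambda(dx)$ and from $\zeta$ to $\zeta-\delta_x$ at rate $\zeta(dx)$. For $f\in\mathcal F_2^{(p)}$ let $$h(\xi)=h_f(\xi)=-\int_0^\infty\big[\mathbb E f(\mathbf Z_\xi(t))-\mathrm{Po}(\boldsymbol\lambda)(f)\big]\,dt,\qquad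 \xi\in\mathfrak N,$$ be the solution of the Stein equation for $\mathrm{Po}(\boldsymbol\lambda)$ and $f$. Put $$\|\Delta h\|_\infty=\sup_{\xi\in\mathfrak N,\,x\in\mathcal X}|h(\xi+\delta_x)-h(\xi)|,\qquad \|\Delta^2h\|_\infty=\sup_{\xi\in\mathfrak N;\,x,y\in\mathcal X}|h(\xi+\delta_x+\delta_y)-h(\xi+\delta_x)-h(\xi+\delta_y)+h(\xi)|.$$ With $\kappa_0=4e/(1+4e-\sqrt{1+8e})$ and $\kappa_1=2-\kappa_0$, let $$\gamma_1^{(p)}=\begin{cases}\sqrt{2/e}+2(\kappa_0e^{\kappa_0})^{-1/2},&p=1,\\[2pt] \sqrt{2/e}+2\Big(\dfrac{2-p}{p\kappa_0^{1-1/p}-\kappa_1(p-1)}\Big)^{(2-p)/(2(p-1))},&1<p\le2,\\[6pt] \dfrac p{p-1}+\dfrac1{\sqrt{2e}}\dfrac p{p-1}\Big(\dfrac{p-2}{\sqrt{2e}\,(p\kappa_0^{1-1/p}-\kappa_1(p-1))}\Big)^{(p-2)/p},&2<p<\infty\end{cases}$$ (with $0^0=1$ for $p=2$), $\gamma_2^{(p)}=\dfrac{(1+2^{1/p}+(2/3)^{1/p})\,p^2}{(p-1)(2p-1)}$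 for $1<p<\infty$, and $$c_1^{(p)}(\lambda)=\begin{cases}\min(1,\gamma_1^{(p)}\lambda^{-1/\max(2,p)}),&1\le p<\infty,\\1,&p=\infty,\end{cases}\qquad c_2^{(p)}(\lambda)=\begin{cases}\min\big(1,\tfrac{11}6[1+2\log^+(6\lambda/11)]\lambda^{-1}\big),&p=1,\\ \min(1,\gamma_2^{(p)}\lambda^{-1/p}),&1<p<\infty,\\1,&p=\infty.\end{cases}$$ Then for every $p\in[1,\infty]$ and every $f\in\mathcal F_2^{(p)}$ the function $h=h_f$ is well defined (all the integrals in its definition exist and are finite), and (i) $\|\Delta h\|_\infty\le c_1^{(p)}(\lambda)$; (ii) $\|\Delta^2h\|_\infty\le c_2^{(p)}(\lambda)$; (iii) $|(h(\xi+\delta_x)-h(\xi))-(h(\eta+\delta_x)-h(\eta))|\le c_2^{(p)}(\lambda)\,d_1'(\xi,\eta)$ for all $\xi,\eta\in\mathfrak N$ and $x\in\mathcal X$. -/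

import Mathlib

open MeasureTheory ProbabilityTheory Set
open scoped ENNReal

noncomputable section

namespace PoissonStein

/-! ### Finite point measures -/

/-- The space `𝔑` of finite point measures on `X`.  The point measure `∑ᵢ δ_{xᵢ}` is represented by
the multiset of its atoms `xᵢ`; see `toMeasure` and `toMeasure_injective`.  Addition of multisets is
addition of measures, `{x}` is `δ_x`, `0` is the null measure, `Multiset.card ξ` is `|ξ|`. -/
abbrev PointMeasure (X : Type*) := Multiset X

section Config

variable {X : Type*} [MeasurableSpace X]

/-- The measure `∑ᵢ δ_{xᵢ}` on `X` given by the multiset of the `xᵢ`. -/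
def toMeasure (ξ : PointMeasure X) : Measure X := (ξ.map Measure.dirac).sum

/-- The `σ`-algebra on `𝔑`: the smallest one for which all the point counts `ξ ↦ ξ(A)`, with
`A` a measurable subset of `X`, are measurable. -/
instance instMeasurableSpacePointMeasure : MeasurableSpace (PointMeasure X) :=
  ⨆ A : {A : Set X // MeasurableSet A},
    MeasurableSpace.comap (fun ξ : PointMeasure X => toMeasure ξ A.1) inferInstance

@[simp] lemma toMeasure_zero : toMeasure (0 : PointMeasure X) = 0 := by simp [toMeasure]

lemma toMeasure_cons (x : X) (ξ : PointMeasure X) :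
    toMeasure (x ::ₘ ξ) = Measure.dirac x + toMeasure ξ := by simp [toMeasure]

lemma toMeasure_add (ξ η : PointMeasure X) : toMeasure (ξ + η) = toMeasure ξ + toMeasure η := by
  simp [toMeasure]

lemma toMeasure_singleton (x : X) : toMeasure ({x} : PointMeasure X) = Measure.dirac x := by
  simp [toMeasure]

lemma toMeasure_univ (ξ : PointMeasure X) : toMeasure ξ univ = Multiset.card ξ := by
  induction ξ using Multiset.induction_on with
  | empty => simp
  | cons a s ih => simp [toMeasure_cons, ih, add_comm]

lemma toMeasure_singleton_set [MeasurableSingletonClass X] [DecidableEq X] (ξ : PointMeasure X)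
    (x : X) : toMeasure ξ {x} = (ξ.count x : ℝ≥0∞) := by
  induction ξ using Multiset.induction_on with
  | empty => simp
  | cons a s ih =>
    by_cases h : a = x
    · subst h; simp [toMeasure_cons, ih, add_comm]
    · simp [toMeasure_cons, ih, h, Multiset.count_cons_of_ne (Ne.symm h)]

lemma toMeasure_injective [MeasurableSingletonClass X] :
    Function.Injective (toMeasure : PointMeasure X → Measure X) := by
  classical
  intro ξ η h
  ext x
  have := congrArg (fun μ : Measure X => μ {x}) h
  simpa [toMeasure_singleton_set] using this

lemma measurable_toMeasure_apply {A : Set X} (hA : MeasurableSet A) :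
    Measurable (fun ξ : PointMeasure X => toMeasure ξ A) :=
  Measurable.of_comap_le
    (le_iSup (fun A : {A : Set X // MeasurableSet A} =>
      MeasurableSpace.comap (fun ξ : PointMeasure X => toMeasure ξ A.1) inferInstance) ⟨A, hA⟩)

lemma measurable_toMeasure : Measurable (toMeasure : PointMeasure X → Measure X) :=
  Measure.measurable_of_measurable_coe _ fun _ hA => measurable_toMeasure_apply hA

lemma measurable_pointMeasure {S : Type*} [MeasurableSpace S] {g : S → PointMeasure X}
    (h : ∀ A : Set X, MeasurableSet A → Measurable (fun s => toMeasure (g s) A)) :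
    Measurable g := by
  rw [measurable_iff_comap_le, instMeasurableSpacePointMeasure, MeasurableSpace.comap_iSup]
  refine iSup_le fun A => ?_
  rw [MeasurableSpace.comap_comp]
  exact (h A.1 A.2).comap_le

lemma measurable_card : Measurable (Multiset.card : PointMeasure X → ℕ) := by
  refine measurable_to_countable' fun n => ?_
  have : (Multiset.card : PointMeasure X → ℕ) ⁻¹' {n}
      = (fun ξ : PointMeasure X => toMeasure ξ univ) ⁻¹' {(n : ℝ≥0∞)} := by
    ext ξ; simp [toMeasure_univ]
  rw [this]
  exact measurable_toMeasure_apply MeasurableSet.univ (measurableSet_singleton _)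

lemma measurable_addPoint : Measurable (fun z : PointMeasure X × X => z.1 + {z.2}) := by
  refine measurable_pointMeasure fun A hA => ?_
  simp only [toMeasure_add, toMeasure_singleton, Measure.add_apply]
  exact ((measurable_toMeasure_apply hA).comp measurable_fst).add
    ((Measure.measurable_coe hA).comp (Measure.measurable_dirac.comp measurable_snd))

/-- The kernel `ξ ↦ ξ(dx)`. -/
def pointKernel (X : Type*) [MeasurableSpace X] : Kernel (PointMeasure X) X :=
  ⟨toMeasure, measurable_toMeasure⟩

instance isSFiniteKernel_pointKernel : IsSFiniteKernel (pointKernel X) := by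
  classical
  have hS : ∀ n : ℕ, MeasurableSet {ξ : PointMeasure X | Multiset.card ξ = n} := fun n =>
    measurable_card (measurableSet_singleton n)
  let κ : ℕ → Kernel (PointMeasure X) X := fun n => Kernel.piecewise (hS n) (pointKernel X) 0
  have hκ : ∀ n, IsFiniteKernel (κ n) := fun n => by
    refine ⟨⟨(n : ℝ≥0∞), ENNReal.natCast_lt_top n, fun ξ => ?_⟩⟩
    by_cases h : Multiset.card ξ = n
    · simp [κ, Kernel.piecewise_apply, h, pointKernel, toMeasure_univ]
    · simp [κ, Kernel.piecewise_apply, h]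
  refine ⟨κ, hκ, ?_⟩
  ext ξ A hA
  rw [Kernel.sum_apply' _ _ hA, tsum_eq_single (Multiset.card ξ)]
  · simp [κ, Kernel.piecewise_apply]
  · intro n hn
    simp [κ, Kernel.piecewise_apply, hn.symm]

end Config

section Erase

variable {X : Type*} [MeasurableSpace X] [MeasurableEq X]

open scoped Classical in
/-- The point measure `ξ - δ_x` (for an atom `x` of `ξ`). -/
def removePoint (ξ : PointMeasure X) (x : X) : PointMeasure X := ξ.erase x

lemma measurableSet_mem : MeasurableSet {z : PointMeasure X × X | z.2 ∈ z.1} := by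
  classical
  have hD : MeasurableSet {w : (PointMeasure X × X) × X | w.2 = w.1.2} :=
    measurableSet_eq_fun measurable_snd (measurable_snd.comp measurable_fst)
  let κ : Kernel (PointMeasure X × X) X := (pointKernel X).comap Prod.fst measurable_fst
  have h := Kernel.measurable_kernel_prodMk_left (κ := κ) hD
  have h2 : {z : PointMeasure X × X | z.2 ∈ z.1} = (fun z : PointMeasure X × X =>
      κ z (Prod.mk z ⁻¹' {w : (PointMeasure X × X) × X | w.2 = w.1.2})) ⁻¹' {0}ᶜ := by
    ext z
    have : (Prod.mk z ⁻¹' {w : (PointMeasure X × X) × X | w.2 = w.1.2}) = {z.2} := by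
      ext y; simp
    simp only [mem_preimage, this]
    change z.2 ∈ z.1 ↔ toMeasure z.1 {z.2} ∈ ({0}ᶜ : Set ℝ≥0∞)
    simp [toMeasure_singleton_set, Multiset.count_eq_zero]
  rw [h2]
  exact h (measurableSet_singleton _).compl

lemma measurable_removePoint :
    Measurable (fun z : PointMeasure X × X => removePoint z.1 z.2) := by
  classical
  refine measurable_pointMeasure fun A hA => ?_
  have key : (fun z : PointMeasure X × X => toMeasure (removePoint z.1 z.2) A)
      = fun z => toMeasure z.1 A -
        ({z : PointMeasure X × X | z.2 ∈ z.1} ∩ Prod.snd ⁻¹' A).indicator 1 z := by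
    funext z
    by_cases hz : z.2 ∈ z.1
    · have h1 : toMeasure z.1 A = A.indicator 1 z.2 + toMeasure (removePoint z.1 z.2) A := by
        conv_lhs => rw [← Multiset.cons_erase hz]
        rw [toMeasure_cons, Measure.add_apply, Measure.dirac_apply' _ hA]
        rfl
      by_cases hA' : z.2 ∈ A
      · simp [h1, hz, hA']
      · simp [h1, hz, hA']
    · have h1 : removePoint z.1 z.2 = z.1 := Multiset.erase_of_notMem hz
      simp [h1, hz]
  rw [key]
  exact ((measurable_toMeasure_apply hA).comp measurable_fst).sub
    (measurable_one.indicator (measurableSet_mem.inter (measurable_snd hA)))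

/-! ### The spatial immigration-death process -/

/-- The jump rates of the immigration-death process with immigration measure `lam` and unit per
capita death rate: from `ξ` it jumps to `ξ + δ_x` at rate `lam(dx)` and to `ξ - δ_x` at rate
`ξ(dx)`.  Thus `∫ (h(ζ) - h(ξ)) rateMeasure lam ξ (dζ)` is the generator
`𝒜h(ξ) = ∫ [h(ξ + δ_x) - h(ξ)] lam(dx) + ∫ [h(ξ - δ_x) - h(ξ)] ξ(dx)`. -/
def rateMeasure (lam : Measure X) (ξ : PointMeasure X) : Measure (PointMeasure X) :=
  lam.map (fun x => ξ + {x}) + (toMeasure ξ).map (fun x => removePoint ξ x)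

/-- The law of the new state when the process jumps from `ξ`: the normalized jump rates. -/
def jumpMeasure (lam : Measure X) (ξ : PointMeasure X) : Measure (PointMeasure X) :=
  (lam univ + Multiset.card ξ)⁻¹ • rateMeasure lam ξ

lemma measurable_rateMeasure (lam : Measure X) [IsFiniteMeasure lam] :
    Measurable (rateMeasure lam) := by
  refine Measure.measurable_of_measurable_coe _ fun B hB => ?_
  have h1 : ∀ ξ : PointMeasure X, Measurable (fun x : X => ξ + {x}) := fun ξ =>
    measurable_addPoint.comp (measurable_const.prodMk measurable_id)
  have h2 : ∀ ξ : PointMeasure X, Measurable (fun x : X => removePoint ξ x) := fun ξ =>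
    measurable_removePoint.comp (measurable_const.prodMk measurable_id)
  have h3 : (fun ξ : PointMeasure X => rateMeasure lam ξ B) = fun ξ =>
      lam (Prod.mk ξ ⁻¹' ((fun z : PointMeasure X × X => z.1 + {z.2}) ⁻¹' B))
      + pointKernel X ξ
        (Prod.mk ξ ⁻¹' ((fun z : PointMeasure X × X => removePoint z.1 z.2) ⁻¹' B)) := by
    funext ξ
    rw [rateMeasure, Measure.add_apply, Measure.map_apply (h1 ξ) hB, Measure.map_apply (h2 ξ) hB]
    rfl
  rw [h3]
  exact (measurable_measure_prodMk_left (measurable_addPoint hB)).add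
    (Kernel.measurable_kernel_prodMk_left (measurable_removePoint hB))

lemma rateMeasure_univ (lam : Measure X) (ξ : PointMeasure X) :
    rateMeasure lam ξ univ = lam univ + Multiset.card ξ := by
  have h1 : Measurable (fun x : X => ξ + {x}) :=
    measurable_addPoint.comp (measurable_const.prodMk measurable_id)
  have h2 : Measurable (fun x : X => removePoint ξ x) :=
    measurable_removePoint.comp (measurable_const.prodMk measurable_id)
  rw [rateMeasure, Measure.add_apply, Measure.map_apply h1 .univ, Measure.map_apply h2 .univ,
    preimage_univ, preimage_univ, toMeasure_univ]

/-- The transition kernel of the embedded jump chain. -/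
def jumpKernel (lam : Measure X) [IsFiniteMeasure lam] :
    Kernel (PointMeasure X) (PointMeasure X) where
  toFun := jumpMeasure lam
  measurable' := by
    refine Measure.measurable_of_measurable_coe _ fun B hB => ?_
    simp only [jumpMeasure, Measure.smul_apply, smul_eq_mul]
    refine Measurable.mul ?_ ((Measure.measurable_coe hB).comp (measurable_rateMeasure lam))
    exact (measurable_from_nat (f := fun n : ℕ => (lam univ + (n : ℝ≥0∞))⁻¹)).comp measurable_card

instance isMarkovKernel_jumpKernel (lam : Measure X) [IsFiniteMeasure lam] [NeZero lam] :
    IsMarkovKernel (jumpKernel lam) := by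
  refine ⟨fun ξ => ⟨?_⟩⟩
  change ((lam univ + Multiset.card ξ)⁻¹ • rateMeasure lam ξ) univ = 1
  rw [Measure.smul_apply, rateMeasure_univ, smul_eq_mul]
  refine ENNReal.inv_mul_cancel ?_ ?_
  · have : lam univ ≠ 0 := by simpa using NeZero.ne lam
    simp [this]
  · exact ENNReal.add_ne_top.2 ⟨measure_ne_top _ _, ENNReal.natCast_ne_top _⟩

/-- The holding time in the state `ξ`: exponential with rate `lam(X) + |ξ|`. -/
def holdingKernel (lam : Measure X) : Kernel (PointMeasure X) ℝ :=
  (Kernel.ofFunOfCountable fun n : ℕ => expMeasure (lam.real univ + n)).comap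
    Multiset.card measurable_card

instance isMarkovKernel_holdingKernel (lam : Measure X) [IsFiniteMeasure lam] [NeZero lam] :
    IsMarkovKernel (holdingKernel lam) := by
  refine ⟨fun ξ => ?_⟩
  change IsProbabilityMeasure (expMeasure (lam.real univ + (Multiset.card ξ : ℝ)))
  refine isProbabilityMeasure_expMeasure ?_
  have : 0 < lam.real univ := by
    rw [measureReal_def]
    exact ENNReal.toReal_pos (by simpa using NeZero.ne lam) (measure_ne_top _ _)
  positivity

/-- One step `(s, ξ) ↦ (s + T, ζ)` of the Markov chain of jump times and states: the holding time
`T` in `ξ` and the new state `ζ` are independent, with laws `holdingKernel` and `jumpKernel`. -/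
def stepKernel (lam : Measure X) [IsFiniteMeasure lam] :
    Kernel (ℝ × PointMeasure X) (ℝ × PointMeasure X) :=
  (Kernel.id ×ₖ ((holdingKernel lam ×ₖ jumpKernel lam).comap Prod.snd measurable_snd)).map
    (fun z : (ℝ × PointMeasure X) × (ℝ × PointMeasure X) => (z.1.1 + z.2.1, z.2.2))

instance isMarkovKernel_stepKernel (lam : Measure X) [IsFiniteMeasure lam] [NeZero lam] :
    IsMarkovKernel (stepKernel lam) :=
  Kernel.IsMarkovKernel.map _ (by fun_prop)

/-- The law of the sequence `(Sₙ, Yₙ)ₙ` of jump times and successive states of the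
immigration-death process with immigration measure `lam` and unit per capita death rate, started
from `(S₀, Y₀) = (0, ξ)`. -/
def pathLaw (lam : Measure X) [IsFiniteMeasure lam] [NeZero lam] (ξ : PointMeasure X) :
    Measure (ℕ → ℝ × PointMeasure X) :=
  Kernel.traj (X := fun _ => ℝ × PointMeasure X)
    (fun n => (stepKernel lam).comap
      (fun w : (Π _ : Finset.Iic n, ℝ × PointMeasure X) => w ⟨n, Finset.mem_Iic.2 le_rfl⟩)
      (measurable_pi_apply _)) 0 (fun _ => (0, ξ))

end Erase

section StateAt

variable {X : Type*}

open scoped Classical in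
/-- The state at time `t` of the pure jump process with jump times and states `(Sₙ, Yₙ)ₙ`: it is
`Yₙ` for `Sₙ ≤ t < Sₙ₊₁`.  (The value `0` is used only on the null event that `t` is in no such
interval.) Under `pathLaw lam ξ` this is the immigration-death process `𝐙_ξ(t)`. -/
def stateAt (t : ℝ) (ω : ℕ → ℝ × PointMeasure X) : PointMeasure X :=
  if h : ∃ n, (ω n).1 ≤ t ∧ t < (ω (n + 1)).1 then (ω (Nat.find h)).2 else 0

end StateAt

section Stein

variable {X : Type*} [MeasurableSpace X]

/-- The law `Po(lam)` on `𝔑` of the Poisson process with finite expectation measure `lam`: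
`Po(lam)(B) = e^{-lam(X)} ∑ₙ (1/n!) lam^n {(x₁, …, xₙ) : ∑ᵢ δ_{xᵢ} ∈ B}`. -/
def poissonProcess (lam : Measure X) : Measure (PointMeasure X) :=
  Measure.sum fun n : ℕ => ENNReal.ofReal (Real.exp (-lam.real univ) / n.factorial) •
    (Measure.pi fun _ : Fin n => lam).map (fun x => Multiset.map x Finset.univ.val)

variable [MeasurableEq X]

/-- `𝔼 f(𝐙_ξ(t)) - Po(lam)(f)`. -/
def meanDeviation (lam : Measure X) [IsFiniteMeasure lam] [NeZero lam] (f : PointMeasure X → ℝ)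
    (ξ : PointMeasure X) (t : ℝ) : ℝ :=
  (∫ ω, f (stateAt t ω) ∂(pathLaw lam ξ)) - ∫ η, f η ∂(poissonProcess lam)

/-- The solution `h_f(ξ) = -∫₀^∞ [𝔼 f(𝐙_ξ(t)) - Po(lam)(f)] dt` of the Stein equation. -/
def steinSolution (lam : Measure X) [IsFiniteMeasure lam] [NeZero lam] (f : PointMeasure X → ℝ)
    (ξ : PointMeasure X) : ℝ :=
  -∫ t in Ioi (0 : ℝ), meanDeviation lam f ξ t

end Stein

section Norms

variable {X : Type*}

/-- `‖Δh‖_∞`, the supremum of `|h(ξ + δ_x) - h(ξ)|`, as an extended nonnegative real. -/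
def firstDiffNorm (h : PointMeasure X → ℝ) : ℝ≥0∞ :=
  ⨆ (ξ : PointMeasure X) (x : X), ENNReal.ofReal |h (ξ + {x}) - h ξ|

/-- `‖Δ²h‖_∞`, the supremum of `|h(ξ + δ_x + δ_y) - h(ξ + δ_x) - h(ξ + δ_y) + h(ξ)|`, as an
extended nonnegative real. -/
def secondDiffNorm (h : PointMeasure X → ℝ) : ℝ≥0∞ :=
  ⨆ (ξ : PointMeasure X) (x : X) (y : X),
    ENNReal.ofReal |h (ξ + {x} + {y}) - h (ξ + {x}) - h (ξ + {y}) + h ξ|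

end Norms

/-! ### Metrics on point measures -/

section Metrics

variable {X : Type*} [MetricSpace X]

/-- `x` enumerates the points of `ξ`, that is, `ξ = ∑ᵢ δ_{xᵢ}`. -/
def Enumerates {n : ℕ} (x : Fin n → X) (ξ : PointMeasure X) : Prop :=
  Multiset.map x Finset.univ.val = ξ

/-- The `L_p` average `((1/n) ∑ᵢ d₀(xᵢ, yᵢ)^p)^{1/p}` of the distances of paired points, and their
maximum if `p = ∞`. -/
def averageDist (p : ℝ≥0∞) {n : ℕ} (x y : Fin n → X) : ℝ :=
  if p = ∞ then ⨆ i, dist (x i) (y i)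
  else ((1 / n : ℝ) * ∑ i, dist (x i) (y i) ^ p.toReal) ^ (1 / p.toReal)

/-- The metric `d₁^{(p)}` on `𝔑`.  The minimum over all permutations of the points of `η` is
written as the infimum (of a finite set) over all enumerations of the points of `ξ` and `η`. -/
def dOne (p : ℝ≥0∞) (ξ η : PointMeasure X) : ℝ :=
  if Multiset.card ξ ≠ Multiset.card η then 1
  else if Multiset.card ξ = 0 then 0
  else sInf {r | ∃ x y : Fin (Multiset.card ξ) → X,
    Enumerates x ξ ∧ Enumerates y η ∧ r = averageDist p x y}

/-- For `n = |ξ| ≤ m = |η|`: the number `(m - n) + min_π ∑_{i ≤ n} d₀(xᵢ, y_{π(i)})`. -/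
def dOnePrimeAux (ξ η : PointMeasure X) (hle : Multiset.card ξ ≤ Multiset.card η) : ℝ :=
  ((Multiset.card η : ℝ) - Multiset.card ξ) +
    sInf {r | ∃ (x : Fin (Multiset.card ξ) → X) (y : Fin (Multiset.card η) → X),
      Enumerates x ξ ∧ Enumerates y η ∧ r = ∑ i, dist (x i) (y (Fin.castLE hle i))}

/-- The metric `d₁'` on `𝔑`. -/
def dOnePrime (ξ η : PointMeasure X) : ℝ :=
  if hle : Multiset.card ξ ≤ Multiset.card η then dOnePrimeAux ξ η hle
  else dOnePrimeAux η ξ (le_of_not_ge hle)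

/-- The class `ℱ₂^{(p)}` of the `[0,1]`-valued functions on `𝔑` that are `1`-Lipschitz for
`d₁^{(p)}`. -/
def lipClass (X : Type*) [MetricSpace X] (p : ℝ≥0∞) : Set (PointMeasure X → ℝ) :=
  {f | (∀ ξ, f ξ ∈ Icc (0 : ℝ) 1) ∧ ∀ ξ η, |f ξ - f η| ≤ dOne p ξ η}

end Metrics

/-! ### The constants -/

/-- `κ₀ = 4e / (1 + 4e - √(1 + 8e))`. -/
def kappaZero : ℝ :=
  4 * Real.exp 1 / (1 + 4 * Real.exp 1 - Real.sqrt (1 + 8 * Real.exp 1))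

/-- `κ₁ = 2 - κ₀`. -/
def kappaOne : ℝ := 2 - kappaZero

/-- The constant `γ₁^{(p)}`, for `1 ≤ p < ∞`. -/
def gammaOne (p : ℝ) : ℝ :=
  if p = 1 then
    Real.sqrt (2 / Real.exp 1) + 2 * (kappaZero * Real.exp kappaZero) ^ (-(1 / 2) : ℝ)
  else if p ≤ 2 then
    Real.sqrt (2 / Real.exp 1) +
      2 * ((2 - p) / (p * kappaZero ^ (1 - 1 / p) - kappaOne * (p - 1)))
        ^ ((2 - p) / (2 * (p - 1)))
  else
    p / (p - 1) + 1 / Real.sqrt (2 * Real.exp 1) * (p / (p - 1)) *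
      ((p - 2) / (Real.sqrt (2 * Real.exp 1) *
        (p * kappaZero ^ (1 - 1 / p) - kappaOne * (p - 1)))) ^ ((p - 2) / p)

/-- The constant `γ₂^{(p)}`, for `1 < p < ∞`. -/
def gammaTwo (p : ℝ) : ℝ :=
  (1 + 2 ^ (1 / p) + (2 / 3) ^ (1 / p)) * p ^ 2 / ((p - 1) * (2 * p - 1))

/-- The factor `c₁^{(p)}(l)`, for `1 ≤ p ≤ ∞` and `l > 0`. -/
def cOne (p : ℝ≥0∞) (l : ℝ) : ℝ :=
  if p = ∞ then 1
  else min 1 (gammaOne p.toReal * l ^ (-1 / max 2 p.toReal))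

/-- The factor `c₂^{(p)}(l)`, for `1 ≤ p ≤ ∞` and `l > 0`.  Here `log⁺ = max(0, log)`. -/
def cTwo (p : ℝ≥0∞) (l : ℝ) : ℝ :=
  if p = ∞ then 1
  else if p = 1 then min 1 (11 / 6 * (1 + 2 * Real.posLog (6 * l / 11)) * l⁻¹)
  else min 1 (gammaTwo p.toReal * l ^ (-1 / p.toReal))

end PoissonStein

end

open PoissonStein

/-! Write l for the mass of λ and θ = 1/p (θ = 0 if p = ∞). At time t the process started in ξ is
distributed as the e^{-t}-thinning of ξ superposed with an independent Poisson process of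
expectation measure (1 - e^{-t})λ. This is the function `flow`. Since the process is built from its
jump chain and holding times, the identification needs proof. `flow` solves Kolmogorov's backward
equation (`hasDerivAt_semigroup`), hence the renewal equation for the first jump (`flow_renewal`);
the expectation along paths solves the same equation (`integral_chainKernel_stateAt`), and iteration
shows that the two bounded solutions agree (`abs_integral_sub_flow_le`). This also disposes of
explosion.

An added point x matters at time t only if it survives, so a first difference of `flow` carries a
factor e^{-t}; second differences, and first differences compared before and after moving a point,
carry e^{-2t}. What remains are differences of ζ ↦ 𝔼 f(ζ + Z), with Z a Poisson process of mass s =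
l u, u = 1 - e^{-t}. As du = e^{-t} dt, bounds for these are integrated over (0, 1) against du or (1
- u) du.

For a first difference, replace x by a random point with the law of the points of Z. If Z has N
points this costs at most (N + 1)^{-θ}, because f is Lipschitz for an averaged distance, and 𝔼 (N +
1)^{-θ} ≤ s^{-θ}. Afterwards N has merely been shifted by one. What is left is 𝔼[g(N + 1) - g(N)]
with g in [0, 1], at most the largest Poisson weight, which is at most (2es)^{-1/2}. Hence the bound
min(1, s^{-θ} + (2es)^{-1/2}) of `PowerLipschitz.abs_addPoisson_sub_le`.

For second differences the same replacement leaves two replacement errors, one difference of such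
errors and one second difference in N. Summation by parts against Poisson weights and variance
estimates handle the last two. A numerical comparison (`mixed_factor_le`) turns the sum into min(2,
K s^{-θ}) with K = 1 + 2^θ + (2/3)^θ.

Integrating these two bounds gives the constants in (i) and (ii). For (iii), pass from one
configuration to the other by moving the matched points and adding the unmatched ones
(`abs_sub_le_dOnePrime`). -/

noncomputable section

namespace PoissonStein

/-! ### Homogeneous Markov chains and the Ionescu-Tulcea construction -/

section Chain

variable {E : Type*} [MeasurableSpace E]

/-- The last coordinate of a finite trajectory. -/
def lastCoord (E : Type*) (n : ℕ) (w : Π _ : Finset.Iic n, E) : E :=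
  w ⟨n, Finset.mem_Iic.2 le_rfl⟩

lemma measurable_lastCoord (n : ℕ) : Measurable (lastCoord E n) := measurable_pi_apply _

/-- The transition kernels of a homogeneous Markov chain, as functions of the whole past. -/
def pastKernel (K : Kernel E E) (n : ℕ) : Kernel (Π _ : Finset.Iic n, E) E :=
  K.comap (lastCoord E n) (measurable_lastCoord n)

instance isMarkovKernel_pastKernel (K : Kernel E E) [IsMarkovKernel K] (n : ℕ) :
    IsMarkovKernel (pastKernel K n) := by
  unfold pastKernel; infer_instance

/-- The law of the trajectory of a homogeneous Markov chain, as a function of its initial state. -/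
def chainKernel (K : Kernel E E) [IsMarkovKernel K] : Kernel E (ℕ → E) :=
  (Kernel.traj (X := fun _ => E) (pastKernel K) 0).comap (fun e _ => e) (by fun_prop)

instance isMarkovKernel_chainKernel (K : Kernel E E) [IsMarkovKernel K] :
    IsMarkovKernel (chainKernel K) := by
  unfold chainKernel; infer_instance

/-- The trajectory is Markovian with transition kernel `K`. -/
def IsChain (K : Kernel E E) (μ : Measure (ℕ → E)) : Prop :=
  ∀ b : ℕ, μ.map (fun x => (Preorder.frestrictLe (π := fun _ => E) b x, x (b + 1)))
    = (μ.map (Preorder.frestrictLe (π := fun _ => E) b)) ⊗ₘ pastKernel K b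

lemma map_prodMap_compProd {A B C : Type*} [MeasurableSpace A] [MeasurableSpace B]
    [MeasurableSpace C] {μ : Measure A} [SFinite μ] {κ : Kernel B C} [IsSFiniteKernel κ] {g : A → B}
    (hg : Measurable g) :
    (μ ⊗ₘ (κ.comap g hg)).map (Prod.map g id) = μ.map g ⊗ₘ κ := by
  ext s hs
  rw [Measure.map_apply (by fun_prop) hs, Measure.compProd_apply (hs.preimage (by fun_prop)),
    Measure.compProd_apply hs, lintegral_map (Kernel.measurable_kernel_prodMk_left hs) hg]
  rfl

/-- `pastKernel` looks only at the last coordinate, so it commutes with dropping coordinate 0: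
homogeneity makes the shifted trajectory a chain with the same kernel. -/
lemma isChain_traj_one (K : Kernel E E) [IsMarkovKernel K] (w : Π _ : Finset.Iic 1, E) :
    IsChain K ((Kernel.traj (X := fun _ => E) (pastKernel K) 1 w).map (fun x n => x (n + 1))) := by
  intro b
  have h := Kernel.partialTraj_compProd_eq_map_traj (X := fun _ => E) (κ := pastKernel K)
    (a := 1) (b := b + 1) (by omega) (x₀ := w)
  rw [← Kernel.traj_map_frestrictLe_apply] at h
  let g : (Π _ : Finset.Iic (b + 1), E) → (Π _ : Finset.Iic b, E) := fun y i =>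
    y ⟨i.1 + 1, Finset.mem_Iic.2 (Nat.succ_le_succ (Finset.mem_Iic.1 i.2))⟩
  have hg : Measurable g := by fun_prop
  have h1 : pastKernel K (b + 1) = (pastKernel K b).comap g hg := rfl
  rw [h1] at h
  have h2 := congrArg (fun m => m.map (Prod.map g id)) h
  rw [map_prodMap_compProd hg, Measure.map_map hg (by fun_prop),
    Measure.map_map (by fun_prop) (by fun_prop)] at h2
  rw [Measure.map_map (by fun_prop) (by fun_prop), Measure.map_map (by fun_prop) (by fun_prop)]
  exact h2.symm

lemma isChain_chainKernel (K : Kernel E E) [IsMarkovKernel K] (e : E) :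
    IsChain K (chainKernel K e) := by
  intro b
  have h := Kernel.partialTraj_compProd_eq_map_traj (X := fun _ => E) (κ := pastKernel K)
    (a := 0) (b := b) (by omega) (x₀ := fun _ => e)
  rw [← Kernel.traj_map_frestrictLe_apply] at h
  exact h.symm

/-- By induction, the initial law and `K` determine the laws of all initial segments; a measure on
sequences is the unique projective limit of these. -/
lemma IsChain.ext {K : Kernel E E} {μ ν : Measure (ℕ → E)}
    [IsProbabilityMeasure μ] [IsProbabilityMeasure ν] (hμ : IsChain K μ) (hν : IsChain K ν)
    (h0 : μ.map (fun x => x 0) = ν.map (fun x => x 0)) : μ = ν := by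
  have key : ∀ b : ℕ, μ.map (Preorder.frestrictLe (π := fun _ => E) b)
      = ν.map (Preorder.frestrictLe (π := fun _ => E) b) := by
    intro b
    induction b with
    | zero =>
      let g : E → (Π _ : Finset.Iic 0, E) := fun e _ => e
      have hg : Measurable g := by fun_prop
      have h1 : (Preorder.frestrictLe (π := fun _ => E) 0) = g ∘ (fun x : ℕ → E => x 0) := by
        funext x i
        have : i.1 = 0 := Nat.le_zero.1 (Finset.mem_Iic.1 i.2)
        simp [g, this]
      rw [h1, ← Measure.map_map hg (by fun_prop), h0, Measure.map_map hg (by fun_prop)]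
    | succ b ih =>
      let g : (Π _ : Finset.Iic b, E) × E → (Π _ : Finset.Iic (b + 1), E) := fun z i =>
        if h : i.1 ≤ b then z.1 ⟨i.1, Finset.mem_Iic.2 h⟩ else z.2
      have hg : Measurable g := by
        refine measurable_pi_lambda _ fun i => ?_
        by_cases h : i.1 ≤ b
        · simp only [g, h, dite_true]; fun_prop
        · simp only [g, h, dite_false]; fun_prop
      have h1 : (Preorder.frestrictLe (π := fun _ => E) (b + 1))
          = g ∘ (fun x : ℕ → E => (Preorder.frestrictLe (π := fun _ => E) b x, x (b + 1))) := by
        funext x i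
        by_cases h : i.1 ≤ b
        · simp [g, h]
        · have : i.1 = b + 1 := le_antisymm (Finset.mem_Iic.1 i.2) (by omega)
          simp [g, this]
      rw [h1, ← Measure.map_map hg (by fun_prop), hμ b, ih, ← hν b,
        Measure.map_map hg (by fun_prop)]
  have hproj : IsProjectiveMeasureFamily (α := fun _ : ℕ => E)
      (fun I : Finset ℕ => ν.map (Finset.restrict (π := fun _ => E) I)) := by
    intro I J hJI
    rw [Measure.map_map (Finset.measurable_restrict₂ hJI) (Finset.measurable_restrict I)]
    rfl
  have h1 : IsProjectiveLimit μ (fun I : Finset ℕ => ν.map (Finset.restrict (π := fun _ => E) I)) :=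
    (isProjectiveLimit_nat_iff (X := fun _ => E) hproj μ).2 key
  have h2 : IsProjectiveLimit ν (fun I : Finset ℕ => ν.map (Finset.restrict (π := fun _ => E) I)) :=
    fun _ => rfl
  have : ∀ I : Finset ℕ, IsFiniteMeasure
      ((fun I : Finset ℕ => ν.map (Finset.restrict (π := fun _ => E) I)) I) := fun I => by
    infer_instance
  exact h1.unique h2

lemma chainKernel_map_zero (K : Kernel E E) [IsMarkovKernel K] (e : E) :
    (chainKernel K e).map (fun x => x 0) = Measure.dirac e := by
  have h := Kernel.traj_map_frestrictLe_apply (X := fun _ => E) (κ := pastKernel K) 0 0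
    (fun _ => e)
  rw [Kernel.partialTraj_self, Kernel.id_apply] at h
  have h2 := congrArg (fun m => m.map (lastCoord E 0)) h
  rw [Measure.map_map (measurable_lastCoord 0) (by fun_prop),
    Measure.map_dirac' (measurable_lastCoord 0)] at h2
  exact h2

lemma ae_chainKernel_zero (K : Kernel E E) [IsMarkovKernel K] (e : E)
    {p : E → Prop} (hp : MeasurableSet {e | p e}) (h : p e) :
    ∀ᵐ ω ∂(chainKernel K e), p (ω 0) := by
  have h1 : ∀ᵐ y ∂((chainKernel K e).map (fun x => x 0)), p y := by
    rw [chainKernel_map_zero, ae_dirac_iff hp]; exact h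
  exact ae_of_ae_map (measurable_pi_apply 0).aemeasurable h1

lemma traj_one_map_shift (K : Kernel E E) [IsMarkovKernel K] (w : Π _ : Finset.Iic 1, E) :
    (Kernel.traj (X := fun _ => E) (pastKernel K) 1 w).map (fun x n => x (n + 1))
      = chainKernel K (lastCoord E 1 w) := by
  have : IsProbabilityMeasure
      ((Kernel.traj (X := fun _ => E) (pastKernel K) 1 w).map (fun x n => x (n + 1))) :=
    Measure.isProbabilityMeasure_map (Measurable.aemeasurable (by fun_prop))
  refine (isChain_traj_one K w).ext (isChain_chainKernel K _) ?_
  rw [chainKernel_map_zero, Measure.map_map (by fun_prop) (by fun_prop)]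
  have h := Kernel.traj_map_frestrictLe_apply (X := fun _ => E) (κ := pastKernel K) 1 1 w
  rw [Kernel.partialTraj_self, Kernel.id_apply] at h
  have h2 := congrArg (fun m => m.map (lastCoord E 1)) h
  rw [Measure.map_map (measurable_lastCoord 1) (by fun_prop),
    Measure.map_dirac' (measurable_lastCoord 1)] at h2
  exact h2

/-- The Markov property at time one. -/
lemma chainKernel_map_shift (K : Kernel E E) [IsMarkovKernel K] (e : E) :
    (chainKernel K e).map (fun x n => x (n + 1)) = (K e).bind (chainKernel K) := by
  -- Disintegrate over the first two coordinates. The conditional law of the shifted sequence is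
  -- then given by `traj_one_map_shift`, and coordinate 1 has law `K e`.
  have h1 : chainKernel K e = (Kernel.partialTraj (X := fun _ => E) (pastKernel K) 0 1
      (fun _ => e)).bind (Kernel.traj (X := fun _ => E) (pastKernel K) 1) := by
    rw [← Kernel.comp_apply, Kernel.traj_comp_partialTraj (by omega)]
    rfl
  have h3 : K e = (Kernel.partialTraj (X := fun _ => E) (pastKernel K) 0 1
      (fun _ => e)).map (lastCoord E 1) := by
    have := Kernel.map_partialTraj_succ_self (X := fun _ => E) (κ := pastKernel K) 0
    rw [← Kernel.map_apply _ (measurable_lastCoord 1)]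
    change pastKernel K 0 (fun _ => e) = _
    rw [← this]
    rfl
  ext s hs
  rw [Measure.map_apply (by fun_prop) hs, h1,
    Measure.bind_apply (hs.preimage (by fun_prop)) (Kernel.aemeasurable _),
    Measure.bind_apply hs (Kernel.aemeasurable _), h3,
    lintegral_map (Kernel.measurable_coe _ hs) (measurable_lastCoord 1)]
  refine lintegral_congr fun w => ?_
  rw [← traj_one_map_shift, Measure.map_apply (by fun_prop) hs]

end Chain

lemma toMeasure_map {X : Type*} [MeasurableSpace X] (T : X → X) (ξ : PointMeasure X) {A : Set X} (hA : MeasurableSet A)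
    (hT : Measurable T) : toMeasure (ξ.map T) A = toMeasure ξ (T ⁻¹' A) := by
  induction ξ using Multiset.induction_on with
  | empty => simp
  | cons a s ih =>
    rw [Multiset.map_cons, toMeasure_cons, toMeasure_cons, Measure.add_apply, Measure.add_apply, ih,
      Measure.dirac_apply' _ hA, Measure.dirac_apply' _ (hT hA)]
    rfl

lemma exists_enumerates {X : Type*} (ξ : PointMeasure X) :
    ∃ x : Fin (Multiset.card ξ) → X, Enumerates x ξ := by
  induction ξ using Quot.inductionOn with
  | h l =>
    refine ⟨fun i => l.get i, ?_⟩
    change Multiset.map (fun i => l.get i) (Finset.univ : Finset (Fin l.length)).val = l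
    rw [Fin.univ_def]
    change ((List.map (fun i => l.get i) (List.finRange l.length) : List X) : Multiset X) = l
    rw [List.map_get_finRange]

/-! ### Functions of point measures that are Lipschitz in each point -/

section PointLipschitz

variable {X : Type*} [MetricSpace X]

/-- Moving one point of `ξ` changes `g` by at most the distance of the move. -/
def PointLipschitz (g : PointMeasure X → ℝ) : Prop :=
  ∀ (ξ : PointMeasure X) (x y : X), |g (ξ + {x}) - g (ξ + {y})| ≤ dist x y

lemma PointLipschitz.abs_sub_map_le {g : PointMeasure X → ℝ} (hg : PointLipschitz g) (T : X → X)
    (ξ ζ : PointMeasure X) :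
    |g (ζ + ξ) - g (ζ + ξ.map T)| ≤ (ξ.map fun x => dist x (T x)).sum := by
  induction ξ using Multiset.induction_on generalizing ζ with
  | empty => simp
  | cons a s ih =>
    have h1 := hg (ζ + s) a (T a)
    have h2 := ih (ζ + {T a})
    have e1 : ζ + (a ::ₘ s) = ζ + s + {a} := by rw [← Multiset.singleton_add]; abel
    have e2 : ζ + Multiset.map T (a ::ₘ s) = ζ + {T a} + s.map T := by
      rw [Multiset.map_cons, ← Multiset.singleton_add]; abel
    have e3 : ζ + {T a} + s = ζ + s + {T a} := by abel
    rw [e3] at h2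
    rw [e1, e2, Multiset.map_cons, Multiset.sum_cons]
    calc _ = |(g (ζ + s + {a}) - g (ζ + s + {T a})) +
          (g (ζ + s + {T a}) - g (ζ + {T a} + s.map T))| := by ring_nf
      _ ≤ _ := (abs_add_le _ _).trans (add_le_add h1 h2)

lemma tendsto_multiset_sum_dist {T : ℕ → X → X}
    (hT : ∀ x, Filter.Tendsto (fun k => T k x) Filter.atTop (nhds x)) (ξ : PointMeasure X) :
    Filter.Tendsto (fun k => (ξ.map fun x => dist x (T k x)).sum) Filter.atTop (nhds 0) := by
  induction ξ using Multiset.induction_on with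
  | empty => simp
  | cons a s ih =>
    simp only [Multiset.map_cons, Multiset.sum_cons]
    have h := (tendsto_const_nhds (x := a)).dist (hT a)
    rw [dist_self] at h
    simpa using h.add ih

variable [MeasurableSpace X] [BorelSpace X]

/-- A function of a discretized point measure is measurable, whatever the function is. -/
lemma measurable_comp_map_simpleFunc (g : PointMeasure X → ℝ) (T : SimpleFunc X X) :
    Measurable (fun ξ : PointMeasure X => g (ξ.map T)) := by
  classical
  -- The image configuration is determined by the counts on the finitely many cells of `T`. These
  -- counts are measurable and take values in a countable discrete space, on which every function is
  -- measurable.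
  let c : PointMeasure X → (T.range → ℕ) := fun ξ a => (ξ.map T).count a.1
  have hc : Measurable c := by
    refine measurable_pi_lambda _ fun a => measurable_to_countable' fun n => ?_
    have : (fun ξ : PointMeasure X => c ξ a) ⁻¹' {n}
        = (fun ξ : PointMeasure X => toMeasure ξ (T ⁻¹' {a.1})) ⁻¹' {(n : ℝ≥0∞)} := by
      ext ξ
      rw [mem_preimage, mem_preimage, ← toMeasure_map T ξ (measurableSet_singleton _) T.measurable,
        toMeasure_singleton_set]
      simp [c]
    rw [this]
    exact measurable_toMeasure_apply (T.measurableSet_preimage _) (measurableSet_singleton _)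
  let r : (T.range → ℕ) → PointMeasure X := fun v => ∑ a, v a • ({a.1} : Multiset X)
  have hr : ∀ ξ : PointMeasure X, ξ.map T = r (c ξ) := by
    intro ξ
    ext b
    simp only [r, c]
    rw [Multiset.count_sum']
    simp only [Multiset.count_nsmul, Multiset.count_singleton]
    by_cases hb : b ∈ T.range
    · rw [Finset.sum_eq_single ⟨b, hb⟩]
      · simp
      · intro a _ ha
        have : b ≠ a.1 := fun h => ha (Subtype.ext h.symm)
        simp [this]
      · simp
    · rw [Finset.sum_eq_zero, Multiset.count_eq_zero]
      · intro h
        obtain ⟨x, _, rfl⟩ := Multiset.mem_map.1 h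
        exact hb (SimpleFunc.mem_range_self T x)
      · intro a _
        have : b ≠ a.1 := fun h => hb (h ▸ a.2)
        simp [this]
  have : (fun ξ : PointMeasure X => g (ξ.map T)) = (fun v => g (r v)) ∘ c := by
    funext ξ; simp [hr]
  rw [this]
  exact (measurable_of_countable _).comp hc

/-- Measurability is not part of the definition of the Lipschitz class. It holds because `g` is the
pointwise limit of its values at configurations whose points are rounded to a dense sequence. -/
lemma PointLipschitz.measurable [SecondCountableTopology X] {g : PointMeasure X → ℝ}
    (hg : PointLipschitz g) : Measurable g := by
  rcases isEmpty_or_nonempty X with hX | hX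
  · have : Subsingleton (PointMeasure X) := ⟨fun a b => by
      rw [Multiset.eq_zero_of_forall_notMem (s := a) fun x => (hX.false x).elim,
        Multiset.eq_zero_of_forall_notMem (s := b) fun x => (hX.false x).elim]⟩
    exact Subsingleton.measurable
  let T : ℕ → SimpleFunc X X := fun k =>
    SimpleFunc.nearestPt (TopologicalSpace.denseSeq X) k
  have hT : ∀ x, Filter.Tendsto (fun k => T k x) Filter.atTop (nhds x) := fun x =>
    SimpleFunc.tendsto_nearestPt (by
      rw [(TopologicalSpace.denseRange_denseSeq X).closure_range]; trivial)
  refine measurable_of_tendsto_metrizable (f := fun k ξ => g (ξ.map (T k)))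
    (fun k => measurable_comp_map_simpleFunc g (T k)) ?_
  rw [tendsto_pi_nhds]
  intro ξ
  rw [tendsto_iff_dist_tendsto_zero]
  refine squeeze_zero (fun _ => dist_nonneg) (fun k => ?_) (tendsto_multiset_sum_dist hT ξ)
  rw [dist_comm, Real.dist_eq]
  simpa using hg.abs_sub_map_le (T k) ξ 0

end PointLipschitz

/-! ### The Lipschitz classes of the metrics `d₁^{(p)}` -/

section LipClass

variable {X : Type*} [MetricSpace X]

lemma averageDist_nonneg (p : ℝ≥0∞) {n : ℕ} (x y : Fin n → X) : 0 ≤ averageDist p x y := by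
  unfold averageDist
  split_ifs
  · exact Real.iSup_nonneg fun i => dist_nonneg
  · positivity

lemma dOne_map_le (p : ℝ≥0∞) {n : ℕ} (hn : n ≠ 0) (x y : Fin n → X) :
    dOne p (Multiset.map x Finset.univ.val) (Multiset.map y Finset.univ.val)
      ≤ averageDist p x y := by
  have key : ∀ (ξ η : PointMeasure X), Multiset.map x Finset.univ.val = ξ →
      Multiset.map y Finset.univ.val = η → dOne p ξ η ≤ averageDist p x y := by
    intro ξ η hξ hη
    have h1 : n = Multiset.card ξ := by rw [← hξ]; simp
    have h2 : n = Multiset.card η := by rw [← hη]; simp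
    unfold dOne
    rw [if_neg (by omega), if_neg (by omega)]
    subst h1
    refine csInf_le ⟨0, ?_⟩ ⟨x, y, hξ, hη, rfl⟩
    rintro r ⟨x', y', _, _, rfl⟩
    exact averageDist_nonneg _ _ _
  exact key _ _ rfl rfl

/-- For `f` in the Lipschitz class of `d₁^{(p)}`, the effect of moving one point of `ξ + δ_x`. -/
lemma abs_sub_le_of_mem_lipClass {p : ℝ≥0∞} (hp : 1 ≤ p) {f : PointMeasure X → ℝ}
    (hf : f ∈ lipClass X p) (ξ : PointMeasure X) (x y : X) :
    |f (ξ + {x}) - f (ξ + {y})|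
      ≤ dist x y * ((Multiset.card ξ : ℝ) + 1) ^ (-(1 / p.toReal)) := by
  obtain ⟨z, hz⟩ := exists_enumerates ξ
  -- Enumerating the common points by the same `z` makes all paired distances vanish except the one
  -- between `x` and `y`.
  have e : ∀ w : X, ξ + {w} = Multiset.map (Fin.cons w z : Fin (Multiset.card ξ + 1) → X)
      Finset.univ.val := by
    intro w
    rw [Fin.univ_succ]
    simp only [Finset.cons_val, Multiset.map_cons, Fin.cons_zero, Finset.map_val, Multiset.map_map]
    rw [add_comm, Multiset.singleton_add]
    congr 1
    conv_lhs => rw [← hz]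
    rfl
  refine (hf.2 _ _).trans ?_
  rw [e x, e y]
  refine (dOne_map_le p (Nat.succ_ne_zero _) _ _).trans ?_
  unfold averageDist
  split_ifs with h
  -- For p = ∞ the conventions `∞.toReal = 0` and `1 / 0 = 0` give exponent 0, which is the correct
  -- statement: there is no gain from averaging.
  · simp only [h, ENNReal.toReal_top, div_zero, neg_zero, Real.rpow_zero, mul_one]
    refine ciSup_le fun i => ?_
    refine Fin.cases ?_ (fun j => ?_) i
    · simp
    · simp
  · have hp0 : 0 < p.toReal := by
      refine ENNReal.toReal_pos (fun h0 => ?_) h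
      rw [h0] at hp; exact absurd hp (by simp)
    rw [Fin.sum_univ_succ]
    simp only [Fin.cons_zero, Fin.cons_succ, dist_self, Real.zero_rpow hp0.ne',
      Finset.sum_const_zero, add_zero]
    rw [Real.mul_rpow (by positivity) (by positivity), ← Real.rpow_mul dist_nonneg,
      mul_one_div_cancel hp0.ne', Real.rpow_one, mul_comm, Real.rpow_neg (by positivity), one_div,
      Real.inv_rpow (by positivity)]
    push_cast
    rfl

lemma pointLipschitz_of_mem_lipClass {p : ℝ≥0∞} (hp : 1 ≤ p) {f : PointMeasure X → ℝ}
    (hf : f ∈ lipClass X p) : PointLipschitz f := fun ξ x y =>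
  (abs_sub_le_of_mem_lipClass hp hf ξ x y).trans
    (mul_le_of_le_one_right dist_nonneg
      (Real.rpow_le_one_of_one_le_of_nonpos (by linarith [(Nat.cast_nonneg (Multiset.card ξ) : (0:ℝ) ≤ _)]) (by
        rw [neg_nonpos]; positivity)))

end LipClass

/-! ### The Poisson distribution -/

section Poisson

/-- The weights of the Poisson distribution with parameter `s`. -/
def pois (s : ℝ) (n : ℕ) : ℝ := Real.exp (-s) * (s ^ n / n.factorial)

/-- The expectation of `w` under the Poisson distribution with parameter `s`. -/
def poisE (s : ℝ) (w : ℕ → ℝ) : ℝ := ∑' n, pois s n * w n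

lemma pois_nonneg {s : ℝ} (hs : 0 ≤ s) (n : ℕ) : 0 ≤ pois s n := by unfold pois; positivity

lemma pois_pos {s : ℝ} (hs : 0 < s) (n : ℕ) : 0 < pois s n := by unfold pois; positivity

lemma pois_succ (s : ℝ) (n : ℕ) : pois s (n + 1) * (n + 1) = s * pois s n := by
  unfold pois
  rw [Nat.factorial_succ]
  push_cast
  have : (n.factorial : ℝ) ≠ 0 := by positivity
  field_simp
  ring

lemma hasSum_pois (s : ℝ) : HasSum (pois s) 1 := by
  have h := NormedSpace.expSeries_div_hasSum_exp (𝔸 := ℝ) s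
  rw [← Real.exp_eq_exp_ℝ] at h
  have h2 := h.mul_left (Real.exp (-s))
  rwa [← Real.exp_add, neg_add_cancel, Real.exp_zero] at h2

lemma summable_pois_mul (s : ℝ) {w : ℕ → ℝ} {C : ℝ} (hw : ∀ n, |w n| ≤ C) :
    Summable (fun n => pois s n * w n) := by
  have h := ((Real.summable_pow_div_factorial |s|).mul_left (Real.exp (-s))).mul_right C
  refine Summable.of_norm_bounded h fun n => ?_
  rw [Real.norm_eq_abs, abs_mul]
  unfold pois
  rw [abs_mul, abs_div, abs_pow, Real.abs_exp, Nat.abs_cast]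
  gcongr
  exact hw n

lemma poisE_const (s c : ℝ) : poisE s (fun _ => c) = c := by
  unfold poisE; rw [tsum_mul_right, (hasSum_pois s).tsum_eq, one_mul]

lemma poisE_sub (s : ℝ) {v w : ℕ → ℝ} {C D : ℝ} (hv : ∀ n, |v n| ≤ C) (hw : ∀ n, |w n| ≤ D) :
    poisE s (fun n => v n - w n) = poisE s v - poisE s w := by
  unfold poisE
  rw [← (summable_pois_mul s hv).tsum_sub (summable_pois_mul s hw)]
  simp only [mul_sub]

lemma poisE_add (s : ℝ) {v w : ℕ → ℝ} {C D : ℝ} (hv : ∀ n, |v n| ≤ C) (hw : ∀ n, |w n| ≤ D) :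
    poisE s (fun n => v n + w n) = poisE s v + poisE s w := by
  unfold poisE
  rw [← (summable_pois_mul s hv).tsum_add (summable_pois_mul s hw)]
  simp only [mul_add]

lemma poisE_const_mul (s c : ℝ) (w : ℕ → ℝ) : poisE s (fun n => c * w n) = c * poisE s w := by
  unfold poisE
  rw [← tsum_mul_left]
  exact tsum_congr fun n => by ring

lemma poisE_mono {s : ℝ} (hs : 0 ≤ s) {v w : ℕ → ℝ} {C D : ℝ} (hv : ∀ n, |v n| ≤ C)
    (hw : ∀ n, |w n| ≤ D) (h : ∀ n, v n ≤ w n) : poisE s v ≤ poisE s w :=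
  (summable_pois_mul s hv).tsum_le_tsum
    (fun n => mul_le_mul_of_nonneg_left (h n) (pois_nonneg hs n)) (summable_pois_mul s hw)

lemma abs_poisE_le_poisE {s : ℝ} (hs : 0 ≤ s) {v w : ℕ → ℝ} {D : ℝ}
    (hw : ∀ n, |w n| ≤ D) (h : ∀ n, |v n| ≤ w n) : |poisE s v| ≤ poisE s w := by
  have hv : ∀ n, |v n| ≤ D := fun n => (h n).trans ((le_abs_self _).trans (hw n))
  have hw' : ∀ n, |-w n| ≤ D := fun n => by rw [abs_neg]; exact hw n
  refine abs_le.2 ⟨?_, poisE_mono hs hv hw fun n => (le_abs_self _).trans (h n)⟩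
  have := poisE_mono hs hw' hv fun n => neg_le.1 ((neg_le_abs _).trans (h n))
  have e : poisE s (fun n => -w n) = -poisE s w := by
    have := poisE_const_mul s (-1) w
    simpa using this
  linarith

lemma abs_poisE_le {s : ℝ} (hs : 0 ≤ s) {w : ℕ → ℝ} {C : ℝ} (hw : ∀ n, |w n| ≤ C) :
    |poisE s w| ≤ C :=
  (abs_poisE_le_poisE hs (D := |C|) (fun _ => le_rfl) hw).trans_eq (poisE_const s C)

/-- Termwise differentiation of the power series, dominated on the ball of radius |s| + 1; the
factor e^{-s} contributes the term without shift. -/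
lemma hasDerivAt_poisE (s : ℝ) {w : ℕ → ℝ} {C : ℝ} (hw : ∀ n, |w n| ≤ C) :
    HasDerivAt (fun s => poisE s w) (poisE s (fun n => w (n + 1)) - poisE s w) s := by
  have hC : 0 ≤ C := (abs_nonneg _).trans (hw 0)
  set R : ℝ := |s| + 1
  have hR : 0 < R := by positivity
  have hsu : Summable (fun n : ℕ => n * R ^ (n - 1) / n.factorial * C) := by
    refine (summable_nat_add_iff 1).1 ?_
    refine ((Real.summable_pow_div_factorial R).mul_right C).congr fun n => ?_
    rw [Nat.factorial_succ]
    push_cast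
    have : (n.factorial : ℝ) ≠ 0 := by positivity
    field_simp
  have h1 := hasDerivAt_tsum_of_isPreconnected (g := fun (n : ℕ) (y : ℝ) => y ^ n / n.factorial * w n)
    (g' := fun (n : ℕ) (y : ℝ) => n * y ^ (n - 1) / n.factorial * w n) (t := Metric.ball 0 R)
    (y₀ := 0) (y := s) hsu Metric.isOpen_ball (convex_ball 0 R).isPreconnected
    (fun n y _ => ((hasDerivAt_pow n y).div_const _).mul_const _)
    (fun n y hy => by
      have hy' : |y| ≤ R := by simpa using (mem_ball_zero_iff.1 hy).le
      rw [Real.norm_eq_abs, abs_mul, abs_div, abs_mul, abs_pow, Nat.abs_cast, Nat.abs_cast]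
      gcongr
      exact hw n)
    (Metric.mem_ball_self hR)
    ((Real.summable_pow_div_factorial |0|).mul_right C |>.of_norm_bounded fun n => by
      rw [Real.norm_eq_abs, abs_mul, abs_div, abs_pow, Nat.abs_cast]
      gcongr
      exact hw n)
    (by simp [R])
  have h2 : (∑' n : ℕ, (n * s ^ (n - 1) / n.factorial * w n))
      = ∑' n : ℕ, (s ^ n / n.factorial * w (n + 1)) := by
    have hs : Summable (fun n : ℕ => n * s ^ (n - 1) / n.factorial * w n) :=
      hsu.of_norm_bounded fun n => by
        rw [Real.norm_eq_abs, abs_mul, abs_div, abs_mul, abs_pow, Nat.abs_cast, Nat.abs_cast]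
        gcongr
        · simp [R]
        · exact hw n
    rw [hs.tsum_eq_zero_add]
    simp only [Nat.cast_zero, zero_mul, zero_div, zero_add]
    refine tsum_congr fun n => ?_
    rw [Nat.factorial_succ]
    push_cast
    have : (n.factorial : ℝ) ≠ 0 := by positivity
    field_simp
  rw [h2] at h1
  have h3 : HasDerivAt (fun s : ℝ => Real.exp (-s)) (-Real.exp (-s)) s := by
    simpa using (hasDerivAt_neg s).exp
  have h4 := h3.mul h1
  have e : ∀ (v : ℕ → ℝ) (y : ℝ), poisE y v = Real.exp (-y) * ∑' n : ℕ, y ^ n / n.factorial * v n :=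
    fun v y => by
      rw [← tsum_mul_left]; exact tsum_congr fun n => by unfold pois; ring
  have e' : (fun s => poisE s w)
      = (fun s : ℝ => Real.exp (-s)) * fun y : ℝ => ∑' n : ℕ, y ^ n / n.factorial * w n := by
    funext y; exact e w y
  rw [e', e, e]
  exact h4.congr_deriv (by ring)

/-- The Stein identity 𝔼[N w(N)] = s 𝔼[w(N + 1)], from `pois_succ`. All moments, inverse moments and
summations by parts below come from it. -/
lemma hasSum_pois_shift {s : ℝ} {w : ℕ → ℝ} {a : ℝ}
    (h : HasSum (fun n => pois s n * w (n + 1)) a) :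
    HasSum (fun n => pois s n * (n * w n)) (s * a) := by
  rw [← hasSum_nat_add_iff' 1]
  simp only [Finset.range_one, Finset.sum_singleton, Nat.cast_zero, zero_mul, mul_zero, sub_zero]
  refine (h.mul_left s).congr_fun ?_
  intro n
  have := pois_succ s n
  push_cast
  linear_combination (w (n + 1)) * this

lemma poisE_shift {s : ℝ} {w : ℕ → ℝ} {C : ℝ} (hw : ∀ n, |w n| ≤ C) :
    poisE s (fun n => n * w n) = s * poisE s (fun n => w (n + 1)) :=
  (hasSum_pois_shift (summable_pois_mul s fun n => hw (n + 1)).hasSum).tsum_eq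

lemma hasSum_pois_id (s : ℝ) : HasSum (fun n => pois s n * (n : ℝ)) s := by
  have := hasSum_pois_shift (s := s) (w := fun _ => 1) (a := 1) (by simpa using hasSum_pois s)
  simpa using this

lemma hasSum_pois_sq (s : ℝ) : HasSum (fun n => pois s n * (n : ℝ) ^ 2) (s ^ 2 + s) := by
  have := hasSum_pois_shift (s := s) (w := fun n => n) (a := s + 1) (by
    refine ((hasSum_pois_id s).add (hasSum_pois s)).congr_fun fun n => ?_
    push_cast; ring)
  convert this using 1
  · funext n; ring
  · ring

lemma hasSum_pois_cube (s : ℝ) :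
    HasSum (fun n => pois s n * (n : ℝ) ^ 3) (s ^ 3 + 3 * s ^ 2 + s) := by
  have := hasSum_pois_shift (s := s) (w := fun n => (n : ℝ) ^ 2) (a := (s ^ 2 + s) + 2 * s + 1) (by
    refine (((hasSum_pois_sq s).add ((hasSum_pois_id s).mul_left 2)).add
      (hasSum_pois s)).congr_fun fun n => ?_
    push_cast; ring)
  convert this using 1
  · funext n; ring
  · ring

lemma hasSum_pois_fourth (s : ℝ) :
    HasSum (fun n => pois s n * (n : ℝ) ^ 4) (s ^ 4 + 6 * s ^ 3 + 7 * s ^ 2 + s) := by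
  have := hasSum_pois_shift (s := s) (w := fun n => (n : ℝ) ^ 3)
    (a := (s ^ 3 + 3 * s ^ 2 + s) + 3 * (s ^ 2 + s) + 3 * s + 1) (by
    refine ((((hasSum_pois_cube s).add ((hasSum_pois_sq s).mul_left 3)).add
      ((hasSum_pois_id s).mul_left 3)).add (hasSum_pois s)).congr_fun fun n => ?_
    push_cast; ring)
  convert this using 1
  · funext n; ring
  · ring

/-! #### Inverse moments -/

lemma abs_inv_succ_le (n : ℕ) : |((n : ℝ) + 1)⁻¹| ≤ 1 := by
  rw [abs_of_nonneg (by positivity)]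
  exact inv_le_one_of_one_le₀ (by linarith [(Nat.cast_nonneg n : (0 : ℝ) ≤ n)])

lemma poisE_inv_succ (s : ℝ) : s * poisE s (fun n => ((n : ℝ) + 1)⁻¹) = 1 - Real.exp (-s) := by
  -- Since `0⁻¹ = 0`, the product n · w(n) is the indicator of n ≥ 1, which has probability 1 -
  -- e^{-s}.
  have h1 := poisE_shift (s := s) (w := fun n => (n : ℝ)⁻¹) (C := 1) (fun n => by
    rcases n with _ | n
    · simp
    · push_cast; exact abs_inv_succ_le n)
  push_cast at h1
  rw [← h1]
  have h2 : HasSum (fun n : ℕ => pois s n * (n * (n : ℝ)⁻¹)) (1 - Real.exp (-s)) := by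
    rw [← hasSum_nat_add_iff' 1]
    have h3 := (hasSum_nat_add_iff' 1).2 (hasSum_pois s)
    have e : pois s 0 = Real.exp (-s) := by simp [pois]
    simp only [Finset.range_one, Finset.sum_singleton, Nat.cast_zero, zero_mul, mul_zero, sub_zero,
      e] at h3 ⊢
    refine h3.congr_fun fun n => ?_
    have : ((n : ℝ) + 1) ≠ 0 := by positivity
    push_cast
    field_simp
  exact h2.tsum_eq

lemma poisE_inv_succ_le {s : ℝ} (hs : 0 < s) : poisE s (fun n => ((n : ℝ) + 1)⁻¹) ≤ s⁻¹ := by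
  have h := poisE_inv_succ s
  have := Real.exp_pos (-s)
  rw [← mul_le_mul_iff_right₀ hs, mul_inv_cancel₀ hs.ne']
  linarith

/-- The shift identity with w(n) = 1/(n + 1) gives s² 𝔼[1/(N + 2)] = s - 1 + e^{-s}; conclude with
(s + 1)e^{-s} ≤ 1. -/
lemma poisE_inv_add_two_le {s : ℝ} (hs : 0 < s) :
    poisE s (fun n => ((n : ℝ) + 2)⁻¹) ≤ (s + 1)⁻¹ := by
  have h1 := poisE_shift (s := s) (w := fun n => ((n : ℝ) + 1)⁻¹) (C := 1) abs_inv_succ_le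
  have h2 : poisE s (fun n => (n : ℝ) * ((n : ℝ) + 1)⁻¹)
      = 1 - poisE s (fun n => ((n : ℝ) + 1)⁻¹) := by
    have h3 := poisE_sub s (v := fun _ => 1) (C := 1) (by simp) abs_inv_succ_le
    rw [poisE_const] at h3
    rw [← h3]
    congr 1
    funext n
    have : ((n : ℝ) + 1) ≠ 0 := by positivity
    field_simp
    ring
  have e : (fun n : ℕ => (((n + 1 : ℕ) : ℝ) + 1)⁻¹) = fun n : ℕ => ((n : ℝ) + 2)⁻¹ := by
    funext n; push_cast; ring_nf
  rw [h2, e] at h1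
  have h3 := poisE_inv_succ s
  set A := poisE s (fun n => ((n : ℝ) + 1)⁻¹)
  set B := poisE s (fun n => ((n : ℝ) + 2)⁻¹)
  have h4 : (s + 1) * Real.exp (-s) ≤ 1 := by
    rw [Real.exp_neg, mul_inv_le_iff₀ (Real.exp_pos s), one_mul]
    exact Real.add_one_le_exp s
  rw [← one_div, le_div_iff₀ (by linarith)]
  have h5 : s ^ 2 * (B * (s + 1)) = (s + 1) * (s - 1) + (s + 1) * Real.exp (-s) := by
    linear_combination (-(s + 1) * s) * h1 - (s + 1) * h3
  have : s ^ 2 * (B * (s + 1)) ≤ s ^ 2 * 1 := by rw [h5]; nlinarith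
  exact le_of_mul_le_mul_left this (by positivity)

/-- Compare (n + 1)^{-2} ≤ 2/((n + 1)(n + 2)) and apply the shift identity with w(n) = 1/(n(n + 1)),
which leaves s^{-1} 𝔼[1/(N + 1)]. -/
lemma poisE_inv_succ_sq_le {s : ℝ} (hs : 0 < s) :
    poisE s (fun n => (((n : ℝ) + 1)⁻¹) ^ 2) ≤ 2 / s ^ 2 := by
  have hb : ∀ n : ℕ, |((n : ℝ))⁻¹ * ((n : ℝ) + 1)⁻¹| ≤ 1 := fun n => by
    rw [abs_mul]
    refine mul_le_one₀ ?_ (abs_nonneg _) (abs_inv_succ_le n)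
    rcases n with _ | n
    · simp
    · push_cast; exact abs_inv_succ_le n
  have h1 := poisE_shift (s := s) (w := fun n => ((n : ℝ))⁻¹ * ((n : ℝ) + 1)⁻¹) (C := 1) hb
  have h2 : poisE s (fun n => (n : ℝ) * (((n : ℝ))⁻¹ * ((n : ℝ) + 1)⁻¹))
      ≤ poisE s (fun n => ((n : ℝ) + 1)⁻¹) := by
    have hle : ∀ n : ℕ, (n : ℝ) * (((n : ℝ))⁻¹ * ((n : ℝ) + 1)⁻¹) ≤ ((n : ℝ) + 1)⁻¹ := fun n => by
      rw [← mul_assoc]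
      refine mul_le_of_le_one_left (by positivity) ?_
      exact mul_inv_le_one
    refine poisE_mono hs.le (C := 1) (fun n => ?_) abs_inv_succ_le hle
    rw [abs_of_nonneg (by positivity)]
    exact (hle n).trans ((le_abs_self _).trans (abs_inv_succ_le n))
  have h3 : poisE s (fun n => (((n : ℝ) + 1)⁻¹) ^ 2)
      ≤ poisE s (fun n => 2 * ((((n + 1 : ℕ) : ℝ))⁻¹ * (((n + 1 : ℕ) : ℝ) + 1)⁻¹)) := by
    refine poisE_mono hs.le (C := 1) (fun n => ?_) (D := 2) (fun n => ?_) fun n => ?_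
    · rw [abs_pow]; exact pow_le_one₀ (abs_nonneg _) (abs_inv_succ_le n)
    · rw [abs_mul, abs_two]; have := hb (n + 1); linarith
    · push_cast
      have h0 : (0 : ℝ) ≤ n := Nat.cast_nonneg n
      rw [sq, ← mul_inv, ← mul_inv, ← div_eq_mul_inv, inv_eq_one_div, div_le_div_iff₀ (by positivity) (by positivity)]
      nlinarith
  rw [poisE_const_mul] at h3
  have h4 := poisE_inv_succ_le hs
  refine h3.trans ?_
  rw [div_eq_mul_inv]
  refine mul_le_mul_of_nonneg_left ?_ (by norm_num)
  rw [← mul_le_mul_iff_right₀ hs, ← h1]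
  refine h2.trans (h4.trans_eq ?_)
  field_simp

/-! #### The maximal weight, and differences -/

/-- The left side is the integral of log over [k - 1/2, k + 1/2], so this is the midpoint inequality
for a concave function. The proof varies the half-width y: the derivative is log((k + y)(k - y)) -
log k² ≤ 0. -/
lemma mul_log_sub_le_log {k : ℝ} (hk : 1 ≤ k) :
    ((k + 1 / 2) * Real.log (k + 1 / 2) - (k + 1 / 2))
      - ((k - 1 / 2) * Real.log (k - 1 / 2) - (k - 1 / 2)) ≤ Real.log k := by
  let φ : ℝ → ℝ := fun y => ((k + y) * Real.log (k + y) - (k + y))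
      - ((k - y) * Real.log (k - y) - (k - y)) - 2 * y * Real.log k
  have hd : ∀ y ∈ Icc (0 : ℝ) (1 / 2), HasDerivAt φ
      (Real.log (k + y) + Real.log (k - y) - 2 * Real.log k) y := by
    intro y hy
    have h1 : k + y ≠ 0 := by linarith [hy.1]
    have h2 : k - y ≠ 0 := by linarith [hy.2]
    have a1 : HasDerivAt (fun y : ℝ => k + y) 1 y := by simpa using (hasDerivAt_id y).const_add k
    have a2 : HasDerivAt (fun y : ℝ => k - y) (-1) y := by simpa using (hasDerivAt_id y).const_sub k
    have b1 := (a1.mul (a1.log h1)).sub a1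
    have b2 := (a2.mul (a2.log h2)).sub a2
    have b3 := (((hasDerivAt_id y).const_mul 2).mul_const (Real.log k))
    refine ((b1.sub b2).sub b3).congr_deriv ?_
    field_simp
    ring
  have hanti : AntitoneOn φ (Icc 0 (1 / 2)) := by
    refine antitoneOn_of_deriv_nonpos (convex_Icc _ _)
      (fun y hy => (hd y hy).continuousAt.continuousWithinAt)
      (fun y hy => (hd y (interior_subset hy)).differentiableAt.differentiableWithinAt) ?_
    intro y hy
    have hy' := interior_subset hy
    have hky : 0 < k - y := by linarith [hy'.2]
    have hky' : 0 < k + y := by linarith [hy'.1]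
    have hlog : Real.log ((k + y) * (k - y)) ≤ Real.log (k ^ 2) :=
      Real.log_le_log (by positivity) (by nlinarith [sq_nonneg y])
    rw [Real.log_mul hky'.ne' hky.ne', Real.log_pow] at hlog
    rw [(hd y hy').deriv]
    push_cast at hlog
    linarith
  have := hanti (left_mem_Icc.2 (by norm_num)) (right_mem_Icc.2 (by norm_num)) (by norm_num)
  simp only [φ] at this
  norm_num at this ⊢
  linarith

/-- Summing the midpoint inequality gives a Stirling-type lower bound for log m!, with equality at m
= 0. With c = m + 1/2, the factor √s · s^m e^{-s} = exp(c log s - s) is largest at s = c. -/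
lemma pois_le {s : ℝ} (hs : 0 < s) (m : ℕ) : pois s m ≤ (Real.sqrt (2 * Real.exp 1 * s))⁻¹ := by
  have h1 : ∀ m : ℕ, ((m : ℝ) + 1 / 2) * Real.log (m + 1 / 2) - (m + 1 / 2)
      ≤ Real.log m.factorial - (1 + Real.log 2) / 2 := by
    intro m
    induction m with
    | zero =>
      simp only [Nat.cast_zero, zero_add, Nat.factorial_zero, Nat.cast_one, Real.log_one, one_div,
        Real.log_inv]
      linarith
    | succ m ih =>
      have h := mul_log_sub_le_log (k := m + 1) (by linarith [(Nat.cast_nonneg m : (0 : ℝ) ≤ m)])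
      rw [Nat.factorial_succ, Nat.cast_mul, Real.log_mul (by positivity) (by positivity)]
      push_cast
      have e : (m : ℝ) + 1 - 1 / 2 = m + 1 / 2 := by ring
      rw [e] at h
      linarith
  have h2 := h1 m
  set c : ℝ := m + 1 / 2 with hc
  have hc0 : 0 < c := by positivity
  have h3 : c * Real.log s - s ≤ c * Real.log c - c := by
    have := Real.log_le_sub_one_of_pos (div_pos hs hc0)
    rw [Real.log_div hs.ne' hc0.ne'] at this
    have h4 := mul_le_mul_of_nonneg_left this hc0.le
    have : c * (s / c - 1) = s - c := by field_simp
    linarith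
  rw [← Real.log_le_log_iff (pois_pos hs m) (by positivity), Real.log_inv,
    Real.log_sqrt (by positivity), Real.log_mul (by positivity) hs.ne',
    Real.log_mul (by norm_num) (by positivity), Real.log_exp]
  unfold pois
  rw [Real.log_mul (by positivity) (by positivity), Real.log_exp,
    Real.log_div (by positivity) (by positivity), Real.log_pow]
  have : (m : ℝ) = c - 1 / 2 := by rw [hc]; ring
  rw [this]
  linarith

/-- The weights increase up to ⌊s⌋ and decrease afterwards. Abel summation therefore bounds the sum
by the weight at the mode: use g ≥ 0 on the increasing side and g ≤ 1 on the decreasing side. -/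
lemma poisE_forward_diff_le {s : ℝ} (hs : 0 < s) {g : ℕ → ℝ} (hg : ∀ n, g n ∈ Icc (0 : ℝ) 1) :
    poisE s (fun n => g (n + 1) - g n) ≤ (Real.sqrt (2 * Real.exp 1 * s))⁻¹ := by
  set m := ⌊s⌋₊
  have hup : ∀ n, n < m → pois s n ≤ pois s (n + 1) := fun n hn => by
    have h1 : (n : ℝ) + 1 ≤ s := by
      have : ((n + 1 : ℕ) : ℝ) ≤ s := (Nat.le_floor_iff hs.le).1 hn
      exact_mod_cast this
    have h2 := pois_succ s n
    have h3 := pois_nonneg hs.le (n + 1)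
    have : s * pois s n ≤ s * pois s (n + 1) := by rw [← h2]; nlinarith
    exact le_of_mul_le_mul_left this hs
  have hdown : ∀ n, m ≤ n → pois s (n + 1) ≤ pois s n := fun n hn => by
    have h1 : s ≤ n + 1 := by
      have : s < (n + 1 : ℕ) := (Nat.floor_lt hs.le).1 (Nat.lt_succ_of_le hn)
      exact_mod_cast this.le
    have h2 := pois_succ s n
    have h3 := pois_nonneg hs.le (n + 1)
    have : s * pois s (n + 1) ≤ s * pois s n := by rw [← h2]; nlinarith
    exact le_of_mul_le_mul_left this hs
  have h1 : ∀ k ≤ m, ∑ n ∈ Finset.range k, pois s n * (g (n + 1) - g n) ≤ pois s k * g k := by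
    intro k
    induction k with
    | zero => intro _; simpa using mul_nonneg (pois_nonneg hs.le 0) (hg 0).1
    | succ k ih =>
      intro hk
      rw [Finset.sum_range_succ]
      have a := ih (by omega)
      have b := mul_le_mul_of_nonneg_right (hup k hk) (hg (k + 1)).1
      linarith
  have h2 : ∀ j, ∑ n ∈ Finset.range (m + j), pois s n * (g (n + 1) - g n)
      ≤ pois s m - pois s (m + j) * (1 - g (m + j)) := by
    intro j
    induction j with
    | zero => have := h1 m le_rfl; simp only [add_zero]; linarith
    | succ j ih =>
      rw [← add_assoc, Finset.sum_range_succ]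
      have b := mul_le_mul_of_nonneg_right (hdown (m + j) (by omega))
        (sub_nonneg.2 (hg (m + j + 1)).2)
      linarith
  have hb : ∀ n, |g (n + 1) - g n| ≤ 1 := fun n => by
    rw [abs_le]; constructor <;> linarith [(hg n).1, (hg n).2, (hg (n + 1)).1, (hg (n + 1)).2]
  have ht := (summable_pois_mul s hb).hasSum.tendsto_sum_nat
  refine le_of_tendsto ht (Filter.eventually_atTop.2 ⟨m, fun k hk => ?_⟩)
  obtain ⟨j, rfl⟩ := Nat.exists_eq_add_of_le hk
  refine (h2 j).trans ?_
  have := mul_nonneg (pois_nonneg hs.le (m + j)) (sub_nonneg.2 (hg (m + j)).2)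
  linarith [pois_le hs m]

lemma abs_poisE_forward_diff_le {s : ℝ} (hs : 0 < s) {g : ℕ → ℝ}
    (hg : ∀ n, g n ∈ Icc (0 : ℝ) 1) :
    |poisE s (fun n => g (n + 1) - g n)| ≤ (Real.sqrt (2 * Real.exp 1 * s))⁻¹ := by
  refine abs_le.2 ⟨?_, poisE_forward_diff_le hs hg⟩
  have h := poisE_forward_diff_le hs (g := fun n => 1 - g n) fun n =>
    ⟨by linarith [(hg n).2], by linarith [(hg n).1]⟩
  have e : poisE s (fun n => 1 - g (n + 1) - (1 - g n)) = -poisE s (fun n => g (n + 1) - g n) := by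
    have := poisE_const_mul s (-1) (fun n => g (n + 1) - g n)
    rw [neg_one_mul] at this
    rw [← this]; congr 1; funext n; ring
  rw [e] at h
  linarith

end Poisson

/-! ### Thinning -/

section Thinning

variable {X : Type*}

/-- The expectation of `g` at the point measure obtained from `ζ` by keeping each point
independently with probability `r`. -/
def thin (r : ℝ) (g : PointMeasure X → ℝ) (ζ : PointMeasure X) : ℝ :=
  (ζ.antidiagonal.map fun z => r ^ Multiset.card z.1 * (1 - r) ^ Multiset.card z.2 * g z.1).sum

/-- The function `ζ ↦ g(ζ + δ_x)`. -/
def addPoint (x : X) (g : PointMeasure X → ℝ) : PointMeasure X → ℝ := fun ζ => g (ζ + {x})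

@[simp] lemma thin_zero (r : ℝ) (g : PointMeasure X → ℝ) : thin r g 0 = g 0 := by
  simp [thin]

/-- Condition on the survival of `x`. This recursion drives every later induction on the number of
points. -/
lemma thin_cons (r : ℝ) (g : PointMeasure X → ℝ) (x : X) (ζ : PointMeasure X) :
    thin r g (x ::ₘ ζ) = r * thin r (addPoint x g) ζ + (1 - r) * thin r g ζ := by
  unfold thin addPoint
  rw [Multiset.antidiagonal_cons, Multiset.map_add, Multiset.sum_add, Multiset.map_map,
    Multiset.map_map, ← Multiset.sum_map_mul_left, ← Multiset.sum_map_mul_left, add_comm]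
  congr 2
  · refine Multiset.map_congr rfl fun z _ => ?_
    simp only [Function.comp_apply, Prod.map_fst, Prod.map_snd, id,
      ← Multiset.singleton_add, add_comm z.1 {x}]
    simp only [Multiset.card_add, Multiset.card_singleton]
    ring
  · refine Multiset.map_congr rfl fun z _ => ?_
    simp only [Function.comp_apply, Prod.map_fst, Prod.map_snd, id, Multiset.card_cons]
    ring

lemma thin_add_singleton (r : ℝ) (g : PointMeasure X → ℝ) (x : X) (ζ : PointMeasure X) :
    thin r g (ζ + {x}) = r * thin r (addPoint x g) ζ + (1 - r) * thin r g ζ := by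
  rw [add_comm, Multiset.singleton_add, thin_cons]

lemma thin_one (g : PointMeasure X → ℝ) (ζ : PointMeasure X) : thin 1 g ζ = g ζ := by
  induction ζ using Multiset.induction_on generalizing g with
  | empty => simp
  | cons a s ih =>
    rw [thin_cons, ih, addPoint, add_comm s, Multiset.singleton_add]; ring

lemma thin_const (r c : ℝ) (ζ : PointMeasure X) : thin r (fun _ => c) ζ = c := by
  induction ζ using Multiset.induction_on with
  | empty => simp
  | cons a s ih =>
    have e : addPoint a (fun _ : PointMeasure X => c) = fun _ => c := rfl
    rw [thin_cons, e, ih]; ring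

lemma thin_sub (r : ℝ) (g h : PointMeasure X → ℝ) (ζ : PointMeasure X) :
    thin r (fun η => g η - h η) ζ = thin r g ζ - thin r h ζ := by
  unfold thin
  rw [← Multiset.sum_map_sub]
  congr 1
  exact Multiset.map_congr rfl fun z _ => by ring

lemma thin_mono {r : ℝ} (hr : r ∈ Icc (0 : ℝ) 1) {g h : PointMeasure X → ℝ} (hgh : ∀ η, g η ≤ h η)
    (ζ : PointMeasure X) : thin r g ζ ≤ thin r h ζ := by
  unfold thin
  refine Multiset.sum_map_le_sum_map _ _ fun z _ => ?_
  have h1 := hr.1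
  have h2 : 0 ≤ 1 - r := sub_nonneg.2 hr.2
  exact mul_le_mul_of_nonneg_left (hgh _) (by positivity)

lemma thin_mem_Icc {r : ℝ} (hr : r ∈ Icc (0 : ℝ) 1) {g : PointMeasure X → ℝ} {a b : ℝ}
    (hg : ∀ η, g η ∈ Icc a b) (ζ : PointMeasure X) : thin r g ζ ∈ Icc a b :=
  ⟨(thin_const r a ζ).ge.trans (thin_mono hr (fun η => (hg η).1) ζ),
    (thin_mono hr (fun η => (hg η).2) ζ).trans (thin_const r b ζ).le⟩

lemma abs_thin_le {r : ℝ} (hr : r ∈ Icc (0 : ℝ) 1) {g : PointMeasure X → ℝ} {C : ℝ}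
    (hg : ∀ η, |g η| ≤ C) (ζ : PointMeasure X) : |thin r g ζ| ≤ C :=
  abs_le.2 (thin_mem_Icc hr (fun η => abs_le.1 (hg η)) ζ)

end Thinning

/-! ### Adding a random point, and adding a Poisson process -/

section AddRandom

variable {X : Type*} [MeasurableSpace X]

/-- The expectation of `f(ζ + δ_Y)` for a random point `Y` with law `μ`. -/
def addRandom (μ : Measure X) (f : PointMeasure X → ℝ) (ζ : PointMeasure X) : ℝ :=
  ∫ y, f (ζ + {y}) ∂μ

lemma addRandom_addPoint (μ : Measure X) (x : X) (f : PointMeasure X → ℝ) :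
    addRandom μ (addPoint x f) = addPoint x (addRandom μ f) := by
  funext ζ
  unfold addRandom addPoint
  simp only [add_right_comm ζ]

lemma iterate_addRandom_addPoint (μ : Measure X) (x : X) (f : PointMeasure X → ℝ) (n : ℕ) :
    (addRandom μ)^[n] (addPoint x f) = addPoint x ((addRandom μ)^[n] f) := by
  induction n with
  | zero => rfl
  | succ n ih => rw [Function.iterate_succ_apply', ih, addRandom_addPoint,
      Function.iterate_succ_apply']

/-- The expectation of `f(ζ + Z)` for a Poisson process `Z` with expectation measure `s μ`. -/
def addPoisson (μ : Measure X) (s : ℝ) (f : PointMeasure X → ℝ) (ζ : PointMeasure X) : ℝ :=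
  poisE s fun n => (addRandom μ)^[n] f ζ

lemma addPoisson_addPoint (μ : Measure X) (s : ℝ) (x : X) (f : PointMeasure X → ℝ) :
    addPoisson μ s (addPoint x f) = addPoint x (addPoisson μ s f) := by
  funext ζ
  unfold addPoisson
  simp only [iterate_addRandom_addPoint]
  rfl

lemma addPoisson_zero (μ : Measure X) (f : PointMeasure X → ℝ) : addPoisson μ 0 f = f := by
  funext ζ
  unfold addPoisson poisE
  rw [tsum_eq_single 0 fun n hn => by simp [pois, hn]]
  simp [pois]

lemma measurable_add_singleton (ζ : PointMeasure X) : Measurable (fun y : X => ζ + {y}) :=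
  measurable_addPoint.comp (measurable_const.prodMk measurable_id)

end AddRandom

/-! ### Stability of the Lipschitz class, and the derivative in the Poisson intensity. -/

section Immigration

variable {X : Type*} [MetricSpace X]

/-- The `[0,1]`-valued functions on `𝔑` that are Lipschitz in each point. -/
structure UnitLipschitz (f : PointMeasure X → ℝ) : Prop where
  mem_Icc : ∀ ζ, f ζ ∈ Icc (0 : ℝ) 1
  pointLipschitz : PointLipschitz f

lemma UnitLipschitz.abs_le {f : PointMeasure X → ℝ} (hf : UnitLipschitz f) (ζ : PointMeasure X) :
    |f ζ| ≤ 1 := by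
  rw [abs_of_nonneg (hf.mem_Icc ζ).1]; exact (hf.mem_Icc ζ).2

lemma UnitLipschitz.addPoint {f : PointMeasure X → ℝ} (hf : UnitLipschitz f) (x : X) :
    UnitLipschitz (addPoint x f) where
  mem_Icc ζ := hf.mem_Icc _
  pointLipschitz ζ y z := by
    have h := hf.pointLipschitz (ζ + {x}) y z
    unfold PoissonStein.addPoint
    rwa [add_right_comm ζ {y}, add_right_comm ζ {z}]

lemma UnitLipschitz.thin {f : PointMeasure X → ℝ} (hf : UnitLipschitz f) {r : ℝ}
    (hr : r ∈ Icc (0 : ℝ) 1) : UnitLipschitz (thin r f) where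
  mem_Icc := thin_mem_Icc hr hf.mem_Icc
  pointLipschitz ζ x y := by
    have h : ∀ η, |PoissonStein.addPoint x f η - PoissonStein.addPoint y f η| ≤ dist x y :=
      fun η => hf.pointLipschitz η x y
    rw [thin_add_singleton, thin_add_singleton, add_sub_add_right_eq_sub, ← mul_sub, ← thin_sub,
      abs_mul, abs_of_nonneg hr.1]
    exact (mul_le_of_le_one_left (abs_nonneg _) hr.2).trans (abs_thin_le hr h ζ)

variable [MeasurableSpace X] [BorelSpace X] [SecondCountableTopology X] (μ : Measure X) [IsProbabilityMeasure μ]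

lemma UnitLipschitz.integrable {f : PointMeasure X → ℝ} (hf : UnitLipschitz f)
    (ζ : PointMeasure X) : Integrable (fun y => f (ζ + {y})) μ :=
  Integrable.of_bound (hf.pointLipschitz.measurable.comp
    (measurable_add_singleton ζ)).aestronglyMeasurable 1 (Filter.Eventually.of_forall fun y => by
      simpa using hf.abs_le _)

lemma UnitLipschitz.addRandom {f : PointMeasure X → ℝ} (hf : UnitLipschitz f) :
    UnitLipschitz (addRandom μ f) where
  mem_Icc ζ := by
    refine ⟨integral_nonneg fun y => (hf.mem_Icc _).1, ?_⟩
    refine (integral_mono (hf.integrable μ ζ) (integrable_const 1)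
      fun y => (hf.mem_Icc _).2).trans_eq ?_
    simp
  pointLipschitz ζ x y := by
    unfold PoissonStein.addRandom
    rw [← integral_sub (hf.integrable μ _) (hf.integrable μ _)]
    rw [← Real.norm_eq_abs, ← mul_one (dist x y), ← probReal_univ (μ := μ)]
    refine norm_integral_le_of_norm_le_const (Filter.Eventually.of_forall fun z => ?_)
    rw [add_right_comm ζ {x}, add_right_comm ζ {y}]
    exact hf.pointLipschitz _ x y

lemma UnitLipschitz.iterate_addRandom {f : PointMeasure X → ℝ} (hf : UnitLipschitz f) (n : ℕ) :
    UnitLipschitz ((PoissonStein.addRandom μ)^[n] f) := by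
  induction n with
  | zero => exact hf
  | succ n ih => rw [Function.iterate_succ_apply']; exact ih.addRandom μ

lemma UnitLipschitz.addPoisson {f : PointMeasure X → ℝ} (hf : UnitLipschitz f) {s : ℝ}
    (hs : 0 ≤ s) : UnitLipschitz (addPoisson μ s f) where
  mem_Icc ζ := by
    have hb := fun n => (hf.iterate_addRandom μ n).abs_le ζ
    refine ⟨?_, (le_abs_self _).trans (abs_poisE_le hs hb)⟩
    have := poisE_mono hs (v := fun _ => 0) (C := 1) (by simp) hb
      fun n => ((hf.iterate_addRandom μ n).mem_Icc ζ).1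
    rwa [poisE_const] at this
  pointLipschitz ζ x y := by
    unfold PoissonStein.addPoisson
    rw [← poisE_sub s (fun n => (hf.iterate_addRandom μ n).abs_le _)
      (fun n => (hf.iterate_addRandom μ n).abs_le _)]
    exact abs_poisE_le hs fun n => (hf.iterate_addRandom μ n).pointLipschitz ζ x y

lemma poisE_addRandom {f : PointMeasure X → ℝ} (hf : UnitLipschitz f) {s : ℝ} (hs : 0 ≤ s)
    (ζ : PointMeasure X) :
    poisE s (fun n => (addRandom μ)^[n + 1] f ζ) = addRandom μ (addPoisson μ s f) ζ := by
  have hb := fun n (y : X) => (hf.iterate_addRandom μ n).abs_le (ζ + {y})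
  have h := integral_tsum_of_summable_integral_norm (μ := μ)
    (F := fun (n : ℕ) (y : X) => pois s n * (addRandom μ)^[n] f (ζ + {y}))
    (fun n => ((hf.iterate_addRandom μ n).integrable μ ζ).const_mul _) (by
      refine Summable.of_nonneg_of_le (fun n => integral_nonneg fun y => norm_nonneg _)
        (fun n => ?_) (hasSum_pois s).summable
      refine (integral_mono (((hf.iterate_addRandom μ n).integrable μ ζ).const_mul _).norm
        (integrable_const (pois s n)) fun y => ?_).trans_eq (by simp)
      rw [Real.norm_eq_abs, abs_mul, abs_of_nonneg (pois_nonneg hs n)]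
      exact mul_le_of_le_one_right (pois_nonneg hs n) (hb n y))
  simp only [integral_const_mul] at h
  unfold poisE
  simp only [Function.iterate_succ_apply']
  exact h

lemma hasDerivAt_addPoisson {f : PointMeasure X → ℝ} (hf : UnitLipschitz f) {s : ℝ} (hs : 0 ≤ s)
    (ζ : PointMeasure X) :
    HasDerivAt (fun s => addPoisson μ s f ζ)
      (addRandom μ (addPoisson μ s f) ζ - addPoisson μ s f ζ) s := by
  rw [← poisE_addRandom μ hf hs]
  exact hasDerivAt_poisE s fun n => (hf.iterate_addRandom μ n).abs_le ζ

end Immigration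

/-! ### The semigroup of the immigration-death process -/

section RemovePoint

variable {X : Type*}

lemma removePoint_cons_self (x : X) (ζ : PointMeasure X) : removePoint (x ::ₘ ζ) x = ζ := by
  classical
  exact Multiset.erase_cons_head x ζ

lemma removePoint_cons_of_mem (x : X) {ζ : PointMeasure X} {y : X} (hy : y ∈ ζ) :
    removePoint (x ::ₘ ζ) y = x ::ₘ removePoint ζ y := by
  classical
  unfold removePoint
  by_cases h : x = y
  · subst h
    rw [Multiset.erase_cons_head, Multiset.cons_erase hy]
  · exact Multiset.erase_cons_tail _ h

end RemovePoint

section Semigroup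

variable {X : Type*} [MeasurableSpace X]

/-- The expectation of `f` under the superposition of the `e^{-t}`-thinning of `ζ` and a Poisson
process with expectation measure `(1 - e^{-t}) l μ`. -/
def semigroup (l : ℝ) (μ : Measure X) (f : PointMeasure X → ℝ) (t : ℝ) :
    PointMeasure X → ℝ :=
  thin (Real.exp (-t)) (addPoisson μ (l * (1 - Real.exp (-t))) f)

lemma semigroup_cons (l : ℝ) (μ : Measure X) (f : PointMeasure X → ℝ) (t : ℝ) (x : X)
    (ζ : PointMeasure X) :
    semigroup l μ f t (x ::ₘ ζ) = Real.exp (-t) * semigroup l μ (addPoint x f) t ζ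
      + (1 - Real.exp (-t)) * semigroup l μ f t ζ := by
  unfold semigroup
  rw [thin_cons, addPoisson_addPoint]

lemma semigroup_zero (l : ℝ) (μ : Measure X) (f : PointMeasure X → ℝ) :
    semigroup l μ f 0 = f := by
  funext ζ
  unfold semigroup
  simp [thin_one, addPoisson_zero]

lemma exp_neg_mem_Icc {t : ℝ} (ht : 0 ≤ t) : Real.exp (-t) ∈ Icc (0 : ℝ) 1 :=
  ⟨(Real.exp_pos _).le, Real.exp_le_one_iff.2 (neg_nonpos.2 ht)⟩

/-- The generator of the immigration-death process with immigration measure `l μ`. -/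
def generator (l : ℝ) (μ : Measure X) (g : PointMeasure X → ℝ) (ζ : PointMeasure X) : ℝ :=
  l * (addRandom μ g ζ - g ζ) + (ζ.map fun y => g (removePoint ζ y) - g ζ).sum

end Semigroup

/-! ### The backward equation for the superposition of thinning and immigration. -/

section BackwardEquation

variable {X : Type*} [MetricSpace X] [MeasurableSpace X] [BorelSpace X] [SecondCountableTopology X]
  (l : ℝ) (μ : Measure X) [IsProbabilityMeasure μ] {f : PointMeasure X → ℝ}

lemma UnitLipschitz.semigroup (hl : 0 ≤ l) (hf : UnitLipschitz f) {t : ℝ} (ht : 0 ≤ t) :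
    UnitLipschitz (semigroup l μ f t) :=
  (hf.addPoisson μ (mul_nonneg hl (sub_nonneg.2 (exp_neg_mem_Icc ht).2))).thin (exp_neg_mem_Icc ht)

lemma addRandom_semigroup_cons (hl : 0 ≤ l) (hf : UnitLipschitz f) {t : ℝ} (ht : 0 ≤ t) (x : X)
    (ζ : PointMeasure X) :
    addRandom μ (PoissonStein.semigroup l μ f t) (x ::ₘ ζ)
      = Real.exp (-t) * addRandom μ (PoissonStein.semigroup l μ (addPoint x f) t) ζ
        + (1 - Real.exp (-t)) * addRandom μ (PoissonStein.semigroup l μ f t) ζ := by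
  unfold addRandom
  simp only [Multiset.cons_add, semigroup_cons]
  rw [integral_add, integral_const_mul, integral_const_mul]
  · exact (((hf.addPoint x).semigroup l μ hl ht).integrable μ ζ).const_mul _
  · exact ((hf.semigroup l μ hl ht).integrable μ ζ).const_mul _

/-- Particles evolve independently: the last term is the death of `x`, the others act on `ζ` with
`x` alive or dead at time t. This is the recursion obtained by differentiating `semigroup_cons` in
t. -/
lemma generator_semigroup_cons (hl : 0 ≤ l) (hf : UnitLipschitz f) {t : ℝ} (ht : 0 ≤ t) (x : X)
    (ζ : PointMeasure X) :
    generator l μ (PoissonStein.semigroup l μ f t) (x ::ₘ ζ)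
      = Real.exp (-t) * generator l μ (PoissonStein.semigroup l μ (addPoint x f) t) ζ
        + (1 - Real.exp (-t)) * generator l μ (PoissonStein.semigroup l μ f t) ζ
        + Real.exp (-t) * (PoissonStein.semigroup l μ f t ζ
          - PoissonStein.semigroup l μ (addPoint x f) t ζ) := by
  unfold generator
  rw [addRandom_semigroup_cons l μ hl hf ht, Multiset.map_cons, Multiset.sum_cons,
    removePoint_cons_self]
  have h : (ζ.map fun y => PoissonStein.semigroup l μ f t (removePoint (x ::ₘ ζ) y)
        - PoissonStein.semigroup l μ f t (x ::ₘ ζ)).sum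
      = Real.exp (-t) * (ζ.map fun y =>
          PoissonStein.semigroup l μ (addPoint x f) t (removePoint ζ y)
            - PoissonStein.semigroup l μ (addPoint x f) t ζ).sum
        + (1 - Real.exp (-t)) * (ζ.map fun y =>
          PoissonStein.semigroup l μ f t (removePoint ζ y)
            - PoissonStein.semigroup l μ f t ζ).sum := by
    rw [← Multiset.sum_map_mul_left, ← Multiset.sum_map_mul_left, ← Multiset.sum_map_add]
    congr 1
    refine Multiset.map_congr rfl fun y hy => ?_
    rw [removePoint_cons_of_mem x hy, semigroup_cons, semigroup_cons]
    ring
  rw [h, semigroup_cons]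
  ring

/-- Kolmogorov's backward equation. -/
lemma hasDerivAt_semigroup (hl : 0 ≤ l) (hf : UnitLipschitz f) {t : ℝ} (ht : 0 ≤ t)
    (ζ : PointMeasure X) :
    HasDerivAt (fun t => PoissonStein.semigroup l μ f t ζ)
      (generator l μ (PoissonStein.semigroup l μ f t) ζ) t := by
  have he : HasDerivAt (fun t : ℝ => Real.exp (-t)) (-Real.exp (-t)) t := by
    simpa using (hasDerivAt_neg t).exp
  have he1 : HasDerivAt (fun t : ℝ => 1 - Real.exp (-t)) (Real.exp (-t)) t := by
    simpa using he.const_sub 1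
  have hs : 0 ≤ l * (1 - Real.exp (-t)) := mul_nonneg hl (sub_nonneg.2 (exp_neg_mem_Icc ht).2)
  -- The function must vary in the induction, since the recursion replaces `f` by `addPoint x f`.
  induction ζ using Multiset.induction_on generalizing f with
  | empty =>
    have h1 := (hasDerivAt_addPoisson μ hf hs 0).comp t (he1.const_mul l)
    have h2 : (fun t => PoissonStein.semigroup l μ f t 0)
        = (fun s => addPoisson μ s f 0) ∘ fun t => l * (1 - Real.exp (-t)) := by
      funext t; simp [PoissonStein.semigroup]
    rw [h2]
    refine h1.congr_deriv ?_
    unfold generator addRandom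
    have h3 : ∀ y : X, PoissonStein.semigroup l μ f t (0 + {y})
        = Real.exp (-t) * addPoisson μ (l * (1 - Real.exp (-t))) f (0 + {y})
          + (1 - Real.exp (-t)) * addPoisson μ (l * (1 - Real.exp (-t))) f 0 := fun y => by
      unfold PoissonStein.semigroup
      rw [thin_add_singleton, thin_zero, thin_zero]
      rfl
    simp only [h3]
    rw [integral_add (((hf.addPoisson μ hs).integrable μ 0).const_mul _) (integrable_const _),
      integral_const_mul, integral_const]
    simp only [PoissonStein.semigroup, thin_zero, probReal_univ, one_smul, Multiset.map_zero,
      Multiset.sum_zero]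
    ring
  | cons x ζ ih =>
    have h := (he.mul (ih (hf.addPoint x))).add (he1.mul (ih hf))
    rw [generator_semigroup_cons l μ hl hf ht]
    have e : (fun t => PoissonStein.semigroup l μ f t (x ::ₘ ζ))
        = ((fun t => Real.exp (-t)) * fun t => PoissonStein.semigroup l μ (addPoint x f) t ζ)
          + (fun t => 1 - Real.exp (-t)) * fun t => PoissonStein.semigroup l μ f t ζ := by
      funext t; exact semigroup_cons l μ f t x ζ
    rw [e]
    exact h.congr_deriv (by ring)

end BackwardEquation

/-! ### The state of the process at a fixed time -/

section StateAtShift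

variable {X : Type*}

lemma stateAt_eq_ite {t : ℝ} {ω : ℕ → ℝ × PointMeasure X} (h0 : (ω 0).1 ≤ t) :
    stateAt t ω = if t < (ω 1).1 then (ω 0).2 else stateAt t (fun n => ω (n + 1)) := by
  classical
  unfold stateAt
  split_ifs with h h1 h2 h3 h4
  · have : Nat.find h = 0 := (Nat.find_eq_zero h).2 ⟨h0, h1⟩
    rw [this]
  · have := Nat.find_comp_succ h h2 (by simp [h1])
    rw [this]
  · obtain ⟨n, hn⟩ := h
    rcases n with _ | n
    · exact absurd hn.2 h1
    · exact absurd ⟨n, hn⟩ h2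
  · exact absurd ⟨0, h0, h3⟩ h
  · obtain ⟨n, hn⟩ := h4
    exact absurd ⟨n + 1, hn⟩ h
  · rfl

lemma measurable_stateAt [MeasurableSpace X] (t : ℝ) :
    Measurable (stateAt t : (ℕ → ℝ × PointMeasure X) → PointMeasure X) := by
  classical
  let A : ℕ → Set (ℕ → ℝ × PointMeasure X) := fun n =>
    {ω | (ω n).1 ≤ t} ∩ {ω | t < (ω (n + 1)).1}
  have hA : ∀ n, MeasurableSet (A n) := fun n => MeasurableSet.inter
    (measurableSet_le (measurable_fst.comp (measurable_pi_apply n)) measurable_const)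
    (measurableSet_lt measurable_const (measurable_fst.comp (measurable_pi_apply (n + 1))))
  intro B hB
  have : stateAt t ⁻¹' B = (⋃ n, ((A n \ ⋃ k < n, A k) ∩ {ω | (ω n).2 ∈ B})) ∪
      ((⋃ n, A n)ᶜ ∩ {_ω | (0 : PointMeasure X) ∈ B}) := by
    ext ω
    simp only [mem_preimage, mem_union, mem_iUnion, mem_inter_iff, mem_sdiff, mem_compl_iff,
      mem_ofPred_eq, stateAt]
    by_cases h : ∃ n, (ω n).1 ≤ t ∧ t < (ω (n + 1)).1
    · rw [dif_pos h]
      constructor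
      · intro hB
        refine Or.inl ⟨Nat.find h, ⟨Nat.find_spec h, ?_⟩, hB⟩
        rintro ⟨k, hk, hk'⟩
        exact Nat.find_min h hk hk'
      · rintro (⟨n, ⟨hn, hn'⟩, hB⟩ | ⟨hn, _⟩)
        · have : Nat.find h = n := (Nat.find_eq_iff h).2 ⟨hn, fun k hk hk' => hn' ⟨k, hk, hk'⟩⟩
          rwa [this]
        · exact absurd h hn
    · rw [dif_neg h]
      constructor
      · exact fun hB => Or.inr ⟨h, hB⟩
      · rintro (⟨n, ⟨hn, _⟩, _⟩ | ⟨_, hB⟩)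
        · exact absurd ⟨n, hn⟩ h
        · exact hB
  rw [this]
  refine MeasurableSet.union (MeasurableSet.iUnion fun n => ?_) ?_
  · refine ((hA n).diff (MeasurableSet.iUnion fun k => MeasurableSet.iUnion fun _ => hA k)).inter ?_
    exact (measurable_snd.comp (measurable_pi_apply n)) hB
  · exact (MeasurableSet.iUnion hA).compl.inter (MeasurableSet.const _)

end StateAtShift

/-! ### The transition probabilities -/

section Transition

variable {X : Type*} [MeasurableSpace X] [MeasurableEq X]

lemma pathLaw_eq (lam : Measure X) [IsFiniteMeasure lam] [NeZero lam] (ξ : PointMeasure X) :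
    pathLaw lam ξ = chainKernel (stepKernel lam) (0, ξ) := rfl

/-- First-jump decomposition: before the first jump the state is `e.2`, and after it the Markov
property restarts the chain from the new jump time and state. -/
lemma integral_chainKernel_stateAt (lam : Measure X) [IsFiniteMeasure lam] [NeZero lam]
    {f : PointMeasure X → ℝ} (hf : Measurable f) (hb : ∀ ζ, |f ζ| ≤ 1) {t : ℝ}
    {e : ℝ × PointMeasure X} (he : e.1 ≤ t) :
    ∫ ω, f (stateAt t ω) ∂(chainKernel (stepKernel lam) e)
      = ∫ e', (if t < e'.1 then f e.2
          else ∫ ω, f (stateAt t ω) ∂(chainKernel (stepKernel lam) e')) ∂(stepKernel lam e) := by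
  set K := stepKernel lam
  -- `F` is to be evaluated on the shifted sequence, whose coordinate 0 carries the first jump time.
  let F : (ℕ → ℝ × PointMeasure X) → ℝ := fun ω => if t < (ω 0).1 then f e.2 else f (stateAt t ω)
  have hF : Measurable F := Measurable.ite
    (measurableSet_lt measurable_const (measurable_fst.comp (measurable_pi_apply 0)))
    measurable_const (hf.comp (measurable_stateAt t))
  have hFb : ∀ ω, ‖F ω‖ ≤ 1 := fun ω => by
    simp only [F]; split_ifs <;> exact hb _
  have hF' : ∀ e', ∫ ω, F ω ∂(chainKernel K e')
      = if t < e'.1 then f e.2 else ∫ ω, f (stateAt t ω) ∂(chainKernel K e') := by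
    intro e'
    split_ifs with h
    · have h1 := ae_chainKernel_zero K e' (p := fun z => t < z.1)
        (measurableSet_lt measurable_const measurable_fst) h
      rw [integral_congr_ae (g := fun _ => f e.2) (h1.mono fun ω hω => by simp [F, hω])]
      simp
    · have h1 := ae_chainKernel_zero K e' (p := fun z => ¬ t < z.1)
        (measurableSet_lt measurable_const measurable_fst).compl h
      exact integral_congr_ae (h1.mono fun ω hω => by simp [F, hω])
  have h0 := ae_chainKernel_zero K e (p := fun z => z.1 ≤ t)
    (measurableSet_le measurable_fst measurable_const) he
  have h1 := ae_chainKernel_zero K e (p := fun z => f z.2 = f e.2)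
    (measurableSet_eq_fun (hf.comp measurable_snd) measurable_const) rfl
  calc ∫ ω, f (stateAt t ω) ∂(chainKernel K e)
      = ∫ ω, F (fun n => ω (n + 1)) ∂(chainKernel K e) := by
        refine integral_congr_ae ?_
        filter_upwards [h0, h1] with ω hω0 hω1
        rw [stateAt_eq_ite hω0]
        simp only [F, zero_add]
        split_ifs
        · exact hω1
        · rfl
    _ = ∫ ω, F ω ∂((chainKernel K e).map fun x n => x (n + 1)) :=
        (integral_map (Measurable.aemeasurable (measurable_pi_lambda _ fun n => measurable_pi_apply (n + 1)))
          hF.aestronglyMeasurable).symm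
    _ = ∫ ω, F ω ∂((K e).bind (chainKernel K)) := by rw [chainKernel_map_shift]
    _ = ∫ ω, F ω ∂((chainKernel K ∘ₖ K) e) := by rw [Kernel.comp_apply]
    _ = ∫ e', ∫ ω, F ω ∂(chainKernel K e') ∂(K e) :=
        Kernel.integral_comp (Integrable.of_bound hF.aestronglyMeasurable 1
          (Filter.Eventually.of_forall hFb))
    _ = _ := by simp only [hF']; rfl

lemma measurable_integral_stateAt (lam : Measure X) [IsFiniteMeasure lam] [NeZero lam]
    {f : PointMeasure X → ℝ} (hf : Measurable f) (t : ℝ) :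
    Measurable (fun e => ∫ ω, f (stateAt t ω) ∂(chainKernel (stepKernel lam) e)) :=
  (StronglyMeasurable.integral_kernel (κ := chainKernel (stepKernel lam))
    (hf.comp (measurable_stateAt t)).stronglyMeasurable).measurable

lemma integral_stepKernel (lam : Measure X) [IsFiniteMeasure lam] [NeZero lam]
    {g : ℝ × PointMeasure X → ℝ} (hg : Measurable g) {C : ℝ} (hb : ∀ e, |g e| ≤ C)
    (e : ℝ × PointMeasure X) :
    ∫ e', g e' ∂(stepKernel lam e)
      = ∫ v, ∫ ζ, g (e.1 + v, ζ) ∂(jumpKernel lam e.2)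
          ∂(expMeasure (lam.real univ + Multiset.card e.2)) := by
  have h1 : stepKernel lam e = ((holdingKernel lam e.2).prod (jumpKernel lam e.2)).map
      (fun z => (e.1 + z.1, z.2)) := by
    unfold stepKernel
    rw [Kernel.map_apply _ (by fun_prop), Kernel.prod_apply, Kernel.id_apply,
      Kernel.comap_apply, Kernel.prod_apply, Measure.dirac_prod,
      Measure.map_map (by fun_prop) (by fun_prop)]
    rfl
  rw [h1, integral_map (by fun_prop) hg.aestronglyMeasurable, integral_prod]
  · rfl
  · exact Integrable.of_bound (hg.comp (by fun_prop)).aestronglyMeasurable C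
      (Filter.Eventually.of_forall fun z => hb _)

end Transition

lemma integral_expMeasure {q : ℝ} (hq : 0 < q) (g : ℝ → ℝ) :
    ∫ v, g v ∂(expMeasure q) = ∫ v in Ioi 0, q * Real.exp (-(q * v)) * g v := by
  have h1 : expMeasure q = volume.withDensity (exponentialPDF q) := rfl
  have hm : Measurable (exponentialPDF q) := (measurable_exponentialPDFReal q).ennreal_ofReal
  rw [h1, integral_withDensity_eq_integral_toReal_smul hm
    (Filter.Eventually.of_forall fun v => ENNReal.ofReal_lt_top), ← integral_Ici_eq_integral_Ioi,
    ← integral_indicator measurableSet_Ici]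
  refine integral_congr_ae (Filter.Eventually.of_forall fun v => ?_)
  by_cases hv : 0 ≤ v
  · have h2 : v ∈ Ici (0 : ℝ) := hv
    simp only [exponentialPDF_of_nonneg hv, indicator_of_mem h2, smul_eq_mul]
    rw [ENNReal.toReal_ofReal (by positivity)]
  · have h2 : v ∉ Ici (0 : ℝ) := hv
    simp only [exponentialPDF_of_neg (not_le.1 hv), indicator_of_notMem h2, ENNReal.toReal_zero,
      zero_smul]

/-! ### Integration against the immigration and jump measures. -/

section NormalizedMeasure

variable {X : Type*} [MeasurableSpace X]

lemma lam_real_pos (lam : Measure X) [IsFiniteMeasure lam] [NeZero lam] : 0 < lam.real univ := by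
  rw [measureReal_def]
  exact ENNReal.toReal_pos (by simpa using NeZero.ne lam) (measure_ne_top _ _)


instance isFiniteMeasure_toMeasure (ζ : PointMeasure X) : IsFiniteMeasure (toMeasure ζ) :=
  ⟨by rw [toMeasure_univ]; exact ENNReal.natCast_lt_top _⟩

lemma integral_toMeasure {g : X → ℝ} (hg : Measurable g) {C : ℝ} (hb : ∀ x, |g x| ≤ C)
    (ζ : PointMeasure X) : ∫ x, g x ∂(toMeasure ζ) = (ζ.map g).sum := by
  induction ζ using Multiset.induction_on with
  | empty => simp
  | cons a s ih =>
    have hint : ∀ μ : Measure X, IsFiniteMeasure μ → Integrable g μ := fun μ _ =>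
      Integrable.of_bound hg.aestronglyMeasurable C (Filter.Eventually.of_forall hb)
    rw [toMeasure_cons, integral_add_measure (hint _ inferInstance) (hint _ inferInstance), ih,
      integral_dirac' _ _ hg.stronglyMeasurable, Multiset.map_cons, Multiset.sum_cons]

/-- The normalized immigration measure. -/
def normalized (lam : Measure X) : Measure X := (lam univ)⁻¹ • lam

variable (lam : Measure X) [IsFiniteMeasure lam] [NeZero lam]

instance isProbabilityMeasure_normalized : IsProbabilityMeasure (normalized lam) := by
  unfold normalized; infer_instance

lemma integral_eq_mul_normalized (g : X → ℝ) :
    ∫ y, g y ∂lam = lam.real univ * ∫ y, g y ∂(normalized lam) := by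
  unfold normalized
  rw [integral_smul_measure, ENNReal.toReal_inv, smul_eq_mul, ← mul_assoc, ← measureReal_def,
    mul_inv_cancel₀ (lam_real_pos lam).ne', one_mul]

variable [MeasurableEq X]

lemma integral_jumpKernel {g : PointMeasure X → ℝ} (hg : Measurable g) {C : ℝ}
    (hb : ∀ x, |g x| ≤ C) (ζ : PointMeasure X) :
    (lam.real univ + Multiset.card ζ) * ∫ η, g η ∂(jumpKernel lam ζ)
      = lam.real univ * addRandom (normalized lam) g ζ
        + (ζ.map fun y => g (removePoint ζ y)).sum := by
  have hint : ∀ μ : Measure (PointMeasure X), IsFiniteMeasure μ → Integrable g μ := fun μ _ =>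
    Integrable.of_bound hg.aestronglyMeasurable C (Filter.Eventually.of_forall hb)
  have h1 : Measurable (fun x : X => ζ + {x}) := measurable_add_singleton ζ
  have h2 : Measurable (fun x : X => removePoint ζ x) :=
    measurable_removePoint.comp (measurable_const.prodMk measurable_id)
  have e : jumpKernel lam ζ = (lam univ + Multiset.card ζ)⁻¹ • rateMeasure lam ζ := rfl
  have hpos : 0 < lam.real univ + Multiset.card ζ := by
    have := lam_real_pos lam; positivity
  have e2 : ((lam univ + (Multiset.card ζ : ℝ≥0∞))⁻¹).toReal
      = (lam.real univ + Multiset.card ζ)⁻¹ := by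
    rw [ENNReal.toReal_inv, ENNReal.toReal_add (measure_ne_top _ _) (ENNReal.natCast_ne_top _)]
    simp [measureReal_def]
  rw [e, integral_smul_measure, e2, smul_eq_mul, ← mul_assoc, mul_inv_cancel₀ hpos.ne', one_mul]
  unfold rateMeasure
  rw [integral_add_measure (hint _ inferInstance) (hint _ inferInstance),
    integral_map h1.aemeasurable hg.aestronglyMeasurable,
    integral_map h2.aemeasurable hg.aestronglyMeasurable, integral_eq_mul_normalized,
    integral_toMeasure (g := fun x => g (removePoint ζ x)) (hg.comp h2) (fun x => hb _)]
  rfl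

end NormalizedMeasure

section PointSum

variable {X : Type*} [MeasurableSpace X]

lemma toMeasure_map_univ {n : ℕ} (x : Fin n → X) :
    toMeasure (Multiset.map x Finset.univ.val) = ∑ i, Measure.dirac (x i) := by
  unfold toMeasure
  rw [Multiset.map_map]
  rfl

lemma measurable_map_univ (n : ℕ) :
    Measurable (fun x : Fin n → X => (Multiset.map x Finset.univ.val : PointMeasure X)) := by
  refine measurable_pointMeasure fun A hA => ?_
  simp only [toMeasure_map_univ, Measure.finsetSum_apply]
  exact Finset.measurable_sum _ fun i _ =>
    (Measure.measurable_coe hA).comp (Measure.measurable_dirac.comp (measurable_pi_apply i))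

variable [MeasurableEq X]

lemma ae_jumpKernel_card_le (lam : Measure X) [IsFiniteMeasure lam] (ζ : PointMeasure X) :
    ∀ᵐ η ∂(jumpKernel lam ζ), Multiset.card η ≤ Multiset.card ζ + 1 := by
  have e : jumpKernel lam ζ = (lam univ + Multiset.card ζ)⁻¹ • rateMeasure lam ζ := rfl
  have hm : MeasurableSet {η : PointMeasure X | Multiset.card η ≤ Multiset.card ζ + 1} :=
    measurable_card (measurableSet_Iic (a := Multiset.card ζ + 1))
  rw [e]
  refine Measure.ae_smul_measure ?_ _
  unfold rateMeasure
  rw [ae_add_measure_iff]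
  refine ⟨(ae_map_iff (measurable_add_singleton ζ).aemeasurable hm).2
    (Filter.Eventually.of_forall fun x => by simp),
    (ae_map_iff (measurable_removePoint.comp
      (measurable_const.prodMk measurable_id)).aemeasurable hm).2
    (Filter.Eventually.of_forall fun x => ?_)⟩
  classical
  exact (Multiset.card_le_card (Multiset.erase_le x ζ)).trans (Nat.le_succ _)

end PointSum

lemma ofReal_exp_mul_measure_pi {X : Type*} [MeasurableSpace X] (lam : Measure X)
    [IsFiniteMeasure lam] (n : ℕ) :
    ENNReal.ofReal (Real.exp (-lam.real univ) / n.factorial)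
      * (Measure.pi fun _ : Fin n => lam) univ = ENNReal.ofReal (pois (lam.real univ) n) := by
  rw [Measure.pi_univ, Finset.prod_const, Finset.card_univ, Fintype.card_fin,
    ← ENNReal.ofReal_toReal (measure_ne_top lam univ), ← ENNReal.ofReal_pow ENNReal.toReal_nonneg,
    ← ENNReal.ofReal_mul (by positivity), ← measureReal_def]
  congr 1
  unfold pois
  ring

/-! ### The one-dimensional laws of the process. -/

section Law

variable {X : Type*} [MetricSpace X] [MeasurableSpace X] [BorelSpace X] [SecondCountableTopology X]
  (lam : Measure X) [IsFiniteMeasure lam] [NeZero lam] {f : PointMeasure X → ℝ}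

/-- The semigroup of the immigration-death process with immigration measure `lam`. -/
def flow (f : PointMeasure X → ℝ) (t : ℝ) : PointMeasure X → ℝ :=
  semigroup (lam.real univ) (normalized lam) f t

lemma UnitLipschitz.flow (hf : UnitLipschitz f) {t : ℝ} (ht : 0 ≤ t) :
    UnitLipschitz (flow lam f t) := hf.semigroup _ _ (lam_real_pos lam).le ht

/-- Time is truncated at 0 because only for t ≥ 0 is e^{-t} a thinning probability; the truncation
gives functions that are bounded and continuous on the whole line. -/
lemma continuous_flow_max (hf : UnitLipschitz f) (ζ : PointMeasure X) :
    Continuous (fun t => flow lam f (max t 0) ζ) := by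
  refine continuous_iff_continuousAt.2 fun t => ?_
  have h1 : ContinuousAt (fun t => flow lam f t ζ) (max t 0) :=
    (hasDerivAt_semigroup _ _ (lam_real_pos lam).le hf (le_max_right t 0) ζ).continuousAt
  exact ContinuousAt.comp (f := fun t : ℝ => max t 0) h1 (by fun_prop)

lemma measurable_flow_max_sub (hf : UnitLipschitz f) (t : ℝ) :
    Measurable (fun e : ℝ × PointMeasure X => flow lam f (max (t - e.1) 0) e.2) :=
  measurable_uncurry_of_continuous_of_measurable (u := fun v ζ => flow lam f (max (t - v) 0) ζ)
    (fun ζ => (continuous_flow_max lam hf ζ).comp (continuous_const.sub continuous_id))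
    (fun v => (hf.flow lam (le_max_right (t - v) 0)).pointLipschitz.measurable)

lemma mul_integral_jumpKernel_flow (hf : UnitLipschitz f) {t : ℝ} (ht : 0 ≤ t)
    (ζ : PointMeasure X) :
    (lam.real univ + Multiset.card ζ) * ∫ η, flow lam f t η ∂(jumpKernel lam ζ)
      = generator (lam.real univ) (normalized lam) (flow lam f t) ζ
        + (lam.real univ + Multiset.card ζ) * flow lam f t ζ := by
  have hS := hf.flow lam ht
  rw [integral_jumpKernel lam hS.pointLipschitz.measurable hS.abs_le]
  unfold generator
  rw [Multiset.sum_map_sub, Multiset.map_const', Multiset.sum_replicate, nsmul_eq_mul]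
  ring

lemma continuous_integral_flow_max (hf : UnitLipschitz f) (ν : Measure (PointMeasure X))
    [IsFiniteMeasure ν] : Continuous (fun w => ∫ η, flow lam f (max w 0) η ∂ν) :=
  continuous_of_dominated (bound := fun _ => 1)
    (fun w => (hf.flow lam (le_max_right w 0)).pointLipschitz.measurable.aestronglyMeasurable)
    (fun w => Filter.Eventually.of_forall fun η => (hf.flow lam (le_max_right w 0)).abs_le η)
    (integrable_const 1) (Filter.Eventually.of_forall fun η => continuous_flow_max lam hf η)

/-- By the backward equation the integrand is the derivative in v of -e^{-qv} `flow lam f (u - v)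
ζ`. -/
lemma integral_jumpKernel_flow_interval (hf : UnitLipschitz f) {u : ℝ} (hu : 0 ≤ u)
    (ζ : PointMeasure X) {q : ℝ} (hq : q = lam.real univ + Multiset.card ζ) :
    ∫ v in Ioc 0 u, q * Real.exp (-(q * v)) * ∫ η, flow lam f (max (u - v) 0) η ∂(jumpKernel lam ζ)
      = flow lam f u ζ - Real.exp (-(q * u)) * f ζ := by
  have hJ := continuous_integral_flow_max lam hf (jumpKernel lam ζ)
  have hd : ∀ v ∈ uIcc 0 u, HasDerivAt (fun v => -(Real.exp (-(q * v)) * flow lam f (u - v) ζ))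
      (q * Real.exp (-(q * v)) * ∫ η, flow lam f (max (u - v) 0) η ∂(jumpKernel lam ζ)) v := by
    intro v hv
    rw [uIcc_of_le hu] at hv
    have h0 : 0 ≤ u - v := sub_nonneg.2 hv.2
    have h1 : HasDerivAt (fun v => Real.exp (-(q * v))) (Real.exp (-(q * v)) * (-(q * 1))) v :=
      (((hasDerivAt_id v).const_mul q).neg).exp
    have h2 : HasDerivAt (fun v => flow lam f (u - v) ζ)
        (generator (lam.real univ) (normalized lam) (flow lam f (u - v)) ζ * (-1)) v :=
      HasDerivAt.comp v (hasDerivAt_semigroup _ _ (lam_real_pos lam).le hf h0 ζ)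
        ((hasDerivAt_id v).const_sub u)
    refine (h1.mul h2).neg.congr_deriv ?_
    have h3 := mul_integral_jumpKernel_flow lam hf h0 ζ
    rw [← hq] at h3
    rw [max_eq_left h0]
    linear_combination (-Real.exp (-(q * v))) * h3
  have hi : IntervalIntegrable (fun v => q * Real.exp (-(q * v)) *
      ∫ η, flow lam f (max (u - v) 0) η ∂(jumpKernel lam ζ)) volume 0 u :=
    Continuous.intervalIntegrable
      ((by fun_prop : Continuous fun v : ℝ => q * Real.exp (-(q * v))).mul
        (hJ.comp (continuous_const.sub continuous_id))) _ _
  rw [← intervalIntegral.integral_of_le hu, intervalIntegral.integral_eq_sub_of_hasDerivAt hd hi]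
  have h0 : flow lam f 0 ζ = f ζ := by unfold flow; rw [semigroup_zero]
  simp only [sub_self, mul_zero, neg_zero, Real.exp_zero, sub_zero, h0]
  ring

/-- Integrate over the exponential holding time. Times up to t - s are covered by the preceding
lemma; later ones contribute e^{-q(t - s)} f(ζ), which cancels its boundary term. -/
lemma flow_renewal (hf : UnitLipschitz f) {t s : ℝ} (hst : s ≤ t) (ζ : PointMeasure X) :
    flow lam f (t - s) ζ
      = ∫ e', (if t < e'.1 then f ζ else flow lam f (max (t - e'.1) 0) e'.2)
          ∂(stepKernel lam (s, ζ)) := by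
  have hfm := hf.pointLipschitz.measurable
  have hg : Measurable (fun e' : ℝ × PointMeasure X =>
      if t < e'.1 then f ζ else flow lam f (max (t - e'.1) 0) e'.2) :=
    Measurable.ite (measurableSet_lt measurable_const measurable_fst) measurable_const
      (measurable_flow_max_sub lam hf t)
  rw [integral_stepKernel lam hg (C := 1) fun e' => by
    split_ifs
    · exact hf.abs_le _
    · exact (hf.flow lam (le_max_right _ _)).abs_le _]
  simp only
  set q := lam.real univ + Multiset.card ζ with hqd
  have hq : 0 < q := by have := lam_real_pos lam; positivity
  set u := t - s
  have hu : 0 ≤ u := sub_nonneg.2 hst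
  rw [integral_expMeasure hq, ← Ioc_union_Ioi_eq_Ioi hu]
  have e1 : ∀ v ∈ Ioc 0 u, q * Real.exp (-(q * v)) * (∫ η, (if t < s + v then f ζ
      else flow lam f (max (t - (s + v)) 0) η) ∂(jumpKernel lam ζ))
      = q * Real.exp (-(q * v)) * ∫ η, flow lam f (max (u - v) 0) η ∂(jumpKernel lam ζ) := by
    intro v hv
    have h1 : ¬ t < s + v := by have := hv.2; simp only [u] at this; linarith
    have h2 : t - (s + v) = u - v := by simp only [u]; ring
    simp only [h1, if_false, h2]
  have e2 : ∀ v ∈ Ioi u, q * Real.exp (-(q * v)) * (∫ η, (if t < s + v then f ζ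
      else flow lam f (max (t - (s + v)) 0) η) ∂(jumpKernel lam ζ))
      = q * f ζ * Real.exp (-q * v) := by
    intro v hv
    have h1 : t < s + v := by have := mem_Ioi.1 hv; simp only [u] at this; linarith
    simp only [h1, if_true, integral_const, probReal_univ, one_smul]
    rw [neg_mul]; ring
  have i2 : IntegrableOn (fun v => q * f ζ * Real.exp (-q * v)) (Ioi u) :=
    (integrableOn_exp_mul_Ioi (neg_lt_zero.2 hq) u).const_mul _
  have hJ := continuous_integral_flow_max lam hf (jumpKernel lam ζ)
  have i1 : IntegrableOn (fun v => q * Real.exp (-(q * v)) *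
      ∫ η, flow lam f (max (u - v) 0) η ∂(jumpKernel lam ζ)) (Ioc 0 u) :=
    (Continuous.integrableOn_Icc ((by fun_prop : Continuous fun v : ℝ => q * Real.exp (-(q * v))).mul
        (hJ.comp (continuous_const.sub continuous_id)))).mono_set Ioc_subset_Icc_self
  rw [setIntegral_union (Ioc_disjoint_Ioi le_rfl) measurableSet_Ioi
      ((integrableOn_congr_fun e1 measurableSet_Ioc).2 i1)
      ((integrableOn_congr_fun e2 measurableSet_Ioi).2 i2),
    setIntegral_congr_fun measurableSet_Ioc e1, setIntegral_congr_fun measurableSet_Ioi e2,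
    integral_jumpKernel_flow_interval lam hf hu ζ hqd, integral_const_mul,
    integral_exp_mul_Ioi (neg_lt_zero.2 hq), neg_mul]
  have hq0 := hq.ne'
  clear_value q u
  field_simp
  ring

/-- The difference of the two solutions solves the homogeneous renewal equation, which is iterated n
times. With q the total jump rate, the weight e^{t - s} gains 𝔼 e^{-T} = q/(q + 1) per step while q
grows by at most 1. The product of these factors telescopes to q/(q + n), which tends to 0. -/
lemma abs_integral_sub_flow_le (hf : UnitLipschitz f) {t : ℝ} (n : ℕ)
    (e : ℝ × PointMeasure X) (he : e.1 ≤ t) :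
    |(∫ ω, f (stateAt t ω) ∂(chainKernel (stepKernel lam) e)) - flow lam f (max (t - e.1) 0) e.2|
      ≤ 2 * Real.exp (t - e.1) * ((lam.real univ + Multiset.card e.2)
          / (lam.real univ + Multiset.card e.2 + n)) := by
  have hl := lam_real_pos lam
  have hfm := hf.pointLipschitz.measurable
  set V : ℝ × PointMeasure X → ℝ :=
    fun e => ∫ ω, f (stateAt t ω) ∂(chainKernel (stepKernel lam) e) with hV
  have hVm : Measurable V := measurable_integral_stateAt lam hfm t
  have hVb : ∀ e, |V e| ≤ 1 := fun e => by
    rw [← Real.norm_eq_abs]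
    refine (norm_integral_le_of_norm_le_const (C := 1)
      (Filter.Eventually.of_forall fun ω => hf.abs_le _)).trans_eq ?_
    rw [probReal_univ, mul_one]
  have hSm : Measurable (fun e' : ℝ × PointMeasure X => flow lam f (max (t - e'.1) 0) e'.2) :=
    measurable_flow_max_sub lam hf t
  have hSb : ∀ e' : ℝ × PointMeasure X, |flow lam f (max (t - e'.1) 0) e'.2| ≤ 1 := fun e' =>
    (hf.flow lam (le_max_right _ _)).abs_le _
  have hDm : Measurable (fun e' : ℝ × PointMeasure X =>
      V e' - flow lam f (max (t - e'.1) 0) e'.2) := hVm.sub hSm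
  have hlt : MeasurableSet {e' : ℝ × PointMeasure X | t < e'.1} :=
    measurableSet_lt measurable_const measurable_fst
  change |V e - _| ≤ _
  induction n generalizing e with
  | zero =>
    have h1 : lam.real univ + (Multiset.card e.2 : ℝ) + (0 : ℕ) ≠ 0 := by positivity
    have h2 : 1 ≤ Real.exp (t - e.1) := Real.one_le_exp (sub_nonneg.2 he)
    have h3 := (abs_sub _ _).trans (add_le_add (hVb e) (hSb e))
    rw [Nat.cast_zero, add_zero] at h1 ⊢
    rw [div_self h1, mul_one]
    linarith
  | succ n ih =>
    obtain ⟨s, ζ⟩ := e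
    simp only at he ⊢
    set q := lam.real univ + (Multiset.card ζ : ℝ) with hq_def
    have hq : 0 < q := by positivity
    have h1 : V (s, ζ) - flow lam f (max (t - s) 0) ζ
        = ∫ e', (if t < e'.1 then 0 else V e' - flow lam f (max (t - e'.1) 0) e'.2)
            ∂(stepKernel lam (s, ζ)) := by
      rw [max_eq_left (sub_nonneg.2 he), flow_renewal lam hf he]
      simp only [hV]
      rw [integral_chainKernel_stateAt lam hfm hf.abs_le he, ← integral_sub]
      · refine integral_congr_ae (Filter.Eventually.of_forall fun e' => ?_)
        simp only
        split_ifs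
        · simp
        · rfl
      · refine Integrable.of_bound (Measurable.ite hlt measurable_const hVm).aestronglyMeasurable 1
          (Filter.Eventually.of_forall fun e' => ?_)
        rw [Real.norm_eq_abs]; split_ifs
        · exact hf.abs_le _
        · exact hVb _
      · refine Integrable.of_bound (Measurable.ite hlt measurable_const hSm).aestronglyMeasurable 1
          (Filter.Eventually.of_forall fun e' => ?_)
        rw [Real.norm_eq_abs]; split_ifs
        · exact hf.abs_le _
        · exact hSb _
    rw [h1, integral_stepKernel lam (Measurable.ite hlt measurable_const hDm) (C := 2)
      (fun e' => by
        split_ifs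
        · simp
        · have := (abs_sub _ _).trans (add_le_add (hVb e') (hSb e')); linarith),
      integral_expMeasure hq]
    set c : ℝ := 2 * Real.exp (t - s) * ((q + 1) / (q + 1 + n)) with hc
    have hinner : ∀ v ∈ Ioi (0 : ℝ), ‖q * Real.exp (-(q * v)) * ∫ η, (if t < s + v then 0 else
        V (s + v, η) - flow lam f (max (t - (s + v)) 0) η) ∂(jumpKernel lam ζ)‖
        ≤ q * c * Real.exp (-(q + 1) * v) := by
      intro v hv
      have hbound : ‖∫ η, (if t < s + v then 0 else
          V (s + v, η) - flow lam f (max (t - (s + v)) 0) η) ∂(jumpKernel lam ζ)‖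
          ≤ c * Real.exp (-v) := by
        have h2 := norm_integral_le_of_norm_le_const (μ := jumpKernel lam ζ)
          (f := fun η => if t < s + v then 0 else
            V (s + v, η) - flow lam f (max (t - (s + v)) 0) η) (C := c * Real.exp (-v)) (by
          filter_upwards [ae_jumpKernel_card_le lam ζ] with η hη
          split_ifs with h
          · rw [norm_zero]; positivity
          · refine (ih (s + v, η) (not_lt.1 h)).trans ?_
            simp only
            have hk : (Multiset.card η : ℝ) ≤ Multiset.card ζ + 1 := by exact_mod_cast hη
            have e3 : Real.exp (t - (s + v)) = Real.exp (t - s) * Real.exp (-v) := by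
              rw [← Real.exp_add]; ring_nf
            -- A jump adds at most one point, and y/(y + n) increases with y.
            have e4 : (lam.real univ + (Multiset.card η : ℝ))
                / (lam.real univ + (Multiset.card η : ℝ) + n) ≤ (q + 1) / (q + 1 + n) := by
              rw [div_le_div_iff₀ (by positivity) (by positivity)]
              have : lam.real univ + (Multiset.card η : ℝ) ≤ q + 1 := by rw [hq_def]; linarith
              have hn : (0 : ℝ) ≤ n := Nat.cast_nonneg n
              nlinarith
            rw [e3, hc]
            have := mul_le_mul_of_nonneg_left e4
              (by positivity : 0 ≤ 2 * (Real.exp (t - s) * Real.exp (-v)))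
            linarith)
        rwa [probReal_univ, mul_one] at h2
      rw [norm_mul, Real.norm_of_nonneg (by positivity : 0 ≤ q * Real.exp (-(q * v)))]
      refine (mul_le_mul_of_nonneg_left hbound (by positivity)).trans_eq ?_
      have e3 : Real.exp (-(q + 1) * v) = Real.exp (-(q * v)) * Real.exp (-v) := by
        rw [← Real.exp_add]; ring_nf
      rw [e3]; ring
    have hneg : -(q + 1) < 0 := by linarith
    have h2 := norm_integral_le_of_norm_le (μ := volume.restrict (Ioi (0 : ℝ)))
      ((integrableOn_exp_mul_Ioi hneg 0).const_mul (q * c))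
      ((ae_restrict_iff' measurableSet_Ioi).2 (Filter.Eventually.of_forall hinner))
    rw [Real.norm_eq_abs] at h2
    refine h2.trans_eq ?_
    rw [integral_const_mul, integral_exp_mul_Ioi hneg, mul_zero, Real.exp_zero, hc]
    push_cast
    have : q + 1 + n ≠ 0 := by positivity
    have : q + (n + 1) ≠ 0 := by positivity
    have : q + 1 ≠ 0 := by positivity
    field_simp
    ring

/-- The expectation of `f` at time `t`. -/
lemma integral_stateAt_eq_flow (hf : UnitLipschitz f) {t : ℝ} (ht : 0 ≤ t) (ξ : PointMeasure X) :
    ∫ ω, f (stateAt t ω) ∂(pathLaw lam ξ) = flow lam f t ξ := by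
  have hl := lam_real_pos lam
  rw [pathLaw_eq]
  have h := fun n => abs_integral_sub_flow_le lam hf n (0, ξ) ht
  simp only [sub_zero, max_eq_left ht] at h
  have hlim : Filter.Tendsto (fun n : ℕ => 2 * Real.exp t * ((lam.real univ + Multiset.card ξ)
      / (lam.real univ + Multiset.card ξ + n))) Filter.atTop (nhds (2 * Real.exp t * 0)) := by
    refine Filter.Tendsto.const_mul _ (Filter.Tendsto.const_div_atTop ?_ _)
    exact Filter.tendsto_atTop_add_const_left _ _ tendsto_natCast_atTop_atTop
  have h2 := ge_of_tendsto' hlim h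
  rw [mul_zero] at h2
  exact sub_eq_zero.1 (abs_eq_zero.1 (le_antisymm h2 (abs_nonneg _)))

lemma integrable_comp_stateAt (hf : UnitLipschitz f) (t : ℝ) (ξ : PointMeasure X) :
    Integrable (fun ω => f (stateAt t ω)) (pathLaw lam ξ) := by
  rw [pathLaw_eq]
  exact Integrable.of_bound
    (hf.pointLipschitz.measurable.comp (measurable_stateAt t)).aestronglyMeasurable 1
    (Filter.Eventually.of_forall fun ω => hf.abs_le _)

/-! ### The Poisson process -/

/-- Splitting off one coordinate of the product measure is one application of `addRandom`, up to the
total mass. Thus the n-th iterate averages over n independent points. -/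
lemma integral_pi_map (hf : UnitLipschitz f) (n : ℕ) (ζ : PointMeasure X) :
    ∫ x, f (ζ + Multiset.map x Finset.univ.val) ∂(Measure.pi fun _ : Fin n => lam)
      = lam.real univ ^ n * (addRandom (normalized lam))^[n] f ζ := by
  induction n generalizing ζ with
  | zero => simp [measureReal_def]
  | succ n ih =>
    have hmp := (measurePreserving_piFinSuccAbove (fun _ : Fin (n + 1) => lam) 0).symm
    have hadd : ∀ (y : X) (x : Fin n → X),
        ζ + Multiset.map (Fin.insertNth (α := fun _ => X) 0 y x) Finset.univ.val
          = (ζ + {y}) + Multiset.map x Finset.univ.val := by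
      intro y x
      rw [Fin.univ_succ]
      simp only [Finset.cons_val, Multiset.map_cons, Finset.map_val, Multiset.map_map]
      rw [← Multiset.singleton_add, ← add_assoc]
      congr 1
    have hm : Measurable fun z : X × (Fin n → X) =>
        f ((ζ + {z.1}) + Multiset.map z.2 Finset.univ.val) := by
      refine hf.pointLipschitz.measurable.comp (measurable_pointMeasure fun A hA => ?_)
      simp only [toMeasure_add, toMeasure_singleton, Measure.add_apply]
      exact (measurable_const.add
        ((Measure.measurable_coe hA).comp (Measure.measurable_dirac.comp measurable_fst))).add
        ((measurable_toMeasure_apply hA).comp ((measurable_map_univ n).comp measurable_snd))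
    rw [← hmp.integral_comp (MeasurableEquiv.measurableEmbedding _)]
    have e : ∀ z : X × (Fin n → X),
        f (ζ + Multiset.map ((MeasurableEquiv.piFinSuccAbove (fun _ => X) 0).symm z)
          Finset.univ.val) = f ((ζ + {z.1}) + Multiset.map z.2 Finset.univ.val) :=
      fun z => congrArg f (hadd z.1 z.2)
    simp only [e]
    rw [integral_prod]
    · simp only [ih]
      rw [integral_const_mul, integral_eq_mul_normalized, Function.iterate_succ_apply', pow_succ,
        mul_assoc]
      rfl
    · exact Integrable.of_bound hm.aestronglyMeasurable 1
        (Filter.Eventually.of_forall fun z => hf.abs_le _)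

instance isProbabilityMeasure_poissonProcess : IsProbabilityMeasure (poissonProcess lam) := by
  refine ⟨?_⟩
  unfold poissonProcess
  rw [Measure.sum_apply _ MeasurableSet.univ]
  have h : ∀ n : ℕ, (ENNReal.ofReal (Real.exp (-lam.real univ) / n.factorial) •
      (Measure.pi fun _ : Fin n => lam).map
        (fun x => (Multiset.map x Finset.univ.val : PointMeasure X))) univ
      = ENNReal.ofReal (pois (lam.real univ) n) := fun n => by
    rw [Measure.smul_apply, Measure.map_apply (measurable_map_univ n) MeasurableSet.univ,
      preimage_univ, smul_eq_mul, ofReal_exp_mul_measure_pi]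
  simp only [h]
  rw [← ENNReal.ofReal_tsum_of_nonneg (pois_nonneg (lam_real_pos lam).le) (hasSum_pois _).summable,
    (hasSum_pois _).tsum_eq, ENNReal.ofReal_one]

lemma UnitLipschitz.integrable_poissonProcess (hf : UnitLipschitz f) :
    Integrable f (poissonProcess lam) :=
  Integrable.of_bound hf.pointLipschitz.measurable.aestronglyMeasurable 1
    (Filter.Eventually.of_forall hf.abs_le)

lemma integral_poissonProcess (hf : UnitLipschitz f) :
    ∫ η, f η ∂(poissonProcess lam) = addPoisson (normalized lam) (lam.real univ) f 0 := by
  have hi := hf.integrable_poissonProcess lam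
  unfold poissonProcess at hi ⊢
  rw [integral_sum_measure hi]
  unfold addPoisson poisE
  refine tsum_congr fun n => ?_
  have h := integral_pi_map lam hf n 0
  simp only [zero_add] at h
  rw [integral_smul_measure, integral_map (measurable_map_univ n).aemeasurable
    hf.pointLipschitz.measurable.aestronglyMeasurable, h, ENNReal.toReal_ofReal (by positivity),
    smul_eq_mul]
  unfold pois
  ring

end Law

/-! ### Differences of Poisson expectations -/

section PoissonDifferences

/-- Bernoulli's inequality for (s/x)^θ. It interpolates between θ = 0 and θ = 1, so that only
integer inverse moments have to be estimated. -/
lemma rpow_neg_le_chord {θ : ℝ} (hθ : θ ∈ Icc (0 : ℝ) 1) {x s : ℝ} (hx : 0 < x) (hs : 0 < s) :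
    x ^ (-θ) ≤ s ^ (-θ) * (θ * (s * x⁻¹) + (1 - θ)) := by
  have h := rpow_one_add_le_one_add_mul_self (s := s * x⁻¹ - 1) (p := θ)
    (by linarith [mul_pos hs (inv_pos.2 hx)]) hθ.1 hθ.2
  rw [add_sub_cancel, Real.mul_rpow hs.le (inv_nonneg.2 hx.le), Real.inv_rpow hx.le,
    ← Real.rpow_neg hx.le] at h
  have h2 : s ^ (-θ) * s ^ θ = 1 := by
    rw [← Real.rpow_add hs, neg_add_cancel, Real.rpow_zero]
  calc x ^ (-θ) = s ^ (-θ) * (s ^ θ * x ^ (-θ)) := by rw [← mul_assoc, h2, one_mul]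
    _ ≤ s ^ (-θ) * (1 + θ * (s * x⁻¹ - 1)) :=
        mul_le_mul_of_nonneg_left h (Real.rpow_nonneg hs.le _)
    _ = _ := by ring

lemma rpow_neg_nonneg_le_one {θ : ℝ} (hθ : 0 ≤ θ) {x : ℝ} (hx : 1 ≤ x) : |x ^ (-θ)| ≤ 1 := by
  rw [abs_of_nonneg (Real.rpow_nonneg (by linarith) _)]
  exact Real.rpow_le_one_of_one_le_of_nonpos hx (neg_nonpos.2 hθ)

lemma one_le_cast_add_one (n : ℕ) : (1 : ℝ) ≤ n + 1 := by
  linarith [(Nat.cast_nonneg n : (0 : ℝ) ≤ n)]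

lemma one_le_cast_add_two (n : ℕ) : (1 : ℝ) ≤ n + 2 := by
  linarith [(Nat.cast_nonneg n : (0 : ℝ) ≤ n)]

lemma poisE_rpow_le {θ : ℝ} (hθ : θ ∈ Icc (0 : ℝ) 1) {s : ℝ} (hs : 0 < s) {x : ℕ → ℝ}
    (hx : ∀ n, 1 ≤ x n) :
    poisE s (fun n => x n ^ (-θ))
      ≤ s ^ (-θ) * (θ * (s * poisE s fun n => (x n)⁻¹) + (1 - θ)) := by
  have hinv : ∀ n, |(x n)⁻¹| ≤ 1 := fun n => by
    rw [abs_of_nonneg (by linarith [inv_pos.2 (lt_of_lt_of_le one_pos (hx n))])]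
    exact inv_le_one_of_one_le₀ (hx n)
  have h := poisE_mono hs.le (v := fun n => x n ^ (-θ)) (C := 1)
    (w := fun n => s ^ (-θ) * θ * s * (x n)⁻¹ + s ^ (-θ) * (1 - θ))
    (D := |s ^ (-θ) * θ * s| * 1 + |s ^ (-θ) * (1 - θ)|)
    (fun n => rpow_neg_nonneg_le_one hθ.1 (hx n))
    (fun n => (abs_add_le _ _).trans (by rw [abs_mul]; gcongr; exact hinv n))
    (fun n => (rpow_neg_le_chord hθ (by linarith [hx n]) hs).trans_eq (by ring))
  rw [poisE_add s (C := |s ^ (-θ) * θ * s| * 1) (D := |s ^ (-θ) * (1 - θ)|)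
    (fun n => by rw [abs_mul]; gcongr; exact hinv n) (fun n => le_rfl), poisE_const_mul,
    poisE_const] at h
  refine h.trans_eq (by ring)

lemma poisE_rpow_add_one_le {θ : ℝ} (hθ : θ ∈ Icc (0 : ℝ) 1) {s : ℝ} (hs : 0 < s) :
    poisE s (fun n => ((n : ℝ) + 1) ^ (-θ)) ≤ s ^ (-θ) := by
  refine (poisE_rpow_le hθ hs one_le_cast_add_one).trans ?_
  have h := mul_le_mul_of_nonneg_left (poisE_inv_succ_le hs) hs.le
  rw [mul_inv_cancel₀ hs.ne'] at h
  have h2 := Real.rpow_pos_of_pos hs (-θ)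
  have h3 := mul_le_mul_of_nonneg_left h hθ.1
  nlinarith

lemma poisE_rpow_add_two_le {θ : ℝ} (hθ : θ ∈ Icc (0 : ℝ) 1) {s : ℝ} (hs : 0 < s) :
    poisE s (fun n => ((n : ℝ) + 2) ^ (-θ)) ≤ s ^ (-θ) * (1 - θ * (s + 1)⁻¹) := by
  refine (poisE_rpow_le hθ hs one_le_cast_add_two).trans ?_
  refine mul_le_mul_of_nonneg_left ?_ (Real.rpow_nonneg hs.le _)
  have h := mul_le_mul_of_nonneg_left (poisE_inv_add_two_le hs) hs.le
  have h2 : s * (s + 1)⁻¹ = 1 - (s + 1)⁻¹ := by field_simp; ring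
  rw [h2] at h
  have h3 := mul_le_mul_of_nonneg_left h hθ.1
  linarith

/-- Summation by parts: the forward difference moves onto the weights and becomes the factor N/s -
1. -/
lemma hasSum_pois_centered {s : ℝ} (hs : 0 < s) {u : ℕ → ℝ} {C : ℝ} (hu : ∀ n, |u n| ≤ C) :
    HasSum (fun n => pois s n * ((n / s - 1) * u n)) (poisE s fun n => u (n + 1) - u n) := by
  have h1 := (hasSum_pois_shift (summable_pois_mul s fun n => hu (n + 1)).hasSum).mul_left s⁻¹
  have h2 := h1.sub (summable_pois_mul s hu).hasSum
  rw [poisE_sub s (fun n => hu (n + 1)) hu]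
  have e : s⁻¹ * (s * ∑' n, pois s n * u (n + 1)) = poisE s fun n => u (n + 1) :=
    inv_mul_cancel_left₀ hs.ne' _
  rw [e] at h2
  exact h2.congr_fun fun n => by field_simp

/-- Two summations by parts; the resulting factor is the second Charlier polynomial. -/
lemma hasSum_pois_second {s : ℝ} (hs : 0 < s) {g : ℕ → ℝ} {C : ℝ} (hg : ∀ n, |g n| ≤ C) :
    HasSum (fun n => pois s n * (((n : ℝ) * (n - 1) / s ^ 2 - 2 * n / s + 1) * g n))
      (poisE s fun n => g (n + 2) - 2 * g (n + 1) + g n) := by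
  have h1 := hasSum_pois_shift (w := fun n => g (n + 1))
    (summable_pois_mul s fun n => hg (n + 1 + 1)).hasSum
  have h2 := hasSum_pois_shift (s := s) (w := fun n => ((n : ℝ) - 1) * g n)
    (h1.congr_fun fun n => by push_cast; ring)
  have h3 := hasSum_pois_shift (summable_pois_mul s fun n => hg (n + 1)).hasSum
  have h4 := ((h2.mul_left (s ^ 2)⁻¹).sub (h3.mul_left (2 * s⁻¹))).add
    (summable_pois_mul s hg).hasSum
  have hC : 0 ≤ C := (abs_nonneg _).trans (hg 0)
  have hb2 : ∀ n, |2 * g (n + 1)| ≤ 2 * C := fun n => by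
    rw [abs_mul, abs_two]; linarith [hg (n + 1)]
  rw [poisE_add s (C := C + 2 * C) (fun n => (abs_sub _ _).trans (add_le_add (hg _) (hb2 n))) hg,
    poisE_sub s (fun n => hg (n + 2)) hb2, poisE_const_mul]
  have e1 : 2 * s⁻¹ * (s * ∑' n, pois s n * g (n + 1)) = 2 * poisE s fun n => g (n + 1) := by
    unfold poisE; field_simp
  have e2 : (s ^ 2)⁻¹ * (s * (s * ∑' n, pois s n * g (n + 1 + 1))) = poisE s fun n => g (n + 2) := by
    unfold poisE; field_simp
  rw [e1, e2] at h4
  exact h4.congr_fun fun n => by field_simp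

lemma hasSum_pois_variance {s : ℝ} (hs : 0 < s) :
    HasSum (fun n => pois s n * ((n : ℝ) / s - 1) ^ 2) s⁻¹ := by
  have h := (((hasSum_pois_sq s).mul_left (s ^ 2)⁻¹).sub
    ((hasSum_pois_id s).mul_left (2 * s⁻¹))).add (hasSum_pois s)
  have e : (s ^ 2)⁻¹ * (s ^ 2 + s) - 2 * s⁻¹ * s + 1 = s⁻¹ := by field_simp; ring
  rw [e] at h
  exact h.congr_fun fun n => by field_simp; ring

lemma hasSum_pois_second_sq {s : ℝ} (hs : 0 < s) :
    HasSum (fun n => pois s n * ((n : ℝ) * (n - 1) / s ^ 2 - 2 * n / s + 1) ^ 2) (2 / s ^ 2) := by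
  have h := (((((hasSum_pois_fourth s).mul_left (s ^ 4)⁻¹).add
    ((hasSum_pois_cube s).mul_left (-2 * (s ^ 4)⁻¹ - 4 * (s ^ 3)⁻¹))).add
    ((hasSum_pois_sq s).mul_left ((s ^ 4)⁻¹ + 4 * (s ^ 3)⁻¹ + 6 * (s ^ 2)⁻¹))).add
    ((hasSum_pois_id s).mul_left (-2 * (s ^ 2)⁻¹ - 4 * s⁻¹))).add (hasSum_pois s)
  have e : (s ^ 4)⁻¹ * (s ^ 4 + 6 * s ^ 3 + 7 * s ^ 2 + s)
      + (-2 * (s ^ 4)⁻¹ - 4 * (s ^ 3)⁻¹) * (s ^ 3 + 3 * s ^ 2 + s)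
      + ((s ^ 4)⁻¹ + 4 * (s ^ 3)⁻¹ + 6 * (s ^ 2)⁻¹) * (s ^ 2 + s)
      + (-2 * (s ^ 2)⁻¹ - 4 * s⁻¹) * s + 1 = 2 / s ^ 2 := by field_simp; ring
  rw [e] at h
  exact h.congr_fun fun n => by field_simp; ring

/-- Second differences ignore constants, so g may be replaced by g - 1/2, of absolute value at most
1/2. Cauchy–Schwarz against the quadratic factor, of second moment 2/s², then gives √2/(2s). -/
lemma abs_poisE_second_diff_le {s : ℝ} (hs : 0 < s) {g : ℕ → ℝ} (hg : ∀ n, g n ∈ Icc (0 : ℝ) 1) :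
    |poisE s fun n => g (n + 2) - 2 * g (n + 1) + g n| ≤ (Real.sqrt 2 * s)⁻¹ := by
  have hb : ∀ n, |g n - 1 / 2| ≤ 1 / 2 := fun n => by
    rw [abs_le]; constructor <;> linarith [(hg n).1, (hg n).2]
  have h := hasSum_pois_second hs hb
  have e : (fun n => g (n + 2) - 1 / 2 - 2 * (g (n + 1) - 1 / 2) + (g n - 1 / 2))
      = fun n => g (n + 2) - 2 * g (n + 1) + g n := by funext n; ring
  rw [e] at h
  have h2 : (0 : ℝ) < Real.sqrt 2 := by positivity
  have h22 : Real.sqrt 2 ^ 2 = 2 := Real.sq_sqrt (by norm_num)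
  -- Cauchy–Schwarz in the form of a weighted arithmetic-geometric mean; the weights make the two
  -- expectations equal.
  have hB := ((hasSum_pois_second_sq hs).mul_left (s / Real.sqrt 2 / 4)).add
    ((hasSum_pois s).mul_left (Real.sqrt 2 / s / 4))
  have h3 := h.norm_le_of_bounded hB fun n => by
    rw [norm_mul, norm_mul, Real.norm_of_nonneg (pois_nonneg hs.le n), Real.norm_eq_abs,
      Real.norm_eq_abs]
    set y := (n : ℝ) * (n - 1) / s ^ 2 - 2 * n / s + 1
    have h4 : |y| * |g n - 1 / 2| ≤ s / Real.sqrt 2 / 4 * y ^ 2 + Real.sqrt 2 / s / 4 := by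
      have h5 : |y| * |g n - 1 / 2| ≤ |y| * (1 / 2) :=
        mul_le_mul_of_nonneg_left (hb n) (abs_nonneg _)
      have h6 : s / Real.sqrt 2 / 4 * y ^ 2 + Real.sqrt 2 / s / 4 - |y| * (1 / 2)
          = (s / Real.sqrt 2 / 4) * (|y| - Real.sqrt 2 / s) ^ 2 := by
        rw [← sq_abs y]
        field_simp
        ring_nf
      have : 0 ≤ (s / Real.sqrt 2 / 4) * (|y| - Real.sqrt 2 / s) ^ 2 := by positivity
      linarith
    have := mul_le_mul_of_nonneg_left h4 (pois_nonneg hs.le n)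
    linarith
  rw [Real.norm_eq_abs] at h3
  refine h3.trans_eq ?_
  field_simp
  rw [h22]
  norm_num

/-- Write |y| = (2 · 1_{y ≥ 0} - 1) y with y = N/s - 1. By summation by parts the mean is twice the
expected forward difference of an indicator, which the largest weight bounds. -/
lemma hasSum_pois_abs_centered {s : ℝ} (hs : 0 < s) :
    ∃ a ≤ 2 * (Real.sqrt (2 * Real.exp 1 * s))⁻¹,
      HasSum (fun n => pois s n * |(n : ℝ) / s - 1|) a := by
  let g : ℕ → ℝ := fun n => if 1 ≤ (n : ℝ) / s then 1 else 0
  have hg : ∀ n, g n ∈ Icc (0 : ℝ) 1 := fun n => by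
    simp only [g]; split_ifs <;> simp
  have hgb : ∀ n, |g n| ≤ 1 := fun n => by
    rw [abs_of_nonneg (hg n).1]; exact (hg n).2
  have h1 := hasSum_pois_centered hs hgb
  have h2 := hasSum_pois_centered hs (u := fun _ => 1) (C := 1) (by simp)
  simp only [sub_self, poisE_const] at h2
  refine ⟨2 * poisE s (fun n => g (n + 1) - g n) - 0, ?_, ?_⟩
  · linarith [poisE_forward_diff_le hs hg]
  · refine ((h1.mul_left 2).sub h2).congr_fun fun n => ?_
    simp only [g]
    split_ifs with h
    · rw [abs_of_nonneg (by linarith)]; ring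
    · rw [abs_of_nonpos (by linarith [not_le.1 h])]; ring

/-- After summation by parts, the chord inequality for (N + 1)^{-θ} leaves 𝔼|N/s - 1| and s 𝔼[|N/s -
1|/(N + 1)]. The latter is at most s (s^{-1} · 2s^{-2})^{1/2} by Cauchy–Schwarz. -/
lemma abs_poisE_diff_le {θ : ℝ} (hθ : θ ∈ Icc (0 : ℝ) 1) {s : ℝ} (hs : 0 < s) {u : ℕ → ℝ}
    (hu : ∀ n, |u n| ≤ ((n : ℝ) + 1) ^ (-θ)) :
    |poisE s fun n => u (n + 1) - u n| ≤ s ^ (-θ) *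
      (θ * (Real.sqrt 2 / Real.sqrt s) + (1 - θ) * (2 * (Real.sqrt (2 * Real.exp 1 * s))⁻¹)) := by
  have hub : ∀ n, |u n| ≤ 1 := fun n =>
    (hu n).trans ((le_abs_self _).trans (rpow_neg_nonneg_le_one hθ.1 (one_le_cast_add_one n)))
  obtain ⟨a, ha, hasum⟩ := hasSum_pois_abs_centered hs
  set q := poisE s (fun n => (((n : ℝ) + 1)⁻¹) ^ 2) with hq
  have hqsum : HasSum (fun n : ℕ => pois s n * (((n : ℝ) + 1)⁻¹) ^ 2) q :=
    (summable_pois_mul s (C := 1) fun n => by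
      rw [abs_pow]; exact pow_le_one₀ (abs_nonneg _) (abs_inv_succ_le n)).hasSum
  have hq2 : q ≤ 2 / s ^ 2 := poisE_inv_succ_sq_le hs
  have h2 : (0 : ℝ) < Real.sqrt 2 := by positivity
  have h22 : Real.sqrt 2 ^ 2 = 2 := Real.sq_sqrt (by norm_num)
  have hr : (0 : ℝ) < Real.sqrt s := by positivity
  have hrr : Real.sqrt s ^ 2 = s := Real.sq_sqrt hs.le
  set r := Real.sqrt s
  set k := Real.sqrt 2
  have hp : 0 < s ^ (-θ) := Real.rpow_pos_of_pos hs _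
  -- The ratio k / r balances the variance 1/s against the bound 2/s² for the inverse square moment.
  have hB := (((hasSum_pois_variance hs).mul_left (s ^ (-θ) * θ * s * (k / r) / 2)).add
    (hqsum.mul_left (s ^ (-θ) * θ * s * (r / k) / 2))).add (hasum.mul_left (s ^ (-θ) * (1 - θ)))
  have h3 := (hasSum_pois_centered hs hub).norm_le_of_bounded hB fun n => by
    rw [norm_mul, norm_mul, Real.norm_of_nonneg (pois_nonneg hs.le n), Real.norm_eq_abs,
      Real.norm_eq_abs]
    set y := (n : ℝ) / s - 1
    set z := ((n : ℝ) + 1)⁻¹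
    have h4 : |u n| ≤ s ^ (-θ) * (θ * (s * z) + (1 - θ)) :=
      (hu n).trans (rpow_neg_le_chord hθ (by positivity) hs)
    have h5 : |y| * z ≤ (k / r) / 2 * y ^ 2 + (r / k) / 2 * z ^ 2 := by
      have h6 : (k / r) / 2 * y ^ 2 + (r / k) / 2 * z ^ 2 - |y| * z
          = (r / k) / 2 * (k / r * |y| - z) ^ 2 := by
        rw [← sq_abs y]
        field_simp
        ring
      have : 0 ≤ (r / k) / 2 * (k / r * |y| - z) ^ 2 := by positivity
      linarith
    have h7 : |y| * |u n| ≤ s ^ (-θ) * θ * s * ((k / r) / 2 * y ^ 2 + (r / k) / 2 * z ^ 2)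
        + s ^ (-θ) * (1 - θ) * |y| := by
      have h8 := mul_le_mul_of_nonneg_left h4 (abs_nonneg y)
      have h9 := mul_le_mul_of_nonneg_left h5
        (mul_nonneg (mul_nonneg hp.le hθ.1) hs.le)
      linarith
    have := mul_le_mul_of_nonneg_left h7 (pois_nonneg hs.le n)
    linarith
  rw [Real.norm_eq_abs] at h3
  refine h3.trans ?_
  have h10 : s ^ (-θ) * (1 - θ) * a
      ≤ s ^ (-θ) * (1 - θ) * (2 * (Real.sqrt (2 * Real.exp 1 * s))⁻¹) :=
    mul_le_mul_of_nonneg_left ha (mul_nonneg hp.le (sub_nonneg.2 hθ.2))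
  have h11 : s ^ (-θ) * θ * s * (r / k) / 2 * q ≤ s ^ (-θ) * θ * s * (r / k) / 2 * (2 / s ^ 2) :=
    mul_le_mul_of_nonneg_left hq2 (by have := hθ.1; positivity)
  have h12 : s ^ (-θ) * θ * s * (k / r) / 2 * s⁻¹ + s ^ (-θ) * θ * s * (r / k) / 2 * (2 / s ^ 2)
      = s ^ (-θ) * (θ * (k / r)) := by
    have e1 : r / k * (2 / s ^ 2) * s = k / r := by
      rw [← hrr]; field_simp; rw [h22]
    have e2 : s * s⁻¹ = 1 := mul_inv_cancel₀ hs.ne'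
    linear_combination (s ^ (-θ) * θ / 2) * e1 + (s ^ (-θ) * θ * (k / r) / 2) * e2
  linarith

/-- The second difference of the Poisson expectations of four sequences that are close to shifts of
each other. -/
lemma abs_poisE_mixed_diff_le {θ : ℝ} (hθ : θ ∈ Icc (0 : ℝ) 1) {s : ℝ} (hs : 0 < s)
    {a b b' g : ℕ → ℝ} (hab : ∀ n, |a n - b (n + 1)| ≤ ((n : ℝ) + 2) ^ (-θ))
    (hbg : ∀ n, |b n - g (n + 1)| ≤ ((n : ℝ) + 1) ^ (-θ))
    (hbg' : ∀ n, |b' n - g (n + 1)| ≤ ((n : ℝ) + 1) ^ (-θ)) (hg : ∀ n, g n ∈ Icc (0 : ℝ) 1) :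
    |poisE s fun n => a n - b n - b' n + g n| ≤ s ^ (-θ) *
      (2 - θ * (s + 1)⁻¹ + (θ * (Real.sqrt 2 / Real.sqrt s)
        + (1 - θ) * (2 * (Real.sqrt (2 * Real.exp 1 * s))⁻¹))
        + (Real.sqrt 2)⁻¹ * (θ + (1 - θ) * s⁻¹)) := by
  have b1 : ∀ n : ℕ, |((n : ℝ) + 1) ^ (-θ)| ≤ 1 := fun n =>
    rpow_neg_nonneg_le_one hθ.1 (one_le_cast_add_one n)
  have b2 : ∀ n : ℕ, |((n : ℝ) + 2) ^ (-θ)| ≤ 1 := fun n =>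
    rpow_neg_nonneg_le_one hθ.1 (one_le_cast_add_two n)
  have hgb : ∀ n, |g n| ≤ 1 := fun n => by rw [abs_of_nonneg (hg n).1]; exact (hg n).2
  have c1 : ∀ n, |a n - b (n + 1)| ≤ 1 := fun n => (hab n).trans ((le_abs_self _).trans (b2 n))
  have c2 : ∀ n, |b n - g (n + 1)| ≤ 1 := fun n => (hbg n).trans ((le_abs_self _).trans (b1 n))
  have c3 : ∀ n, |b' n - g (n + 1)| ≤ 1 := fun n => (hbg' n).trans ((le_abs_self _).trans (b1 n))
  have c4 : ∀ n, |b (n + 1) - g (n + 1 + 1) - (b n - g (n + 1))| ≤ 1 + 1 := fun n =>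
    (abs_sub _ _).trans (add_le_add (c2 _) (c2 n))
  have c5 : ∀ n, |g (n + 2) - 2 * g (n + 1) + g n| ≤ 1 + 2 + 1 := fun n => by
    refine (abs_add_le _ _).trans (add_le_add ((abs_sub _ _).trans (add_le_add (hgb _) ?_)) (hgb n))
    rw [abs_mul, abs_two]; linarith [hgb (n + 1)]
  -- Each added point is traded for an index shift: two replacement errors, the forward difference
  -- of a third, and a pure second difference of g.
  have e : poisE s (fun n => a n - b n - b' n + g n)
      = poisE s (fun n => a n - b (n + 1)) - poisE s (fun n => b' n - g (n + 1))
        + poisE s (fun n => b (n + 1) - g (n + 1 + 1) - (b n - g (n + 1)))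
        + poisE s (fun n => g (n + 2) - 2 * g (n + 1) + g n) := by
    have c6 : ∀ n, |a n - b (n + 1) - (b' n - g (n + 1))| ≤ 1 + 1 := fun n =>
      (abs_sub _ _).trans (add_le_add (c1 n) (c3 n))
    rw [← poisE_sub s c1 c3, ← poisE_add s c6 c4, ← poisE_add s
      (fun n => (abs_add_le _ _).trans (add_le_add (c6 n) (c4 n))) c5]
    congr 1; funext n; ring
  have d1 := (abs_poisE_le_poisE hs.le b2 hab).trans (poisE_rpow_add_two_le hθ hs)
  have d2 := (abs_poisE_le_poisE hs.le b1 hbg').trans (poisE_rpow_add_one_le hθ hs)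
  have d3 := abs_poisE_diff_le hθ hs hbg
  have d4 := abs_poisE_second_diff_le hs hg
  -- Factor s^{-1} = s^{-θ} s^{-(1 - θ)} and use the chord inequality with exponent 1 - θ.
  have d5 : (Real.sqrt 2 * s)⁻¹ ≤ s ^ (-θ) * ((Real.sqrt 2)⁻¹ * (θ + (1 - θ) * s⁻¹)) := by
    have h := rpow_neg_le_chord (θ := 1 - θ) ⟨by linarith [hθ.2], by linarith [hθ.1]⟩ hs one_pos
    rw [Real.one_rpow, one_mul, one_mul, sub_sub_cancel] at h
    have h2 : s⁻¹ = s ^ (-θ) * s ^ (-(1 - θ)) := by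
      rw [← Real.rpow_add hs, ← Real.rpow_neg_one]; congr 1; ring
    rw [mul_inv, h2]
    have h3 := mul_le_mul_of_nonneg_left h
      (by positivity : 0 ≤ s ^ (-θ) * (Real.sqrt 2)⁻¹)
    rw [h2] at h3
    linarith
  rw [e]
  refine ((abs_add_le _ _).trans (add_le_add ((abs_add_le _ _).trans
    (add_le_add ((abs_sub _ _).trans (add_le_add d1 d2)) d3)) (d4.trans d5))).trans_eq ?_
  ring

end PoissonDifferences

/-! ### Numerical comparison with the factor 1 + 2^θ + (2/3)^θ. -/

section NumericalBounds

/-- The factor `1 + 2^θ + (2/3)^θ` in the bound on second differences. -/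
def secondDiffFactor (θ : ℝ) : ℝ := 1 + 2 ^ θ + (2 / 3) ^ θ

/-- A polynomial minorant for the final comparison: the quadratic Taylor minorant of exp for 2^θ,
and the square of 1 - 0.203θ ≤ e^{-0.203θ} for (2/3)^θ, as log(3/2) ≤ 0.406. -/
lemma secondDiffFactor_ge {θ : ℝ} (hθ : 0 ≤ θ) (hθ1 : θ ≤ 1) :
    3 + 0.2871 * θ + 0.2812 * θ ^ 2 ≤ secondDiffFactor θ := by
  have h1 : 1 + 0.6931 * θ + 0.240 * θ ^ 2 ≤ (2 : ℝ) ^ θ := by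
    rw [Real.rpow_def_of_pos two_pos]
    have hl := Real.log_two_gt_d9
    have h := Real.quadratic_le_exp_of_nonneg (x := Real.log 2 * θ) (by positivity)
    have h2 : 0.6931 * θ ≤ Real.log 2 * θ := mul_le_mul_of_nonneg_right (by linarith) hθ
    have h3 : (0.6931 * θ) ^ 2 ≤ (Real.log 2 * θ) ^ 2 := pow_le_pow_left₀ (by positivity) h2 2
    nlinarith [sq_nonneg θ]
  have hlog : Real.log (2 / 3) ≥ -0.406 := by
    have h : (3 / 2 : ℝ) ≤ Real.exp 0.406 := by
      refine le_trans ?_ (Real.sum_le_exp_of_nonneg (by norm_num) 5)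
      norm_num [Finset.sum_range_succ, Nat.factorial]
    have h2 := (Real.log_le_iff_le_exp (by norm_num)).2 h
    have h3 : Real.log (2 / 3) = -Real.log (3 / 2) := by
      rw [← Real.log_inv]; norm_num
    rw [h3]; linarith
  have h4 : 1 - 0.406 * θ + 0.0412 * θ ^ 2 ≤ (2 / 3 : ℝ) ^ θ := by
    rw [Real.rpow_def_of_pos (by norm_num)]
    have h5 : Real.exp (-0.203 * θ) ^ 2 ≤ Real.exp (Real.log (2 / 3) * θ) := by
      rw [← Real.exp_nat_mul]
      refine Real.exp_le_exp.2 ?_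
      push_cast
      nlinarith
    have h7 := pow_le_pow_left₀ (by linarith : 0 ≤ 1 - 0.203 * θ)
      (by linarith [Real.add_one_le_exp (-0.203 * θ)] : 1 - 0.203 * θ ≤ Real.exp (-0.203 * θ)) 2
    nlinarith [sq_nonneg θ]
  unfold secondDiffFactor
  linarith

/-- Here 11/6 is half the factor at θ = 1, where equality holds. The lemma turns s^θ > K/2 into the
θ-free bound s ≥ 11/6. -/
lemma rpow_le_secondDiffFactor {θ : ℝ} (hθ : 0 ≤ θ) (hθ1 : θ ≤ 1) :
    (11 / 6 : ℝ) ^ θ ≤ secondDiffFactor θ / 2 := by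
  have h1 := rpow_one_add_le_one_add_mul_self (s := 5 / 6) (p := θ) (by norm_num) hθ hθ1
  have h2 : 2 - 1.3864 * (1 - θ) ≤ (2 : ℝ) ^ θ := by
    have h3 : (2 : ℝ) ^ θ = 2 * Real.exp (-(Real.log 2 * (1 - θ))) := by
      rw [Real.rpow_def_of_pos two_pos]
      nth_rewrite 2 [← Real.exp_log two_pos]
      rw [← Real.exp_add]; congr 1; ring
    have h4 := Real.add_one_le_exp (-(Real.log 2 * (1 - θ)))
    have h5 : Real.log 2 * (1 - θ) ≤ 0.6932 * (1 - θ) :=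
      mul_le_mul_of_nonneg_right (by linarith [Real.log_two_lt_d9]) (by linarith)
    rw [h3]; linarith
  have h3 : (2 / 3 : ℝ) ≤ (2 / 3) ^ θ := by
    have := Real.rpow_le_rpow_of_exponent_ge (x := 2 / 3) (by norm_num) (by norm_num) hθ1
    rwa [Real.rpow_one] at this
  rw [show (1 : ℝ) + 5 / 6 = 11 / 6 by norm_num] at h1
  unfold secondDiffFactor
  linarith

/-- On this range the left side is at most 3/2, which is half of the lower bound 3 for the factor.
It improves the bound on s to 9/4. -/
lemma rpow_half_le_secondDiffFactor {θ : ℝ} (hθ : 0 ≤ θ) (hθ1 : θ ≤ 1 / 2) :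
    (9 / 4 : ℝ) ^ θ ≤ secondDiffFactor θ / 2 := by
  have h1 : (9 / 4 : ℝ) ^ θ ≤ (9 / 4) ^ (1 / 2 : ℝ) :=
    Real.rpow_le_rpow_of_exponent_le (by norm_num) hθ1
  have h2 : (9 / 4 : ℝ) ^ (1 / 2 : ℝ) = 3 / 2 := by
    rw [← Real.sqrt_eq_rpow, show (9 / 4 : ℝ) = (3 / 2) ^ 2 by norm_num]
    exact Real.sqrt_sq (by norm_num)
  have h3 := secondDiffFactor_ge hθ (by linarith)
  nlinarith [sq_nonneg θ]

lemma inv_sqrt_le {s c : ℝ} (hc : 0 < c) (h : (c ^ 2)⁻¹ ≤ s) : (Real.sqrt s)⁻¹ ≤ c := by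
  have h1 : c⁻¹ ≤ Real.sqrt s := Real.le_sqrt_of_sq_le (by rwa [inv_pow])
  simpa using inv_anti₀ (inv_pos.2 hc) h1

lemma two_mul_inv_sqrt_two_exp_le : 2 * (Real.sqrt (2 * Real.exp 1))⁻¹ ≤ 0.8578 := by
  have h := inv_sqrt_le (s := 2 * Real.exp 1) (c := 0.4289) (by norm_num)
    (le_trans (by norm_num) (mul_le_mul_of_nonneg_left Real.exp_one_gt_d9.le two_pos.le))
  linarith

/-- Only s with s^θ > K/2 matter, the trivial bound 2 serving otherwise, so s is bounded below. With
r = s^{-1/2} bounded above, the left side is dominated by an affine function of θ, to be compared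
with the quadratic minorant of K. -/
lemma mixed_factor_le {θ : ℝ} (hθ : θ ∈ Icc (0 : ℝ) 1) {s : ℝ} (hs : 0 < s)
    (h : secondDiffFactor θ / 2 < s ^ θ) :
    2 - θ * (s + 1)⁻¹ + (θ * (Real.sqrt 2 / Real.sqrt s)
        + (1 - θ) * (2 * (Real.sqrt (2 * Real.exp 1 * s))⁻¹))
        + (Real.sqrt 2)⁻¹ * (θ + (1 - θ) * s⁻¹) ≤ secondDiffFactor θ := by
  have hK := secondDiffFactor_ge hθ.1 hθ.2
  have hsq2 : Real.sqrt 2 ≤ 1.41422 := Real.sqrt_le_iff.2 ⟨by norm_num, by norm_num⟩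
  have hsq2' : (Real.sqrt 2)⁻¹ ≤ 0.70711 := inv_sqrt_le (by norm_num) (by norm_num)
  have hge : ∀ c : ℝ, 0 ≤ c → c ^ θ ≤ secondDiffFactor θ / 2 → c ≤ s := fun c hc hcK => by
    by_contra! hlt
    exact absurd ((Real.rpow_le_rpow hs.le hlt.le hθ.1).trans hcK) (not_le.2 h)
  have hs1 := hge _ (by norm_num) (rpow_le_secondDiffFactor hθ.1 hθ.2)
  set r := (Real.sqrt s)⁻¹ with hr
  have hr0 : 0 < r := by positivity
  have hrs : s⁻¹ = r ^ 2 := by rw [hr, inv_pow, Real.sq_sqrt hs.le]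
  have hs1' : (s + 1)⁻¹ = r ^ 2 / (1 + r ^ 2) := by
    rw [← hrs]; field_simp
  have h2e : 2 * (Real.sqrt (2 * Real.exp 1 * s))⁻¹ ≤ 0.8578 * r := by
    rw [Real.sqrt_mul (by positivity), mul_inv, ← mul_assoc]
    exact mul_le_mul_of_nonneg_right two_mul_inv_sqrt_two_exp_le hr0.le
  have hA : Real.sqrt 2 / Real.sqrt s ≤ 1.41422 * r := by
    rw [div_eq_mul_inv]; exact mul_le_mul_of_nonneg_right hsq2 hr0.le
  have key : ∀ c d : ℝ, 1.41422 * r - r ^ 2 / (1 + r ^ 2) ≤ c →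
      0.8578 * r + 0.70711 * r ^ 2 ≤ d →
      2 - θ * (s + 1)⁻¹ + (θ * (Real.sqrt 2 / Real.sqrt s)
        + (1 - θ) * (2 * (Real.sqrt (2 * Real.exp 1 * s))⁻¹))
        + (Real.sqrt 2)⁻¹ * (θ + (1 - θ) * s⁻¹) ≤ 2 + θ * (c + 0.70711) + (1 - θ) * d := by
    intro c d hc hd
    rw [hs1', hrs]
    have e1 := mul_le_mul_of_nonneg_left hA hθ.1
    have e2 := mul_le_mul_of_nonneg_left h2e (sub_nonneg.2 hθ.2)
    have e3 := mul_le_mul_of_nonneg_right hsq2'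
      (add_nonneg hθ.1 (mul_nonneg (sub_nonneg.2 hθ.2) (sq_nonneg r)))
    have e4 := mul_le_mul_of_nonneg_left hc hθ.1
    have e5 := mul_le_mul_of_nonneg_left hd (sub_nonneg.2 hθ.2)
    linarith
  have hfrac : ∀ c : ℝ, 1.41422 * r * (1 + r ^ 2) - r ^ 2 ≤ c * (1 + r ^ 2) →
      1.41422 * r - r ^ 2 / (1 + r ^ 2) ≤ c := fun c hc => by
    rw [← sub_nonneg] at hc ⊢
    have : c - (1.41422 * r - r ^ 2 / (1 + r ^ 2))
        = (c * (1 + r ^ 2) - (1.41422 * r * (1 + r ^ 2) - r ^ 2)) / (1 + r ^ 2) := by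
      field_simp
    rw [this]; positivity
  -- Knowing only s ≥ 11/6, the estimates fail near θ = 0, where they give 3.0194 against K = 3; so
  -- small θ uses s ≥ 9/4. The constants 2/3 and 0.7386 bound r, and the arguments of `key` are its
  -- two expressions at those endpoints, rounded up.
  rcases le_total θ (1 / 2) with hθ2 | hθ2
  · have hs2 := hge _ (by norm_num) (rpow_half_le_secondDiffFactor hθ.1 hθ2)
    have hr1 : r ≤ 2 / 3 := inv_sqrt_le (by norm_num) (by norm_num; linarith)
    refine (key 0.63522 0.88614 (hfrac _ ?_) ?_).trans ?_
    · nlinarith [mul_nonneg (sub_nonneg.2 hr1)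
        (by nlinarith [sq_nonneg (r - 0.25)] : 0 ≤ 1.41422 * r ^ 2 - 0.6924 * r + 0.9526)]
    · nlinarith
    · nlinarith [sq_nonneg θ]
  · have hr1 : r ≤ 0.7386 := inv_sqrt_le (by norm_num) (by norm_num; linarith)
    refine (key 0.692 1.0194 (hfrac _ ?_) ?_).trans ?_
    · nlinarith [mul_nonneg (sub_nonneg.2 hr1)
        (by nlinarith [sq_nonneg (r - 0.25)] : 0 ≤ 1.41422 * r ^ 2 - 0.6475 * r + 0.936)]
    · nlinarith
    · nlinarith

/-- The bound `min(2, K s^{-θ})` for mixed second differences of Poisson expectations. -/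
lemma abs_poisE_mixed_diff_le_min {θ : ℝ} (hθ : θ ∈ Icc (0 : ℝ) 1) {s : ℝ} (hs : 0 < s)
    {a b b' g : ℕ → ℝ} (ha : ∀ n, a n ∈ Icc (0 : ℝ) 1) (hb : ∀ n, b n ∈ Icc (0 : ℝ) 1)
    (hb' : ∀ n, b' n ∈ Icc (0 : ℝ) 1) (hg : ∀ n, g n ∈ Icc (0 : ℝ) 1)
    (hab : ∀ n, |a n - b (n + 1)| ≤ ((n : ℝ) + 2) ^ (-θ))
    (hbg : ∀ n, |b n - g (n + 1)| ≤ ((n : ℝ) + 1) ^ (-θ))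
    (hbg' : ∀ n, |b' n - g (n + 1)| ≤ ((n : ℝ) + 1) ^ (-θ)) :
    |poisE s fun n => a n - b n - b' n + g n| ≤ min 2 (secondDiffFactor θ * s ^ (-θ)) := by
  have h2 : |poisE s fun n => a n - b n - b' n + g n| ≤ 2 := by
    refine abs_poisE_le hs.le fun n => abs_le.2 ⟨?_, ?_⟩ <;>
    linarith [(ha n).1, (ha n).2, (hb n).1, (hb n).2, (hb' n).1, (hb' n).2, (hg n).1, (hg n).2]
  refine le_min h2 ?_
  have hp : 0 < s ^ (-θ) := Real.rpow_pos_of_pos hs _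
  -- If s^θ ≤ K/2, then K s^{-θ} ≥ 2 and the trivial bound is enough.
  rcases le_or_gt (s ^ θ) (secondDiffFactor θ / 2) with h | h
  · refine h2.trans ?_
    have h3 : s ^ θ * s ^ (-θ) = 1 := by
      rw [← Real.rpow_add hs, add_neg_cancel, Real.rpow_zero]
    have := mul_le_mul_of_nonneg_right h hp.le
    linarith
  · refine (abs_poisE_mixed_diff_le hθ hs hab hbg hbg' hg).trans ?_
    rw [mul_comm]
    exact mul_le_mul_of_nonneg_right (mixed_factor_le hθ hs h) hp.le

end NumericalBounds

/-! ### Differences of the semigroup -/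

section PointMoves

lemma rpow_neg_card_le {θ : ℝ} (hθ : 0 ≤ θ) (k : ℕ) {c : ℝ} (hc : 0 < c) :
    ((k : ℝ) + c) ^ (-θ) ≤ c ^ (-θ) :=
  Real.rpow_le_rpow_of_nonpos hc (by linarith [(Nat.cast_nonneg k : (0 : ℝ) ≤ k)])
    (neg_nonpos.2 hθ)

variable {X : Type*} [MetricSpace X] [MeasurableSpace X] [BorelSpace X]
  [SecondCountableTopology X]

/-- Functions with values in `[0, 1]` for which moving one of `n` points from `x` to `y` costs at
most `dist x y * n^{-θ}`. -/
structure PowerLipschitz (θ : ℝ) (f : PointMeasure X → ℝ) : Prop extends UnitLipschitz f where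
  abs_sub_le : ∀ ξ x y, |f (ξ + {x}) - f (ξ + {y})|
    ≤ dist x y * ((Multiset.card ξ : ℝ) + 1) ^ (-θ)

variable (μ : Measure X) [IsProbabilityMeasure μ] {θ : ℝ} {f : PointMeasure X → ℝ}

/-- The n further random points are shared by both configurations and enlarge the number over which
the distance is averaged. -/
lemma PowerLipschitz.abs_iterate_sub_le (hf : PowerLipschitz θ f) (n : ℕ) (ζ : PointMeasure X)
    (x y : X) : |(addRandom μ)^[n] f (ζ + {x}) - (addRandom μ)^[n] f (ζ + {y})|
      ≤ dist x y * ((Multiset.card ζ : ℝ) + n + 1) ^ (-θ) := by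
  induction n generalizing ζ with
  | zero => simpa using hf.abs_sub_le ζ x y
  | succ n ih =>
    have hi := hf.toUnitLipschitz.iterate_addRandom μ n
    rw [Function.iterate_succ_apply']
    change |(∫ z, (addRandom μ)^[n] f (ζ + {x} + {z}) ∂μ)
      - ∫ z, (addRandom μ)^[n] f (ζ + {y} + {z}) ∂μ| ≤ _
    rw [← integral_sub (hi.integrable μ _) (hi.integrable μ _), ← Real.norm_eq_abs]
    refine (norm_integral_le_of_norm_le_const (μ := μ) (C := dist x y *
      ((Multiset.card ζ : ℝ) + (n + 1 : ℕ) + 1) ^ (-θ))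
      (Filter.Eventually.of_forall fun z => ?_)).trans_eq (by
        rw [probReal_univ, mul_one])
    have h := ih (ζ + {z})
    rw [add_right_comm ζ {x}, add_right_comm ζ {y}, Real.norm_eq_abs]
    refine h.trans_eq ?_
    simp only [Multiset.card_add, Multiset.card_singleton]
    push_cast
    ring_nf

variable (hdist : ∀ x y : X, dist x y ≤ 1)
include hdist

/-- The extra random point of the (n + 1)-st iterate is coupled with the fixed point `x`; their
distance is at most 1. -/
lemma PowerLipschitz.abs_iterate_sub_succ_le (hf : PowerLipschitz θ f) (n : ℕ)
    (ζ : PointMeasure X) (x : X) :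
    |(addRandom μ)^[n] f (ζ + {x}) - (addRandom μ)^[n + 1] f ζ|
      ≤ ((Multiset.card ζ : ℝ) + n + 1) ^ (-θ) := by
  have hi := hf.toUnitLipschitz.iterate_addRandom μ n
  have e : (addRandom μ)^[n] f (ζ + {x}) - (addRandom μ)^[n + 1] f ζ
      = ∫ y, ((addRandom μ)^[n] f (ζ + {x}) - (addRandom μ)^[n] f (ζ + {y})) ∂μ := by
    rw [integral_sub (integrable_const _) (hi.integrable μ _), Function.iterate_succ_apply']
    simp [addRandom]
  rw [e, ← Real.norm_eq_abs]
  refine (norm_integral_le_of_norm_le_const (μ := μ) (C := ((Multiset.card ζ : ℝ) + n + 1) ^ (-θ))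
      (Filter.Eventually.of_forall fun z => ?_)).trans_eq (by
        rw [probReal_univ, mul_one])
  refine (hf.abs_iterate_sub_le μ n ζ x z).trans ?_
  exact mul_le_of_le_one_left (by positivity) (hdist x z)

/-- Replacing `x` by a random point costs s^{-θ} on average; the remaining shift of the Poisson
number by one costs at most the largest weight. -/
lemma PowerLipschitz.abs_addPoisson_sub_le (hθ : θ ∈ Icc (0 : ℝ) 1) (hf : PowerLipschitz θ f)
    {s : ℝ} (hs : 0 < s) (ζ : PointMeasure X) (x : X) :
    |addPoisson μ s f (ζ + {x}) - addPoisson μ s f ζ|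
      ≤ min 1 (s ^ (-θ) + (Real.sqrt (2 * Real.exp 1 * s))⁻¹) := by
  have hm := fun n => (hf.toUnitLipschitz.iterate_addRandom μ n).mem_Icc
  have hb := fun n => (hf.toUnitLipschitz.iterate_addRandom μ n).abs_le
  have hU := hf.toUnitLipschitz.addPoisson μ hs.le
  refine le_min (abs_le.2 ⟨?_, ?_⟩) ?_
  · linarith [(hU.mem_Icc (ζ + {x})).1, (hU.mem_Icc ζ).2]
  · linarith [(hU.mem_Icc (ζ + {x})).2, (hU.mem_Icc ζ).1]
  have h1 : ∀ n, |(addRandom μ)^[n] f (ζ + {x}) - (addRandom μ)^[n + 1] f ζ|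
      ≤ ((n : ℝ) + 1) ^ (-θ) := fun n => by
    refine (hf.abs_iterate_sub_succ_le μ hdist n ζ x).trans ?_
    rw [add_assoc]
    exact rpow_neg_card_le hθ.1 _ (by positivity)
  have b1 : ∀ n : ℕ, |((n : ℝ) + 1) ^ (-θ)| ≤ 1 := fun n =>
    rpow_neg_nonneg_le_one hθ.1 (one_le_cast_add_one n)
  have e : addPoisson μ s f (ζ + {x}) - addPoisson μ s f ζ
      = poisE s (fun n => (addRandom μ)^[n] f (ζ + {x}) - (addRandom μ)^[n + 1] f ζ)
        + poisE s (fun n => (addRandom μ)^[n + 1] f ζ - (addRandom μ)^[n] f ζ) := by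
    unfold addPoisson
    rw [← poisE_sub s (fun n => hb n (ζ + {x})) (fun n => hb n ζ), ← poisE_add s
      (fun n => (h1 n).trans ((le_abs_self _).trans (b1 n)))
      (fun n => (abs_sub _ _).trans (add_le_add (hb (n + 1) ζ) (hb n ζ)))]
    congr 1; funext n; ring
  rw [e]
  exact (abs_add_le _ _).trans (add_le_add
    ((abs_poisE_le_poisE hs.le b1 h1).trans (poisE_rpow_add_one_le hθ hs))
    (abs_poisE_forward_diff_le hs fun n => hm n ζ))

/-- Conditionally on n Poisson points the four configurations give sequences a, b, b', g, and
replacing one added point by a random one shifts the index. In a there is one further point, whence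
n + 2. -/
lemma PowerLipschitz.abs_addPoisson_second_diff_le (hθ : θ ∈ Icc (0 : ℝ) 1)
    (hf : PowerLipschitz θ f) {s : ℝ} (hs : 0 < s) (ζ : PointMeasure X) (x y : X) :
    |addPoisson μ s f (ζ + {x} + {y}) - addPoisson μ s f (ζ + {x}) - addPoisson μ s f (ζ + {y})
        + addPoisson μ s f ζ| ≤ min 2 (secondDiffFactor θ * s ^ (-θ)) := by
  have hm := fun n => (hf.toUnitLipschitz.iterate_addRandom μ n).mem_Icc
  have hb := fun n => (hf.toUnitLipschitz.iterate_addRandom μ n).abs_le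
  have h1 : ∀ n z, |(addRandom μ)^[n] f (ζ + {z}) - (addRandom μ)^[n + 1] f ζ|
      ≤ ((n : ℝ) + 1) ^ (-θ) := fun n z => by
    refine (hf.abs_iterate_sub_succ_le μ hdist n ζ z).trans ?_
    rw [add_assoc]
    exact rpow_neg_card_le hθ.1 _ (by positivity)
  have h2 : ∀ n : ℕ, |(addRandom μ)^[n] f (ζ + {x} + {y}) - (addRandom μ)^[n + 1] f (ζ + {x})|
      ≤ ((n : ℝ) + 2) ^ (-θ) := fun n => by
    refine (hf.abs_iterate_sub_succ_le μ hdist n _ y).trans ?_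
    have := rpow_neg_card_le hθ.1 (Multiset.card ζ) (c := (n : ℝ) + 2) (by positivity)
    refine le_trans (le_of_eq ?_) this
    simp only [Multiset.card_add, Multiset.card_singleton]
    push_cast
    ring_nf
  have h := abs_poisE_mixed_diff_le_min hθ hs (fun n => hm n _) (fun n => hm n _)
    (fun n => hm n _) (fun n => hm n _) h2 (fun n => h1 n x) (fun n => h1 n y)
  refine le_trans (le_of_eq ?_) h
  unfold addPoisson
  have c1 := fun n => (abs_sub ((addRandom μ)^[n] f (ζ + {x} + {y}))
    ((addRandom μ)^[n] f (ζ + {x}))).trans (add_le_add (hb n _) (hb n _))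
  have c2 := fun n => (abs_sub ((addRandom μ)^[n] f (ζ + {x} + {y}) -
    (addRandom μ)^[n] f (ζ + {x})) ((addRandom μ)^[n] f (ζ + {y}))).trans
      (add_le_add (c1 n) (hb n _))
  rw [← poisE_sub s (fun n => hb n _) (fun n => hb n _), ← poisE_sub s c1 (fun n => hb n _),
    ← poisE_add s c2 (fun n => hb n _)]

omit hdist in
lemma PowerLipschitz.abs_addPoisson_move_le (hθ : θ ∈ Icc (0 : ℝ) 1) (hf : PowerLipschitz θ f)
    {s : ℝ} (hs : 0 < s) (ζ : PointMeasure X) (x y : X) :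
    |addPoisson μ s f (ζ + {x}) - addPoisson μ s f (ζ + {y})|
      ≤ min 1 (s ^ (-θ)) * dist x y := by
  have hb := fun n => (hf.toUnitLipschitz.iterate_addRandom μ n).abs_le
  have b1 : ∀ n : ℕ, |((n : ℝ) + 1) ^ (-θ)| ≤ 1 := fun n =>
    rpow_neg_nonneg_le_one hθ.1 (one_le_cast_add_one n)
  rw [min_mul_of_nonneg _ _ dist_nonneg, one_mul]
  refine le_min ((hf.toUnitLipschitz.addPoisson μ hs.le).pointLipschitz ζ x y) ?_
  have h1 : ∀ n, |(addRandom μ)^[n] f (ζ + {x}) - (addRandom μ)^[n] f (ζ + {y})|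
      ≤ dist x y * ((n : ℝ) + 1) ^ (-θ) := fun n => by
    refine (hf.abs_iterate_sub_le μ n ζ x y).trans ?_
    rw [add_assoc]
    exact mul_le_mul_of_nonneg_left (rpow_neg_card_le hθ.1 _ (by positivity)) dist_nonneg
  have b2 : ∀ n : ℕ, |dist x y * ((n : ℝ) + 1) ^ (-θ)| ≤ dist x y := fun n => by
    rw [abs_mul, abs_of_nonneg dist_nonneg]
    exact mul_le_of_le_one_right dist_nonneg (b1 n)
  unfold addPoisson
  rw [← poisE_sub s (fun n => hb n _) (fun n => hb n _)]
  refine (abs_poisE_le_poisE hs.le b2 h1).trans ?_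
  rw [poisE_const_mul, mul_comm]
  exact mul_le_mul_of_nonneg_right (poisE_rpow_add_one_le hθ hs) dist_nonneg

-- Two moves, each costing at most min(1, s^{-θ}) times the distance; the bound used for second
-- differences dominates their sum because K ≥ 2.
omit hdist in
lemma PowerLipschitz.abs_addPoisson_diff_move_le (hθ : θ ∈ Icc (0 : ℝ) 1)
    (hf : PowerLipschitz θ f) {s : ℝ} (hs : 0 < s) (ζ : PointMeasure X) (x y z : X) :
    |addPoisson μ s f (ζ + {y} + {x}) - addPoisson μ s f (ζ + {y})
        - (addPoisson μ s f (ζ + {z} + {x}) - addPoisson μ s f (ζ + {z}))|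
      ≤ min 2 (secondDiffFactor θ * s ^ (-θ)) * dist y z := by
  have h1 := hf.abs_addPoisson_move_le μ hθ hs (ζ + {x}) y z
  have h2 := hf.abs_addPoisson_move_le μ hθ hs ζ y z
  rw [add_right_comm ζ {x} {y}, add_right_comm ζ {x} {z}] at h1
  have h3 : 2 * min 1 (s ^ (-θ)) ≤ min 2 (secondDiffFactor θ * s ^ (-θ)) := by
    have hp : 0 < s ^ (-θ) := Real.rpow_pos_of_pos hs _
    have hK : 2 ≤ secondDiffFactor θ := by
      nlinarith [secondDiffFactor_ge hθ.1 hθ.2, hθ.1, sq_nonneg θ]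
    refine le_min (by linarith [min_le_left 1 (s ^ (-θ))]) ?_
    have := mul_le_mul_of_nonneg_right hK hp.le
    linarith [min_le_right 1 (s ^ (-θ))]
  have h4 := mul_le_mul_of_nonneg_right h3 (dist_nonneg (x := y) (y := z))
  rw [abs_le] at *
  constructor <;> linarith

end PointMoves

/-! ### The solution of the Stein equation -/

section SteinDifferences

lemma image_one_sub_exp_neg : (fun t : ℝ => 1 - Real.exp (-t)) '' Ioi 0 = Ioo 0 1 := by
  ext u
  constructor
  · rintro ⟨t, ht, rfl⟩
    have h1 : Real.exp (-t) < 1 := Real.exp_lt_one_iff.2 (neg_neg_of_pos ht)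
    exact ⟨by linarith, by linarith [Real.exp_pos (-t)]⟩
  · rintro ⟨h0, h1⟩
    have h2 : 0 < 1 - u := sub_pos.2 h1
    refine ⟨-Real.log (1 - u), ?_, ?_⟩
    · exact neg_pos.2 (Real.log_neg h2 (by linarith))
    · simp only [neg_neg, Real.exp_log h2, sub_sub_cancel]

lemma injOn_one_sub_exp_neg : InjOn (fun t : ℝ => 1 - Real.exp (-t)) (Ioi 0) := by
  intro a _ b _ h
  have h2 : Real.exp (-a) = Real.exp (-b) := by simpa using h
  exact neg_injective (Real.exp_injective h2)

lemma hasDerivAt_one_sub_exp_neg (t : ℝ) :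
    HasDerivAt (fun t : ℝ => 1 - Real.exp (-t)) (Real.exp (-t)) t := by
  have he : HasDerivAt (fun t : ℝ => Real.exp (-t)) (-Real.exp (-t)) t := by
    simpa using (hasDerivAt_neg t).exp
  simpa using he.const_sub 1

/-- The substitution u = 1 - e^{-t} absorbs one survival factor e^{-t} into du; a second survival
factor becomes 1 - u. -/
lemma integral_exp_neg_mul_comp (F : ℝ → ℝ) :
    ∫ t in Ioi (0 : ℝ), Real.exp (-t) * F (1 - Real.exp (-t)) = ∫ u in Ioo (0 : ℝ) 1, F u := by
  rw [← image_one_sub_exp_neg, integral_image_eq_integral_abs_deriv_smul measurableSet_Ioi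
    (fun t _ => (hasDerivAt_one_sub_exp_neg t).hasDerivWithinAt) injOn_one_sub_exp_neg]
  simp only [abs_of_pos (Real.exp_pos _), smul_eq_mul]

lemma integrableOn_exp_neg_mul_comp {F : ℝ → ℝ} (hF : IntegrableOn F (Ioo 0 1)) :
    IntegrableOn (fun t => Real.exp (-t) * F (1 - Real.exp (-t))) (Ioi 0) := by
  rw [← image_one_sub_exp_neg, integrableOn_image_iff_integrableOn_abs_deriv_smul measurableSet_Ioi
    (fun t _ => (hasDerivAt_one_sub_exp_neg t).hasDerivWithinAt) injOn_one_sub_exp_neg] at hF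
  simpa only [abs_of_pos (Real.exp_pos _), smul_eq_mul] using hF

lemma abs_integral_le_of_exp_neg {F : ℝ → ℝ} (hF : IntegrableOn F (Ioo 0 1)) {g : ℝ → ℝ}
    (hg : ∀ t, 0 < t → |g t| ≤ Real.exp (-t) * F (1 - Real.exp (-t))) :
    |∫ t in Ioi (0 : ℝ), g t| ≤ ∫ u in Ioo (0 : ℝ) 1, F u := by
  rw [← integral_exp_neg_mul_comp, ← Real.norm_eq_abs]
  exact norm_integral_le_of_norm_le (integrableOn_exp_neg_mul_comp hF)
    ((ae_restrict_iff' measurableSet_Ioi).2 (Filter.Eventually.of_forall hg))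

section Thin

variable {X : Type*} (r : ℝ) (g : PointMeasure X → ℝ) (ζ : PointMeasure X)

lemma thin_add_singleton_sub (x : X) :
    thin r g (ζ + {x}) - thin r g ζ = r * thin r (fun η => g (η + {x}) - g η) ζ := by
  have h := thin_sub r (addPoint x g) g ζ
  rw [thin_add_singleton]
  change _ = r * thin r (fun η => addPoint x g η - g η) ζ
  rw [h]; ring

lemma thin_second_diff (x y : X) :
    thin r g (ζ + {x} + {y}) - thin r g (ζ + {x}) - thin r g (ζ + {y}) + thin r g ζ
      = r ^ 2 * thin r (fun η => g (η + {x} + {y}) - g (η + {x}) - g (η + {y}) + g η) ζ := by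
  have h := thin_add_singleton_sub r (fun η => g (η + {y}) - g η) ζ x
  have e : thin r g (ζ + {x} + {y}) - thin r g (ζ + {x}) - thin r g (ζ + {y}) + thin r g ζ
      = (thin r g (ζ + {x} + {y}) - thin r g (ζ + {x}))
        - (thin r g (ζ + {y}) - thin r g ζ) := by ring
  rw [e, thin_add_singleton_sub, thin_add_singleton_sub, ← mul_sub, h, ← mul_assoc, ← sq]
  congr 2
  funext η
  ring

lemma thin_diff_move (x y z : X) :
    (thin r g (ζ + {y} + {x}) - thin r g (ζ + {y}))
        - (thin r g (ζ + {z} + {x}) - thin r g (ζ + {z}))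
      = r ^ 2 * thin r (fun η => g (η + {y} + {x}) - g (η + {y})
          - (g (η + {z} + {x}) - g (η + {z}))) ζ := by
  have h := thin_sub r (addPoint y fun η => g (η + {x}) - g η)
    (addPoint z fun η => g (η + {x}) - g η) ζ
  rw [thin_add_singleton_sub, thin_add_singleton_sub, thin_add_singleton, thin_add_singleton]
  change _ = r ^ 2 * thin r (fun η => addPoint y (fun η => g (η + {x}) - g η) η
    - addPoint z (fun η => g (η + {x}) - g η) η) ζ
  rw [h]; ring

end Thin

variable {X : Type*} [MetricSpace X] [MeasurableSpace X] [BorelSpace X]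
  [SecondCountableTopology X] (lam : Measure X) [IsFiniteMeasure lam] [NeZero lam]
  {f : PointMeasure X → ℝ}

/-- From the empty configuration the two laws are Poisson with masses l(1 - e^{-t}) and l. The
derivative in the mass is a difference of two numbers in [0, 1], so the mean value inequality
applies. -/
lemma abs_flow_zero_sub_le (hf : UnitLipschitz f) {t : ℝ} (ht : 0 ≤ t) :
    |flow lam f t 0 - ∫ η, f η ∂(poissonProcess lam)| ≤ lam.real univ * Real.exp (-t) := by
  have hl := lam_real_pos lam
  have hu : 0 ≤ lam.real univ * (1 - Real.exp (-t)) :=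
    mul_nonneg hl.le (sub_nonneg.2 (exp_neg_mem_Icc ht).2)
  have h := (convex_Ici (0 : ℝ)).norm_image_sub_le_of_norm_hasDerivWithin_le (C := 1)
    (f := fun s => addPoisson (normalized lam) s f 0)
    (fun s hs => (hasDerivAt_addPoisson (normalized lam) hf hs 0).hasDerivWithinAt)
    (fun s hs => ?_) (mem_Ici.2 hl.le) (mem_Ici.2 hu)
  · rw [integral_poissonProcess lam hf]
    unfold flow semigroup
    rw [thin_zero]
    simp only [Real.norm_eq_abs, one_mul] at h
    refine h.trans_eq ?_
    rw [show lam.real univ * (1 - Real.exp (-t)) - lam.real univ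
      = -(lam.real univ * Real.exp (-t)) by ring, abs_neg, abs_of_nonneg (by positivity)]
  · have hU := hf.addPoisson (normalized lam) hs
    have h1 := (hU.addRandom (normalized lam)).mem_Icc 0
    have h2 := hU.mem_Icc 0
    rw [Real.norm_eq_abs, abs_le]
    constructor <;> linarith [h1.1, h1.2, h2.1, h2.2]

omit [MetricSpace X] [BorelSpace X] [SecondCountableTopology X] [IsFiniteMeasure lam]
  [NeZero lam] in
lemma flow_add_singleton_sub (t : ℝ) (ζ : PointMeasure X) (x : X) :
    flow lam f t (ζ + {x}) - flow lam f t ζ = Real.exp (-t) * thin (Real.exp (-t))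
      (fun η => addPoisson (normalized lam) (lam.real univ * (1 - Real.exp (-t))) f (η + {x})
        - addPoisson (normalized lam) (lam.real univ * (1 - Real.exp (-t))) f η) ζ :=
  thin_add_singleton_sub _ _ _ _

/-- Each initial point changes the expectation by at most its survival probability e^{-t}. This
decay makes the integral defining the Stein solution converge. -/
lemma abs_flow_sub_le (hf : UnitLipschitz f) {t : ℝ} (ht : 0 ≤ t) (ζ : PointMeasure X) :
    |flow lam f t ζ - ∫ η, f η ∂(poissonProcess lam)|
      ≤ (lam.real univ + Multiset.card ζ) * Real.exp (-t) := by
  induction ζ using Multiset.induction_on with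
  | empty => simpa using abs_flow_zero_sub_le lam hf ht
  | cons x ζ ih =>
    have hU := hf.addPoisson (normalized lam)
      (mul_nonneg (lam_real_pos lam).le (sub_nonneg.2 (exp_neg_mem_Icc ht).2))
    have h1 : |flow lam f t (ζ + {x}) - flow lam f t ζ| ≤ Real.exp (-t) := by
      rw [flow_add_singleton_sub, abs_mul, abs_of_pos (Real.exp_pos _)]
      refine mul_le_of_le_one_right (Real.exp_pos _).le (abs_thin_le (exp_neg_mem_Icc ht)
        (fun η => abs_le.2 ⟨?_, ?_⟩) ζ) <;>
      linarith [(hU.mem_Icc (η + {x})).1, (hU.mem_Icc (η + {x})).2, (hU.mem_Icc η).1,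
        (hU.mem_Icc η).2]
    rw [← Multiset.singleton_add, add_comm, Multiset.card_add, Multiset.card_singleton]
    push_cast
    rw [abs_le] at *
    constructor <;> linarith

lemma meanDeviation_eq (hf : UnitLipschitz f) (ξ : PointMeasure X) {t : ℝ} (ht : 0 ≤ t) :
    meanDeviation lam f ξ t = flow lam f t ξ - ∫ η, f η ∂(poissonProcess lam) := by
  unfold meanDeviation
  rw [integral_stateAt_eq_flow lam hf ht]

lemma integrableOn_meanDeviation (hf : UnitLipschitz f) (ξ : PointMeasure X) :
    IntegrableOn (meanDeviation lam f ξ) (Ioi 0) := by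
  have h1 : IntegrableOn (fun t => flow lam f (max t 0) ξ - ∫ η, f η ∂(poissonProcess lam))
      (Ioi 0) := by
    refine Integrable.mono' ((integrableOn_exp_neg_mul_comp (F := fun _ => 1)
      (by simp)).const_mul (lam.real univ + Multiset.card ξ))
      ((continuous_flow_max lam hf ξ).sub continuous_const).aestronglyMeasurable
      ((ae_restrict_iff' measurableSet_Ioi).2 (Filter.Eventually.of_forall fun t ht => ?_))
    rw [max_eq_left (le_of_lt ht), mul_one]
    exact abs_flow_sub_le lam hf (le_of_lt ht) ξ
  refine h1.congr_fun (fun t ht => ?_) measurableSet_Ioi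
  simp only [max_eq_left (le_of_lt (mem_Ioi.1 ht)), meanDeviation_eq lam hf ξ (le_of_lt ht)]

lemma integrableOn_meanDeviation_sub (hf : UnitLipschitz f) (ξ η : PointMeasure X) :
    IntegrableOn (fun t => meanDeviation lam f ξ t - meanDeviation lam f η t) (Ioi 0) :=
  (integrableOn_meanDeviation lam hf ξ).sub (integrableOn_meanDeviation lam hf η)

lemma steinSolution_sub (hf : UnitLipschitz f) (ξ η : PointMeasure X) :
    steinSolution lam f ξ - steinSolution lam f η
      = -∫ t in Ioi (0 : ℝ), (meanDeviation lam f ξ t - meanDeviation lam f η t) := by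
  unfold steinSolution
  rw [integral_sub (integrableOn_meanDeviation lam hf ξ) (integrableOn_meanDeviation lam hf η)]
  ring

lemma steinSolution_sub_sub (hf : UnitLipschitz f) (ξ η ξ' η' : PointMeasure X) :
    steinSolution lam f ξ - steinSolution lam f η
        - (steinSolution lam f ξ' - steinSolution lam f η')
      = -∫ t in Ioi (0 : ℝ), ((meanDeviation lam f ξ t - meanDeviation lam f η t)
          - (meanDeviation lam f ξ' t - meanDeviation lam f η' t)) := by
  rw [steinSolution_sub lam hf, steinSolution_sub lam hf, integral_sub
    (integrableOn_meanDeviation_sub lam hf ξ η) (integrableOn_meanDeviation_sub lam hf ξ' η')]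
  ring

/-- The integrated bound on first differences. -/
def firstDiffIntegral (θ l : ℝ) : ℝ :=
  ∫ u in Ioo (0 : ℝ) 1, min 1 ((l * u) ^ (-θ) + (Real.sqrt (2 * Real.exp 1 * (l * u)))⁻¹)

/-- The integrated bound on second differences. -/
def secondDiffIntegral (θ l : ℝ) : ℝ :=
  ∫ u in Ioo (0 : ℝ) 1, (1 - u) * min 2 (secondDiffFactor θ * (l * u) ^ (-θ))

lemma integrableOn_firstDiffIntegral {θ l : ℝ} (hl : 0 < l) :
    IntegrableOn (fun u => min 1 ((l * u) ^ (-θ) + (Real.sqrt (2 * Real.exp 1 * (l * u)))⁻¹))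
      (Ioo (0 : ℝ) 1) := by
  refine Measure.integrableOn_of_bounded (M := 1) (by simp)
    (Measurable.aestronglyMeasurable (by fun_prop))
    ((ae_restrict_iff' measurableSet_Ioo).2 (Filter.Eventually.of_forall fun u hu => ?_))
  have : 0 ≤ (l * u) ^ (-θ) := Real.rpow_nonneg (mul_nonneg hl.le hu.1.le) _
  rw [Real.norm_of_nonneg (le_min zero_le_one (by positivity))]
  exact min_le_left _ _

lemma secondDiffFactor_pos (θ : ℝ) : 0 < secondDiffFactor θ := by
  unfold secondDiffFactor; positivity

lemma integrableOn_secondDiffIntegral {θ l : ℝ} (hl : 0 < l) :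
    IntegrableOn (fun u => (1 - u) * min 2 (secondDiffFactor θ * (l * u) ^ (-θ)))
      (Ioo (0 : ℝ) 1) := by
  refine Measure.integrableOn_of_bounded (M := 2) (by simp)
    (Measurable.aestronglyMeasurable (by fun_prop))
    ((ae_restrict_iff' measurableSet_Ioo).2 (Filter.Eventually.of_forall fun u hu => ?_))
  have h1 : 0 ≤ (l * u) ^ (-θ) := Real.rpow_nonneg (mul_nonneg hl.le hu.1.le) _
  have h2 : 0 ≤ min 2 (secondDiffFactor θ * (l * u) ^ (-θ)) :=
    le_min zero_le_two (mul_nonneg (secondDiffFactor_pos θ).le h1)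
  have h3 : 0 ≤ 1 - u := sub_nonneg.2 hu.2.le
  rw [Real.norm_of_nonneg (mul_nonneg h3 h2)]
  have h4 := mul_le_mul_of_nonneg_left (min_le_left 2 (secondDiffFactor θ * (l * u) ^ (-θ))) h3
  linarith [hu.1]

variable {θ : ℝ} (hθ : θ ∈ Icc (0 : ℝ) 1) (hf : PowerLipschitz θ f)
include hθ hf

lemma abs_steinSolution_sub_le (hdist : ∀ x y : X, dist x y ≤ 1) (ξ : PointMeasure X) (x : X) :
    |steinSolution lam f (ξ + {x}) - steinSolution lam f ξ|
      ≤ firstDiffIntegral θ (lam.real univ) := by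
  have hl := lam_real_pos lam
  rw [steinSolution_sub lam hf.toUnitLipschitz, abs_neg]
  refine abs_integral_le_of_exp_neg (integrableOn_firstDiffIntegral hl) fun t ht => ?_
  have hs : 0 < lam.real univ * (1 - Real.exp (-t)) :=
    mul_pos hl (sub_pos.2 (Real.exp_lt_one_iff.2 (neg_neg_of_pos ht)))
  rw [meanDeviation_eq lam hf.toUnitLipschitz _ ht.le,
    meanDeviation_eq lam hf.toUnitLipschitz _ ht.le, sub_sub_sub_cancel_right,
    flow_add_singleton_sub, abs_mul, abs_of_pos (Real.exp_pos _)]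
  exact mul_le_mul_of_nonneg_left (abs_thin_le (exp_neg_mem_Icc ht.le) (fun η =>
    hf.abs_addPoisson_sub_le _ hdist hθ hs η x) ξ) (Real.exp_pos _).le

lemma abs_steinSolution_second_diff_le (hdist : ∀ x y : X, dist x y ≤ 1) (ξ : PointMeasure X)
    (x y : X) :
    |steinSolution lam f (ξ + {x} + {y}) - steinSolution lam f (ξ + {x})
        - steinSolution lam f (ξ + {y}) + steinSolution lam f ξ|
      ≤ secondDiffIntegral θ (lam.real univ) := by
  have hl := lam_real_pos lam
  rw [sub_add, steinSolution_sub_sub lam hf.toUnitLipschitz, abs_neg]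
  refine abs_integral_le_of_exp_neg (integrableOn_secondDiffIntegral hl) fun t ht => ?_
  have hs : 0 < lam.real univ * (1 - Real.exp (-t)) :=
    mul_pos hl (sub_pos.2 (Real.exp_lt_one_iff.2 (neg_neg_of_pos ht)))
  simp only [meanDeviation_eq lam hf.toUnitLipschitz _ ht.le, sub_sub_sub_cancel_right]
  have e := thin_second_diff (Real.exp (-t)) (addPoisson (normalized lam)
    (lam.real univ * (1 - Real.exp (-t))) f) ξ x y
  unfold flow semigroup
  rw [← sub_add, e, abs_mul, abs_of_pos (by positivity), sub_sub_cancel, ← mul_assoc, ← sq]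
  exact mul_le_mul_of_nonneg_left (abs_thin_le (exp_neg_mem_Icc ht.le) (fun η =>
    hf.abs_addPoisson_second_diff_le _ hdist hθ hs η x y) ξ) (by positivity)

lemma abs_steinSolution_diff_move_le (ξ : PointMeasure X) (x y z : X) :
    |steinSolution lam f (ξ + {y} + {x}) - steinSolution lam f (ξ + {y})
        - (steinSolution lam f (ξ + {z} + {x}) - steinSolution lam f (ξ + {z}))|
      ≤ secondDiffIntegral θ (lam.real univ) * dist y z := by
  have hl := lam_real_pos lam
  rw [steinSolution_sub_sub lam hf.toUnitLipschitz, abs_neg, secondDiffIntegral,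
    ← integral_mul_const]
  refine abs_integral_le_of_exp_neg ((integrableOn_secondDiffIntegral hl).mul_const _)
    fun t ht => ?_
  have hs : 0 < lam.real univ * (1 - Real.exp (-t)) :=
    mul_pos hl (sub_pos.2 (Real.exp_lt_one_iff.2 (neg_neg_of_pos ht)))
  simp only [meanDeviation_eq lam hf.toUnitLipschitz _ ht.le, sub_sub_sub_cancel_right]
  have e := thin_diff_move (Real.exp (-t)) (addPoisson (normalized lam)
    (lam.real univ * (1 - Real.exp (-t))) f) ξ x y z
  unfold flow semigroup
  rw [e, abs_mul, abs_of_pos (by positivity), sub_sub_cancel, mul_assoc, ← mul_assoc (Real.exp _),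
    ← sq]
  exact mul_le_mul_of_nonneg_left (abs_thin_le (exp_neg_mem_Icc ht.le) (fun η =>
    hf.abs_addPoisson_diff_move_le _ hθ hs η x y z) ξ) (by positivity)

end SteinDifferences

/-! ### The constants -/

section Constants

lemma integral_Ioo_eq_interval (F : ℝ → ℝ) : ∫ u in Ioo (0 : ℝ) 1, F u = ∫ u in (0 : ℝ)..1, F u := by
  rw [intervalIntegral.integral_of_le zero_le_one, integral_Ioc_eq_integral_Ioo]

lemma intervalIntegrable_of_Ioo {F : ℝ → ℝ} (hF : IntegrableOn F (Ioo 0 1)) {a b : ℝ}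
    (ha : 0 ≤ a) (hab : a ≤ b) (hb : b ≤ 1) : IntervalIntegrable F volume a b := by
  rw [intervalIntegrable_iff_integrableOn_Ioo_of_le hab]
  exact hF.mono_set (Ioo_subset_Ioo ha hb)

lemma intervalIntegrable_rpow_zero {r : ℝ} (hr : -1 < r) (a b : ℝ) :
    IntervalIntegrable (fun u : ℝ => u ^ r) volume a b := intervalIntegral.intervalIntegrable_rpow' hr

lemma firstDiffIntegral_le_one {θ l : ℝ} (hl : 0 < l) : firstDiffIntegral θ l ≤ 1 := by
  unfold firstDiffIntegral
  refine (setIntegral_mono_on (integrableOn_firstDiffIntegral hl) (integrableOn_const (by simp)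
    (C := (1 : ℝ))) measurableSet_Ioo fun u _ => min_le_left _ _).trans_eq ?_
  simp

lemma secondDiffIntegral_le_one {θ l : ℝ} (hl : 0 < l) : secondDiffIntegral θ l ≤ 1 := by
  unfold secondDiffIntegral
  have hi := integrableOn_secondDiffIntegral (θ := θ) hl
  rw [integral_Ioo_eq_interval]
  have hg : IntervalIntegrable (fun u : ℝ => (1 - u) * 2) volume 0 1 :=
    Continuous.intervalIntegrable (by fun_prop) _ _
  refine (intervalIntegral.integral_mono_on_of_le_Ioo zero_le_one
    (intervalIntegrable_of_Ioo hi le_rfl zero_le_one le_rfl) hg fun u hu =>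
    mul_le_mul_of_nonneg_left (min_le_left _ _) (sub_nonneg.2 hu.2.le)).trans_eq ?_
  rw [intervalIntegral.integral_mul_const, intervalIntegral.integral_sub (by simp) (by simp)]
  norm_num

lemma secondDiffIntegral_nonneg {θ l : ℝ} (hl : 0 < l) : 0 ≤ secondDiffIntegral θ l :=
  setIntegral_nonneg measurableSet_Ioo fun _ hu => mul_nonneg (sub_nonneg.2 hu.2.le)
    (le_min zero_le_two (mul_nonneg (secondDiffFactor_pos θ).le
      (Real.rpow_nonneg (mul_nonneg hl.le hu.1.le) _)))

/-- Drop the bound 2; for p > 1 the power u^{-1/p} is integrable at 0, and ∫ (1 - u) u^{-1/p} du =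
p²/((p - 1)(2p - 1)). -/
lemma secondDiffIntegral_le_gammaTwo {p l : ℝ} (hp : 1 < p) (hl : 0 < l) :
    secondDiffIntegral (1 / p) l ≤ gammaTwo p * l ^ (-1 / p) := by
  have hp0 : 0 < p := by linarith
  have hθ : 1 / p < 1 := by rw [div_lt_one hp0]; exact hp
  unfold secondDiffIntegral
  rw [integral_Ioo_eq_interval]
  set K := secondDiffFactor (1 / p) with hK
  have h1 := intervalIntegrable_rpow_zero (r := -(1 / p)) (by linarith) 0 1
  have h2 := intervalIntegrable_rpow_zero (r := 1 - 1 / p) (by linarith) 0 1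
  have hle : ∀ u ∈ Ioo (0 : ℝ) 1, (1 - u) * min 2 (K * (l * u) ^ (-(1 / p)))
      ≤ K * l ^ (-(1 / p)) * (u ^ (-(1 / p)) - u ^ (1 - 1 / p)) := fun u hu => by
    have e : u ^ (1 - 1 / p) = u * u ^ (-(1 / p)) := by
      rw [sub_eq_add_neg, Real.rpow_add hu.1, Real.rpow_one]
    rw [e]
    refine (mul_le_mul_of_nonneg_left (min_le_right _ _) (sub_nonneg.2 hu.2.le)).trans_eq ?_
    rw [Real.mul_rpow hl.le hu.1.le]; ring
  refine (intervalIntegral.integral_mono_on_of_le_Ioo zero_le_one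
    (intervalIntegrable_of_Ioo (integrableOn_secondDiffIntegral hl) le_rfl zero_le_one le_rfl)
    ((h1.sub h2).const_mul _) hle).trans_eq ?_
  rw [intervalIntegral.integral_const_mul, intervalIntegral.integral_sub h1 h2,
    integral_rpow (Or.inl (by linarith)), integral_rpow (Or.inl (by linarith)),
    Real.zero_rpow (by linarith), Real.zero_rpow (by linarith), Real.one_rpow, Real.one_rpow,
    neg_div]
  unfold gammaTwo
  rw [hK, secondDiffFactor]
  have h3 : p - 1 ≠ 0 := by linarith
  have h4 : 2 * p - 1 ≠ 0 := by linarith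
  have h5 : (1 - 0) / (-(1 / p) + 1) - (1 - 0) / (1 - 1 / p + 1)
      = p ^ 2 / ((p - 1) * (2 * p - 1)) := by
    have e1 : -(1 / p) + 1 = (p - 1) / p := by field_simp; ring
    have e2 : 1 - 1 / p + 1 = (2 * p - 1) / p := by field_simp; ring
    rw [e1, e2, sub_zero, one_div_div, one_div_div, div_sub_div _ _ h3 h4]; congr 1; ring
  rw [h5]; ring

lemma secondDiffIntegral_one_le {l : ℝ} (hl : 0 < l) :
    secondDiffIntegral 1 l ≤ 11 / 6 * (1 + 2 * Real.posLog (6 * l / 11)) * l⁻¹ := by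
  have hpl := Real.posLog_nonneg (x := 6 * l / 11)
  rcases le_or_gt l (11 / 6) with h | h
  · refine (secondDiffIntegral_le_one hl).trans ?_
    rw [← div_eq_mul_inv, le_div_iff₀ hl]
    linarith
  -- At u = c the two branches of the minimum coincide: (11/3)/(l u) = 2. The two pieces add up to
  -- c² - 2c log c, and c² ≤ c.
  set c := 11 / 6 / l with hc
  have hc0 : 0 < c := by positivity
  have hc1 : c ≤ 1 := (div_le_one hl).2 h.le
  have hlog : Real.posLog (6 * l / 11) = -Real.log c := by
    rw [← Real.log_inv, hc, Real.posLog_eq_log (by rw [abs_of_pos (by positivity)]; linarith)]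
    congr 1; field_simp
  have hK : secondDiffFactor 1 = 11 / 3 := by
    unfold secondDiffFactor; norm_num
  have hi := integrableOn_secondDiffIntegral (θ := 1) hl
  unfold secondDiffIntegral
  rw [integral_Ioo_eq_interval, ← intervalIntegral.integral_add_adjacent_intervals
    (intervalIntegrable_of_Ioo hi le_rfl hc0.le hc1) (intervalIntegrable_of_Ioo hi hc0.le hc1 le_rfl)]
  have h1 : ∫ u in (0 : ℝ)..c, (1 - u) * min 2 (secondDiffFactor 1 * (l * u) ^ (-1 : ℝ))
      ≤ 2 * c - c ^ 2 := by
    refine (intervalIntegral.integral_mono_on_of_le_Ioo (g := fun u => (1 - u) * 2) hc0.le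
      (intervalIntegrable_of_Ioo hi le_rfl hc0.le hc1)
      (Continuous.intervalIntegrable (by fun_prop) _ _) fun u hu =>
      mul_le_mul_of_nonneg_left (min_le_left _ _) (by linarith [hu.2])).trans_eq ?_
    rw [intervalIntegral.integral_mul_const, intervalIntegral.integral_sub (by simp) (by simp)]
    simp; ring
  have h0 : (0 : ℝ) ∉ uIcc c 1 := by
    rw [uIcc_of_le hc1]; exact fun h => absurd h.1 (not_le.2 hc0)
  have hinv : IntervalIntegrable (fun u : ℝ => u⁻¹) volume c 1 :=
    intervalIntegral.intervalIntegrable_inv (fun u hu h => h0 (h ▸ hu)) continuousOn_id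
  have h2 : ∫ u in c..1, (1 - u) * min 2 (secondDiffFactor 1 * (l * u) ^ (-1 : ℝ))
      ≤ 2 * c * (-Real.log c - (1 - c)) := by
    refine (intervalIntegral.integral_mono_on_of_le_Ioo (g := fun u => 2 * c * (u⁻¹ - 1)) hc1
      (intervalIntegrable_of_Ioo hi hc0.le hc1 le_rfl)
      ((hinv.sub (by simp)).const_mul _) fun u hu => ?_).trans_eq ?_
    · have hu0 : 0 < u := hc0.trans hu.1
      refine (mul_le_mul_of_nonneg_left (min_le_right _ _) (by linarith [hu.2])).trans_eq ?_
      rw [hK, Real.rpow_neg_one, hc]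
      field_simp
      ring
    · rw [intervalIntegral.integral_const_mul, intervalIntegral.integral_sub hinv (by simp),
        integral_inv h0]
      simp
  have h3 : 11 / 6 * (1 + 2 * Real.posLog (6 * l / 11)) * l⁻¹ = c * (1 - 2 * Real.log c) := by
    rw [hlog, hc]; ring
  rw [h3]
  nlinarith

lemma secondDiffIntegral_le_cTwo {p : ℝ≥0∞} (hp : 1 ≤ p) {l : ℝ} (hl : 0 < l) :
    secondDiffIntegral (1 / p.toReal) l ≤ cTwo p l := by
  unfold cTwo
  split_ifs with h1 h2
  · exact secondDiffIntegral_le_one hl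
  · subst h2
    refine le_min (secondDiffIntegral_le_one hl) ?_
    simpa using secondDiffIntegral_one_le hl
  · refine le_min (secondDiffIntegral_le_one hl) (secondDiffIntegral_le_gammaTwo ?_ hl)
    have h3 : 1 < p := lt_of_le_of_ne hp (Ne.symm h2)
    rw [← ENNReal.toReal_one]
    exact (ENNReal.toReal_lt_toReal ENNReal.one_ne_top h1).2 h3

end Constants

/-! ### The constant for first differences. -/

section FirstConstant

/-- The number `√(2/e)`. -/
def sqrtTwoDivE : ℝ := Real.sqrt (2 / Real.exp 1)

lemma sqrtTwoDivE_pos : 0 < sqrtTwoDivE := Real.sqrt_pos.2 (by positivity)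

lemma inv_sqrt_two_mul_exp : (Real.sqrt (2 * Real.exp 1))⁻¹ = sqrtTwoDivE / 2 := by
  have h1 : Real.sqrt (2 * Real.exp 1) * sqrtTwoDivE = 2 := by
    rw [sqrtTwoDivE, ← Real.sqrt_mul (by positivity),
      show 2 * Real.exp 1 * (2 / Real.exp 1) = 2 ^ 2 by field_simp]
    exact Real.sqrt_sq zero_le_two
  have h2 : 0 < Real.sqrt (2 * Real.exp 1) := by positivity
  field_simp
  linarith

/-- The equation says 1/κ₀ + (2eκ₀)^{-1/2} = 1: for p = 1, κ₀ is the value of l u at which the two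
branches of the minimum in `firstDiffIntegral` meet. -/
lemma kappaZero_pos_and_eq : 1 < kappaZero ∧ kappaZero - sqrtTwoDivE * Real.sqrt kappaZero = kappaOne := by
  have he := Real.exp_pos 1
  set r := Real.sqrt (1 + 8 * Real.exp 1) with hr
  have hr2 : r ^ 2 = 1 + 8 * Real.exp 1 := Real.sq_sqrt (by positivity)
  have hr0 : 0 < r := by positivity
  have hr1 : 1 < r := by nlinarith
  have hd : 0 < 1 + 4 * Real.exp 1 - r := by nlinarith
  have hk : kappaZero = 4 * Real.exp 1 / (1 + 4 * Real.exp 1 - r) := rfl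
  have h1 : 1 < kappaZero := by rw [hk, one_lt_div hd]; linarith
  refine ⟨h1, ?_⟩
  have h2 : sqrtTwoDivE * Real.sqrt kappaZero = 2 * kappaZero - 2 := by
    rw [sqrtTwoDivE, ← Real.sqrt_mul (by positivity),
      Real.sqrt_eq_iff_mul_self_eq (by positivity) (by linarith), hk]
    -- Expressed through r = √(1 + 8e), the number κ₀ is (r + 1)/(r - 1).
    have he' : Real.exp 1 = (r ^ 2 - 1) / 8 := by linarith
    have hd2 : 1 + 4 * ((r ^ 2 - 1) / 8) - r = (r - 1) ^ 2 / 2 := by ring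
    have h3 : r - 1 ≠ 0 := by linarith
    have h4 : r + 1 ≠ 0 := by linarith
    rw [he', hd2, show r ^ 2 - 1 = (r - 1) * (r + 1) by ring]
    field_simp
    ring
  rw [h2, kappaOne]; ring

lemma one_lt_kappaZero : 1 < kappaZero := kappaZero_pos_and_eq.1

lemma kappaOne_eq : kappaOne = kappaZero - sqrtTwoDivE * Real.sqrt kappaZero :=
  kappaZero_pos_and_eq.2.symm

/-- The value of the bound on first differences for large mass. -/
def firstDiffMajorant (p l : ℝ) : ℝ :=
  sqrtTwoDivE * (Real.sqrt l)⁻¹ +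
    (if p = 1 then (kappaOne + Real.log (l / kappaZero)) / l
    else p / (p - 1) * l ^ (-(1 / p))
      - (p / (p - 1) * kappaZero ^ (1 - 1 / p) - kappaOne) / l)

lemma firstDiffMajorant_kappaZero (p : ℝ) : firstDiffMajorant p kappaZero = 1 := by
  have hk : 0 < kappaZero := by linarith [one_lt_kappaZero]
  have h1 : sqrtTwoDivE * (Real.sqrt kappaZero)⁻¹ + kappaOne / kappaZero = 1 := by
    rw [kappaOne_eq, sub_div, div_self hk.ne', mul_div_assoc, Real.sqrt_div_self', one_div]
    ring
  unfold firstDiffMajorant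
  split_ifs with hp
  · rw [div_self hk.ne', Real.log_one, add_zero, h1]
  · have h2 : kappaZero ^ (1 - 1 / p) = kappaZero * kappaZero ^ (-(1 / p)) := by
      rw [sub_eq_add_neg, Real.rpow_add hk, Real.rpow_one]
    rw [h2, sub_div, mul_left_comm, mul_div_cancel_left₀ _ hk.ne']
    linarith

/-- Cut at u = κ₀/l, bounding the minimum by 1 below the cut and by its second branch above it. The
same cut is admissible for every p, though it is the crossing point only for p = 1. -/
lemma firstDiffIntegral_le_majorant {p l : ℝ} (hp : 1 ≤ p) (hl : kappaZero ≤ l) :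
    firstDiffIntegral (1 / p) l ≤ firstDiffMajorant p l := by
  have hk := one_lt_kappaZero
  have hk0 : 0 < kappaZero := by linarith
  have hl0 : 0 < l := by linarith
  have hp0 : 0 < p := by linarith
  set w := kappaZero / l with hw
  have hw0 : 0 < w := by positivity
  have hw1 : w ≤ 1 := (div_le_one hl0).2 hl
  have hi := integrableOn_firstDiffIntegral (θ := 1 / p) hl0
  have h0 : (0 : ℝ) ∉ uIcc w 1 := by
    rw [uIcc_of_le hw1]; exact fun h => absurd h.1 (not_le.2 hw0)
  have hrp : ∀ r : ℝ, IntervalIntegrable (fun u : ℝ => u ^ r) volume w 1 := fun r =>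
    intervalIntegral.intervalIntegrable_rpow (Or.inr h0)
  unfold firstDiffIntegral
  rw [integral_Ioo_eq_interval, ← intervalIntegral.integral_add_adjacent_intervals
    (intervalIntegrable_of_Ioo hi le_rfl hw0.le hw1) (intervalIntegrable_of_Ioo hi hw0.le hw1 le_rfl)]
  have h1 := intervalIntegral.integral_mono_on_of_le_Ioo hw0.le
    (intervalIntegrable_of_Ioo hi le_rfl hw0.le hw1) (g := fun _ => 1) (by simp)
    fun u _ => min_le_left _ _
  have h2 := intervalIntegral.integral_mono_on_of_le_Ioo hw1
    (intervalIntegrable_of_Ioo hi hw0.le hw1 le_rfl)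
    (g := fun u => l ^ (-(1 / p)) * u ^ (-(1 / p))
      + sqrtTwoDivE / 2 * (Real.sqrt l)⁻¹ * u ^ (-(1 / 2) : ℝ))
    (((hrp _).const_mul _).add ((hrp _).const_mul _)) fun u hu => by
      have hu0 : 0 < u := hw0.trans hu.1
      refine (min_le_right _ _).trans_eq ?_
      rw [Real.mul_rpow hl0.le hu0.le, Real.sqrt_mul (by positivity), Real.sqrt_mul hl0.le,
        mul_inv, mul_inv, inv_sqrt_two_mul_exp, Real.rpow_neg hu0.le (1 / 2), ← Real.sqrt_eq_rpow,
        mul_assoc]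
  rw [intervalIntegral.integral_add ((hrp _).const_mul _) ((hrp _).const_mul _),
    intervalIntegral.integral_const_mul, intervalIntegral.integral_const_mul,
    integral_rpow (r := -(1 / 2)) (Or.inl (by norm_num)), Real.one_rpow] at h2
  rw [intervalIntegral.integral_const, smul_eq_mul, mul_one, sub_zero] at h1
  have h3 : w ^ (-(1 / 2) + 1 : ℝ) = Real.sqrt kappaZero / Real.sqrt l := by
    rw [show (-(1 / 2) + 1 : ℝ) = 1 / 2 by norm_num, ← Real.sqrt_eq_rpow, hw,
      Real.sqrt_div hk0.le]
  have h4 : sqrtTwoDivE / 2 * (Real.sqrt l)⁻¹ * ((1 - w ^ (-(1 / 2) + 1 : ℝ)) / (-(1 / 2) + 1))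
      = sqrtTwoDivE * (Real.sqrt l)⁻¹ + (kappaOne - kappaZero) / l := by
    rw [h3, kappaOne_eq]
    have hs : 0 < Real.sqrt l := by positivity
    have hs2 : Real.sqrt l ^ 2 = l := Real.sq_sqrt hl0.le
    rw [← hs2, Real.sqrt_sq hs.le]
    field_simp
    ring
  rw [h4] at h2
  refine (add_le_add h1 h2).trans_eq ?_
  unfold firstDiffMajorant
  split_ifs with hp1
  · subst hp1
    simp only [div_one, Real.rpow_neg_one]
    rw [integral_inv h0, hw, one_div_div]
    ring
  · have hp2 : 1 < p := lt_of_le_of_ne hp (Ne.symm hp1)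
    have hθ : 1 / p < 1 := (div_lt_one hp0).2 hp2
    rw [integral_rpow (Or.inl (by linarith)), Real.one_rpow, hw,
      Real.div_rpow hk0.le hl0.le, neg_add_eq_sub, Real.rpow_sub hl0, Real.rpow_one,
      show 1 - 1 / p = (p - 1) / p by field_simp, Real.rpow_neg hl0.le]
    have h5 : 0 < l ^ (1 / p) := Real.rpow_pos_of_pos hl0 _
    have h6 : p - 1 ≠ 0 := by linarith
    field_simp
    ring

/-- The right side is the tangent to the concave function C z^τ whose intercept is D. It lets a
negative term -D/l absorb part of an intermediate power of l. -/
lemma weighted_mean_bound {C D z τ : ℝ} (hC : 0 < C) (hD : 0 < D) (hz : 0 < z) (hτ : 0 < τ)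
    (hτ1 : τ ≤ 1) :
    C * z ^ τ ≤ D + τ * C * (C * (1 - τ) / D) ^ ((1 - τ) / τ) * z := by
  rcases eq_or_lt_of_le hτ1 with rfl | hlt
  -- For τ = 1 base and exponent both vanish, and `0 ^ 0 = 1`; this is the convention for p = 2 in
  -- the constant.
  · simp only [Real.rpow_one, sub_self, mul_zero, zero_div, div_one, Real.rpow_zero]
    linarith
  have h1 : 0 < 1 - τ := sub_pos.2 hlt
  set x := C * (1 - τ) / D with hx
  have hx0 : 0 < x := by positivity
  have hxp : 0 < x ^ (1 / τ) := Real.rpow_pos_of_pos hx0 _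
  have h2 := rpow_one_add_le_one_add_mul_self (s := x ^ (1 / τ) * z - 1) (p := τ)
    (by linarith [mul_pos hxp hz]) hτ.le hτ1
  rw [add_sub_cancel, Real.mul_rpow hxp.le hz.le, ← Real.rpow_mul hx0.le, one_div_mul_cancel hτ.ne',
    Real.rpow_one] at h2
  have h3 : x ^ (1 / τ) = x ^ ((1 - τ) / τ) * x := by
    nth_rewrite 3 [← Real.rpow_one x]
    rw [← Real.rpow_add hx0]; congr 1; field_simp; ring
  rw [h3] at h2
  have h4 := mul_le_mul_of_nonneg_left h2 (by positivity : 0 ≤ D / (1 - τ))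
  have h5 : D / (1 - τ) * x = C := by rw [hx]; field_simp
  calc C * z ^ τ = D / (1 - τ) * (x * z ^ τ) := by rw [← mul_assoc, h5]
    _ ≤ _ := h4
    _ = D + τ * (D / (1 - τ) * x) * x ^ ((1 - τ) / τ) * z := by field_simp; ring
    _ = _ := by rw [h5]

/-- With y = (l/(κ₀ e^{κ₀}))^{1/2} the numerator κ₁ + log(l/κ₀) equals 2(1 + log y), which is at
most 2y. -/
lemma firstDiffMajorant_one_le {l : ℝ} (hl : 0 < l) :
    firstDiffMajorant 1 l ≤ gammaOne 1 * l ^ (-(1 / 2) : ℝ) := by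
  have hk : 0 < kappaZero := by linarith [one_lt_kappaZero]
  unfold firstDiffMajorant gammaOne
  rw [if_pos rfl, if_pos rfl, add_mul, Real.rpow_neg hl.le, ← Real.sqrt_eq_rpow]
  refine add_le_add le_rfl ?_
  set m := kappaZero * Real.exp kappaZero with hm
  have hm0 : 0 < m := by positivity
  set y := Real.sqrt l / Real.sqrt m with hy
  have hy0 : 0 < y := by positivity
  have h1 : kappaOne + Real.log (l / kappaZero) = 2 * (Real.log y + 1) := by
    rw [hy, Real.log_div (Real.sqrt_pos.2 hl).ne' (Real.sqrt_pos.2 hm0).ne', Real.log_sqrt hl.le, Real.log_sqrt hm0.le,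
      hm, Real.log_mul hk.ne' (Real.exp_pos _).ne', Real.log_exp, Real.log_div hl.ne' hk.ne',
      kappaOne]
    ring
  have h2 := Real.log_le_sub_one_of_pos hy0
  rw [Real.rpow_neg hm0.le, ← Real.sqrt_eq_rpow, h1, div_le_iff₀ hl]
  have h3 : 2 * (Real.sqrt m)⁻¹ * (Real.sqrt l)⁻¹ * l = 2 * y := by
    have hs : 0 < Real.sqrt l := by positivity
    nth_rewrite 2 [← Real.sq_sqrt hl.le]
    rw [hy]; field_simp
  rw [h3]; linarith

/-- For 1 < p the majorant contains l^{-1/2}, l^{-1/p} and -A/l. One power is kept and the other is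
absorbed by `weighted_mean_bound` with D = A: for p ≤ 2 take z = √l and keep l^{-1/2}; for p > 2
take z = l^{1 - 1/p} and keep l^{-1/p}. -/
lemma firstDiffMajorant_le_gammaOne {p l : ℝ} (hp : 1 ≤ p) (hl : 0 < l) :
    firstDiffMajorant p l ≤ gammaOne p * l ^ (-1 / max 2 p) := by
  have hk := one_lt_kappaZero
  have hk0 : 0 < kappaZero := by linarith
  have hp0 : 0 < p := by linarith
  rcases eq_or_lt_of_le hp with rfl | hp1
  · rw [max_eq_left (by norm_num), neg_div]
    exact firstDiffMajorant_one_le hl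
  have hp1' : p ≠ 1 := hp1.ne'
  have hp2 : 0 < p - 1 := by linarith
  set A := p / (p - 1) * kappaZero ^ (1 - 1 / p) - kappaOne with hA
  have hA0 : 0 < A := by
    have h1 : 1 ≤ p / (p - 1) := by rw [le_div_iff₀ hp2]; linarith
    have h2 : 1 ≤ kappaZero ^ (1 - 1 / p) := Real.one_le_rpow hk.le
      (sub_nonneg.2 ((div_le_one hp0).2 hp))
    have h3 : kappaOne < 1 := by unfold kappaOne; linarith
    nlinarith
  have hA1 : p * kappaZero ^ (1 - 1 / p) - kappaOne * (p - 1) = A * (p - 1) := by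
    rw [hA]; field_simp
  have hs : 0 < Real.sqrt l := by positivity
  have hs2 : Real.sqrt l * Real.sqrt l = l := Real.mul_self_sqrt hl.le
  have hl1 : l ^ (1 - 1 / p) = l * l ^ (-(1 / p)) := by
    rw [sub_eq_add_neg, Real.rpow_add hl, Real.rpow_one]
  have hlp : 0 < l ^ (-(1 / p)) := Real.rpow_pos_of_pos hl _
  unfold firstDiffMajorant gammaOne
  rw [if_neg hp1', if_neg hp1', hA1, ← hA]
  split_ifs with h2
  · rw [max_eq_left h2, neg_div, Real.rpow_neg hl.le (1 / 2), ← Real.sqrt_eq_rpow, add_mul]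
    refine add_le_add le_rfl ?_
    have h := weighted_mean_bound (C := p / (p - 1)) (τ := 2 * (1 - 1 / p)) (by positivity) hA0 hs
      (by have := (div_lt_one hp0).2 hp1; linarith)
      (by
        have : 1 / 2 ≤ 1 / p := one_div_le_one_div_of_le hp0 h2
        linarith)
    have e1 : Real.sqrt l ^ (2 * (1 - 1 / p)) = l ^ (1 - 1 / p) := by
      rw [Real.rpow_mul hs.le, Real.rpow_two, sq, hs2]
    have e2 : (1 - 2 * (1 - 1 / p)) / (2 * (1 - 1 / p)) = (2 - p) / (2 * (p - 1)) := by
      rw [div_eq_div_iff (by have := (div_lt_one hp0).2 hp1; linarith) (by linarith)]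
      field_simp
      ring
    have e3 : p / (p - 1) * (1 - 2 * (1 - 1 / p)) / A = (2 - p) / (A * (p - 1)) := by
      field_simp
      ring
    have e4 : 2 * (1 - 1 / p) * (p / (p - 1)) = 2 := by field_simp
    rw [e1, e2, e3, e4, hl1] at h
    set G := ((2 - p) / (A * (p - 1))) ^ ((2 - p) / (2 * (p - 1)))
    have e5 : 2 * G * (Real.sqrt l)⁻¹ = 2 * G * Real.sqrt l / l := by
      nth_rewrite 3 [← hs2]; field_simp
    rw [e5, sub_le_iff_le_add, ← add_div, le_div_iff₀ hl]
    linarith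
  · have h3 : 2 < p := not_le.1 h2
    have h4 : 0 < p - 2 := by linarith
    have hτ : 0 < p / (2 * (p - 1)) := by positivity
    rw [max_eq_right h3.le, neg_div, one_div (Real.sqrt _), inv_sqrt_two_mul_exp, mul_comm (Real.sqrt _),
      ← div_div (p - 2), div_eq_mul_inv _ (Real.sqrt _), inv_sqrt_two_mul_exp]
    have h := weighted_mean_bound (z := l ^ (1 - 1 / p)) (C := sqrtTwoDivE)
      (τ := p / (2 * (p - 1))) sqrtTwoDivE_pos hA0 (Real.rpow_pos_of_pos hl _) hτ
      (by rw [div_le_one (by positivity)]; linarith)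
    have e1 : (l ^ (1 - 1 / p)) ^ (p / (2 * (p - 1))) = Real.sqrt l := by
      rw [← Real.rpow_mul hl.le, Real.sqrt_eq_rpow]
      congr 1; field_simp
    have e2 : (1 - p / (2 * (p - 1))) / (p / (2 * (p - 1))) = (p - 2) / p := by
      field_simp
      ring
    have e3 : sqrtTwoDivE * (1 - p / (2 * (p - 1))) / A
        = (p - 2) / (A * (p - 1)) * (sqrtTwoDivE / 2) := by
      field_simp
      ring
    have e4 : p / (2 * (p - 1)) * sqrtTwoDivE = sqrtTwoDivE / 2 * (p / (p - 1)) := by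
      field_simp
    rw [e1, e2, e3, e4, hl1] at h
    set G := ((p - 2) / (A * (p - 1)) * (sqrtTwoDivE / 2)) ^ ((p - 2) / p)
    have e5 : sqrtTwoDivE * (Real.sqrt l)⁻¹ = sqrtTwoDivE * Real.sqrt l / l := by
      nth_rewrite 3 [← hs2]; field_simp
    have e6 : sqrtTwoDivE * Real.sqrt l / l
        ≤ A / l + sqrtTwoDivE / 2 * (p / (p - 1)) * G * l ^ (-(1 / p)) := by
      rw [div_le_iff₀ hl, add_mul, div_mul_cancel₀ _ hl.ne']
      linarith
    rw [e5]
    linarith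

lemma firstDiffIntegral_le_cOne {p : ℝ≥0∞} (hp : 1 ≤ p) {l : ℝ} (hl : 0 < l) :
    firstDiffIntegral (1 / p.toReal) l ≤ cOne p l := by
  unfold cOne
  split_ifs with h1
  · exact firstDiffIntegral_le_one hl
  have hp' : 1 ≤ p.toReal := by
    rw [← ENNReal.toReal_one]
    exact (ENNReal.toReal_le_toReal ENNReal.one_ne_top h1).2 hp
  set q := p.toReal
  have hk0 : 0 < kappaZero := by linarith [one_lt_kappaZero]
  refine le_min (firstDiffIntegral_le_one hl) ?_
  rcases le_total kappaZero l with h | h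
  · exact (firstDiffIntegral_le_majorant hp' h).trans (firstDiffMajorant_le_gammaOne hp' hl)
  -- At l = κ₀ the majorant equals 1, so the bound with γ₁ is at least 1 there; being decreasing in
  -- l, it is at least 1 for all smaller masses.
  · refine (firstDiffIntegral_le_one hl).trans ?_
    have h2 := firstDiffMajorant_le_gammaOne hp' hk0
    rw [firstDiffMajorant_kappaZero] at h2
    have h3 : 0 < kappaZero ^ (-1 / max 2 q) := Real.rpow_pos_of_pos hk0 _
    have h4 : 0 < gammaOne q := pos_of_mul_pos_left (by linarith) h3.le
    refine h2.trans (mul_le_mul_of_nonneg_left (Real.rpow_le_rpow_of_nonpos hl h ?_) h4.le)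
    rw [neg_div]
    exact neg_nonpos.2 (div_nonneg zero_le_one (le_max_of_le_left zero_le_two))

end FirstConstant

/-! ### Lipschitz continuity with respect to `d₁'` -/

section DOnePrime

variable {X : Type*} [MetricSpace X] {g : PointMeasure X → ℝ} {c : ℝ}

lemma add_cons_eq {Y : Type*} (ζ R : Multiset Y) (a : Y) : ζ + a ::ₘ R = ζ + R + {a} := by
  rw [← Multiset.singleton_add, add_comm ({a} : Multiset Y), add_assoc]

lemma abs_sub_map_fst_snd_le (hmove : ∀ ξ y z, |g (ξ + {y}) - g (ξ + {z})| ≤ c * dist y z)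
    (P : Multiset (X × X)) (ζ : PointMeasure X) :
    |g (ζ + P.map Prod.fst) - g (ζ + P.map Prod.snd)| ≤ c * (P.map fun z => dist z.1 z.2).sum := by
  induction P using Multiset.induction_on generalizing ζ with
  | empty => simp
  | cons a P ih =>
    have h1 := ih (ζ + {a.1})
    have h2 := hmove (ζ + P.map Prod.snd) a.1 a.2
    rw [add_right_comm ζ {a.1} (P.map Prod.fst), add_right_comm ζ {a.1} (P.map Prod.snd)] at h1
    simp only [Multiset.map_cons, Multiset.sum_cons, add_cons_eq]
    rw [abs_le] at *
    constructor <;> linarith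

omit [MetricSpace X] in
lemma abs_add_sub_le (hadd : ∀ ξ y, |g (ξ + {y}) - g ξ| ≤ c) (R ζ : PointMeasure X) :
    |g (ζ + R) - g ζ| ≤ c * Multiset.card R := by
  induction R using Multiset.induction_on generalizing ζ with
  | empty => simp
  | cons a R ih =>
    have h1 := ih ζ
    have h2 := hadd (ζ + R) a
    rw [add_cons_eq, Multiset.card_cons]
    push_cast
    rw [abs_le] at *
    constructor <;> linarith

/-- For any pair of enumerations, move the paired points one by one and then add the unmatched
points `R` of `η`; take the infimum at the end. -/
lemma abs_sub_le_dOnePrimeAux (hc : 0 ≤ c)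
    (hmove : ∀ ξ y z, |g (ξ + {y}) - g (ξ + {z})| ≤ c * dist y z)
    (hadd : ∀ ξ y, |g (ξ + {y}) - g ξ| ≤ c) (ξ η : PointMeasure X)
    (hle : Multiset.card ξ ≤ Multiset.card η) : |g ξ - g η| ≤ c * dOnePrimeAux ξ η hle := by
  obtain ⟨x₀, hx₀⟩ := exists_enumerates ξ
  obtain ⟨y₀, hy₀⟩ := exists_enumerates η
  have key : ∀ (x : Fin (Multiset.card ξ) → X) (y : Fin (Multiset.card η) → X),
      Enumerates x ξ → Enumerates y η → |g ξ - g η|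
        ≤ c * ((Multiset.card η : ℝ) - Multiset.card ξ)
          + c * ∑ i, dist (x i) (y (Fin.castLE hle i)) := by
    intro x y hx hy
    let P : Multiset (X × X) :=
      (Finset.univ : Finset (Fin (Multiset.card ξ))).val.map fun i => (x i, y (Fin.castLE hle i))
    have hP1 : P.map Prod.fst = ξ := by
      rw [← hx]; simp only [P, Multiset.map_map, Function.comp_def]
    have hsub : P.map Prod.snd ≤ η := by
      have h1 : P.map Prod.snd = (((Finset.univ : Finset (Fin (Multiset.card ξ))).map
          (Fin.castLEEmb hle)).val).map y := by
        simp only [P, Multiset.map_map, Function.comp_def, Finset.map_val]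
        rfl
      rw [h1]
      refine (Multiset.map_le_map (Finset.val_le_iff.2 (Finset.subset_univ _))).trans_eq hy
    obtain ⟨R, hR⟩ := Multiset.le_iff_exists_add.1 hsub
    have hcard : (Multiset.card R : ℝ) = Multiset.card η - Multiset.card ξ := by
      have h2 : Multiset.card η = Multiset.card ξ + Multiset.card R := by
        have h1 : Multiset.card ξ = Multiset.card (P.map Prod.snd) :=
          (congrArg Multiset.card hP1).symm.trans (by simp only [Multiset.card_map])
        rw [h1, ← Multiset.card_add, ← hR]
      rw [h2]; push_cast; ring
    have h3 := abs_sub_map_fst_snd_le hmove P 0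
    have h4 := abs_add_sub_le hadd R (P.map Prod.snd)
    have h5 : (P.map fun z => dist z.1 z.2).sum = ∑ i, dist (x i) (y (Fin.castLE hle i)) := by
      simp only [P, Multiset.map_map, Function.comp_def]
      rfl
    rw [zero_add, zero_add, hP1, h5] at h3
    rw [← hR, hcard] at h4
    rw [abs_le] at *
    constructor <;> linarith
  unfold dOnePrimeAux
  rw [mul_add]
  -- The infimum is compared after dividing by c, so c = 0 is treated separately.
  rcases hc.eq_or_lt with rfl | hc0
  · simpa using key x₀ y₀ hx₀ hy₀
  rw [← sub_le_iff_le_add', ← div_le_iff₀' hc0]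
  refine le_csInf ⟨_, x₀, y₀, hx₀, hy₀, rfl⟩ ?_
  rintro r ⟨x, y, hx, hy, rfl⟩
  rw [div_le_iff₀' hc0, sub_le_iff_le_add']
  exact key x y hx hy

lemma abs_sub_le_dOnePrime (hc : 0 ≤ c)
    (hmove : ∀ ξ y z, |g (ξ + {y}) - g (ξ + {z})| ≤ c * dist y z)
    (hadd : ∀ ξ y, |g (ξ + {y}) - g ξ| ≤ c) (ξ η : PointMeasure X) :
    |g ξ - g η| ≤ c * dOnePrime ξ η := by
  unfold dOnePrime
  split_ifs with hle
  · exact abs_sub_le_dOnePrimeAux hc hmove hadd ξ η hle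
  · rw [abs_sub_comm]
    exact abs_sub_le_dOnePrimeAux hc hmove hadd η ξ _

end DOnePrime

lemma powerLipschitz_of_mem_lipClass {X : Type*} [MetricSpace X] {p : ℝ≥0∞} (hp : 1 ≤ p)
    {f : PointMeasure X → ℝ} (hf : f ∈ lipClass X p) : PowerLipschitz (1 / p.toReal) f where
  mem_Icc := hf.1
  pointLipschitz := pointLipschitz_of_mem_lipClass hp hf
  abs_sub_le := abs_sub_le_of_mem_lipClass hp hf

lemma one_div_toReal_mem_Icc {p : ℝ≥0∞} (hp : 1 ≤ p) : 1 / p.toReal ∈ Icc (0 : ℝ) 1 := by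
  refine ⟨by positivity, ?_⟩
  rcases eq_or_ne p ∞ with rfl | h
  · simp
  have h1 : 1 ≤ p.toReal := by
    rw [← ENNReal.toReal_one]
    exact (ENNReal.toReal_le_toReal ENNReal.one_ne_top h).2 hp
  exact (div_le_one (by linarith)).2 h1

end PoissonStein

end

theorem proposition3 {X : Type*} [MetricSpace X] [CompactSpace X] [MeasurableSpace X]
    [BorelSpace X] (hdist : ∀ x y : X, dist x y ≤ 1)
    (lam : Measure X) [IsFiniteMeasure lam] [NeZero lam]
    (p : ℝ≥0∞) (hp : 1 ≤ p) (f : PointMeasure X → ℝ) (hf : f ∈ lipClass X p) :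
    -- the function `h_f` is well defined: all the integrals in its definition exist
    (Integrable f (poissonProcess lam) ∧
      (∀ (ξ : PointMeasure X) (t : ℝ), 0 ≤ t →
        Integrable (fun ω => f (stateAt t ω)) (pathLaw lam ξ)) ∧
      (∀ ξ : PointMeasure X, IntegrableOn (meanDeviation lam f ξ) (Ioi 0))) ∧
    -- (i)
    firstDiffNorm (steinSolution lam f) ≤ ENNReal.ofReal (cOne p (lam.real univ)) ∧
    -- (ii)
    secondDiffNorm (steinSolution lam f) ≤ ENNReal.ofReal (cTwo p (lam.real univ)) ∧
    -- (iii)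
    ∀ (ξ η : PointMeasure X) (x : X),
      |(steinSolution lam f (ξ + {x}) - steinSolution lam f ξ)
          - (steinSolution lam f (η + {x}) - steinSolution lam f η)|
        ≤ cTwo p (lam.real univ) * dOnePrime ξ η := by
  have hP := powerLipschitz_of_mem_lipClass hp hf
  have hU := hP.toUnitLipschitz
  have hθ := one_div_toReal_mem_Icc hp
  have hl := lam_real_pos lam
  have hc1 := firstDiffIntegral_le_cOne hp hl
  have hc2 := secondDiffIntegral_le_cTwo hp hl
  have h0 := secondDiffIntegral_nonneg (θ := 1 / p.toReal) hl
  refine ⟨⟨hU.integrable_poissonProcess lam, fun ξ t _ => integrable_comp_stateAt lam hU t ξ,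
    integrableOn_meanDeviation lam hU⟩, ?_, ?_, fun ξ η x => ?_⟩
  · unfold firstDiffNorm
    refine iSup₂_le fun ξ x => ?_
    exact ENNReal.ofReal_le_ofReal
      ((abs_steinSolution_sub_le lam hθ hP hdist ξ x).trans hc1)
  · unfold secondDiffNorm
    refine iSup₂_le fun ξ x => iSup_le fun y => ?_
    exact ENNReal.ofReal_le_ofReal
      ((abs_steinSolution_second_diff_le lam hθ hP hdist ξ x y).trans hc2)
  -- Apply the transport argument to ζ ↦ h(ζ + δ_x) - h(ζ): moving a point is controlled by
  -- `abs_steinSolution_diff_move_le`, and adding one is a second difference of h.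
  · refine abs_sub_le_dOnePrime
      (g := fun ζ : PointMeasure X => steinSolution lam f (ζ + {x}) - steinSolution lam f ζ)
      (h0.trans hc2) (fun ζ y z => ?_) (fun ζ y => ?_) ξ η
    · exact (abs_steinSolution_diff_move_le lam hθ hP ζ x y z).trans
        (mul_le_mul_of_nonneg_right hc2 dist_nonneg)
    · have h := (abs_steinSolution_second_diff_le lam hθ hP hdist ζ y x).trans hc2
      rwa [sub_add] at h
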